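/- **Setting.** The ground field is $\mathbb{C}$. Let $n\ge 3$ and write $n=2m+r$ with $r\in\{0,1\}$. Let $V=\mathbb{C}^{n|2}$ carry a non-degenerate even bilinear form $F$, symmetric on $V_{\bar 0}=\mathbb{C}^n$ and skew-symmetric on $V_{\bar 1}=\mathbb{C}^2$, with Gram matrix on $V_{\bar 0}$ equal to $\begin{pmatrix}0&1_m\\1_m&0\end{pmatrix}$ (with an additional diagonal block $1$ if $r=1$) and on $V_{\bar 1}$ equal to $\begin{pmatrix}0&1\\-1&0\end{pmatrix}$. Let $\mathfrak{g}=\mathfrak{osp}(n|2)$ be the Lie superalgebra of endomorphisms $\xi$ (of degree $\varsigma$) with $F(\xi x,y)=-(-1)^{\varsigma\deg x}F(x,\xi y)$, let $\mathfrak h$ be its Cartan subalgebra of diagonal matrices, and let $\epsilon_1,\dots,\epsilon_m,\delta\in\mathfrak h^*$ be the functionals that take the diagonal entries at the first $m$ basis vectors of $V_{\bar 0}$ and at the first basis vector of $V_{\bar 1}$. Let $\mathfrak g=\mathfrak g_{-2}\oplus\mathfrak g_{-1}\oplus\mathfrak g_0\oplus\mathfrak g_1\oplus\mathfrak g_2$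 be the grading by the coefficient of $\delta$ in the roots, so that $\mathfrak g_0\cong\mathfrak o(n)\oplus\mathbb{C}$, and let $\mathfrak u=\mathfrak g_1\oplus\mathfrak g_2$, with $\mathfrak u_{\bar 0}=\mathfrak g_2$ and $\mathfrak u_{\bar 1}=\mathfrak g_1$. The positive roots of $\mathfrak g_0$ are $\epsilon_i\pm\epsilon_j$ $(i<j)$ and, if $r=1$, $\epsilon_i$; the odd positive roots of $\mathfrak g$ are $\Delta_1^+=\{\delta\pm\epsilon_i\}$, together with $\delta$ if $r=1$. Let $H^q(\mathfrak u)=Z^q(\mathfrak u)/B^q(\mathfrak u)$ be the cohomology of the complex $C^q(\mathfrak u)=\bigoplus_{q_0+q_1=q}\mathrm{Hom}(\wedge^{q_0}\mathfrak u_{\bar 0}\otimes S^{q_1}\mathfrak u_{\bar 1},\mathbb{C})$ with trivial coefficients, whose differential is, for $\xi_s\in\mathfrak u_{\bar 0}$ and $\eta_t\in\mathfrak u_{\bar 1}$, $$\begin{aligned}dc(\xi_1,\dots,\xi_{q_0},\eta_1,\dots,\eta_{q_1})={}&\sum_{s<t}(-1)^{s+t-1}c([\xi_s,\xi_t],\dots,\widehat{\xi_s},\dots,\widehat{\xi_t},\dots,\eta_{q_1})\\&+\sum_{s,t}(-1)^{s-1}c(\dots,\widehat{\xi_s},\dots,\xi_{q_0},[\xi_s,\eta_t],\eta_1,\dots,\widehat{\eta_t},\dots)\\&+\sum_{s<t}c([\eta_s,\eta_t],\xi_1,\dots,\xi_{q_0},\dots,\widehat{\eta_s},\dots,\widehat{\eta_t},\dots),\end{aligned}$$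 with the $\mathfrak g_0$-action induced by the adjoint action on $\mathfrak u$. **Proposition 3.4.** For every $q\ge 0$, $$H^q(\mathfrak u)\cong L^{(0)}_{q\epsilon_1-q\delta}$$ as a $\mathfrak g_0$-module, where $L^{(0)}_{\lambda}$ is the finite-dimensional irreducible $\mathfrak g_0$-module with highest weight $\lambda$. That is, $H^q(\mathfrak u)$ is a finite-dimensional irreducible $\mathfrak g_0$-module with highest weight $q\epsilon_1-q\delta$, and it is isomorphic to every such module. Moreover, there is a basis $(e_\alpha)_{\alpha\in\Delta_1^+}$ of $\mathfrak u_{\bar 1}$ with $e_\alpha\in\mathfrak g_\alpha$, with dual basis $(e_\alpha^*)$, such that for every $q\ge 0$ the map that sends a cocycle $c$ to the polynomial function $\eta\mapsto c(\eta,\dots,\eta)$ on $\mathfrak u_{\bar 1}$ is a linear isomorphism $$Z^q(\mathfrak u)\;\cong\;\mathbb{C}[e_\alpha^*\mid\alpha\in\Delta_1^+]_q$$ which carries $B^q(\mathfrak u)$ onto the degree-$q$ part of the ideal generated by the quadric $\sum_{i=1}^m e^*_{\delta-\epsilon_i}e^*_{\delta+\epsilon_i}$ if $r=0$, and $e^*_\delta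 e^*_\delta+\sum_{i=1}^m e^*_{\delta-\epsilon_i}e^*_{\delta+\epsilon_i}$ if $r=1$. -/

import Mathlib

open Matrix

set_option linter.unusedSectionVars false

/-! ### Lie superalgebras and their cohomology with trivial coefficients -/

/-- A complex Lie superalgebra with even part `U₀` and odd part `U₁`.  The bracket is given by its
components on homogeneous elements; the component odd × even is minus the component even × odd. -/
structure LieSuperStructure (U₀ U₁ : Type*) [AddCommGroup U₀] [Module ℂ U₀]
    [AddCommGroup U₁] [Module ℂ U₁] where
  /-- even × even -/
  ee : U₀ →ₗ[ℂ] U₀ →ₗ[ℂ] U₀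
  /-- even × odd -/
  eo : U₀ →ₗ[ℂ] U₁ →ₗ[ℂ] U₁
  /-- odd × odd -/
  oo : U₁ →ₗ[ℂ] U₁ →ₗ[ℂ] U₀
  ee_skew : ∀ x y, ee x y = - ee y x
  oo_symm : ∀ a b, oo a b = oo b a
  jacobi_eee : ∀ x y z, ee x (ee y z) = ee (ee x y) z + ee y (ee x z)
  jacobi_eeo : ∀ x y a, eo x (eo y a) = eo (ee x y) a + eo y (eo x a)
  jacobi_eoo : ∀ x a b, ee x (oo a b) = oo (eo x a) b + oo a (eo x b)
  jacobi_ooo : ∀ a b c, eo (oo a b) c + eo (oo b c) a + eo (oo c a) b = 0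

namespace LieSuperCohomology

section Cochains

variable (U₀ U₁ : Type*) [AddCommGroup U₀] [Module ℂ U₀] [AddCommGroup U₁] [Module ℂ U₁]

/-- Families of functions `c(ξ₁, …, ξ_p, η₁, …, η_k)` of `p` even and `k` odd arguments, one for
each pair `(p, k)`. -/
abbrev Family : Type _ := ∀ p k : ℕ, (Fin p → U₀) → (Fin k → U₁) → ℂ

variable {U₀ U₁}

/-- `f` is multilinear, alternating in the even arguments and symmetric in the odd ones, that is,
`f` is an element of `Hom(∧^p U₀ ⊗ S^k U₁, ℂ)`. -/
structure IsForm {p k : ℕ} (f : (Fin p → U₀) → (Fin k → U₁) → ℂ) : Prop where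
  add_even : ∀ ξ η i x y, f (Function.update ξ i (x + y)) η =
    f (Function.update ξ i x) η + f (Function.update ξ i y) η
  smul_even : ∀ ξ η i (a : ℂ) x, f (Function.update ξ i (a • x)) η =
    a * f (Function.update ξ i x) η
  add_odd : ∀ ξ η j x y, f ξ (Function.update η j (x + y)) =
    f ξ (Function.update η j x) + f ξ (Function.update η j y)
  smul_odd : ∀ ξ η j (a : ℂ) x, f ξ (Function.update η j (a • x)) =
    a * f ξ (Function.update η j x)
  alternating : ∀ ξ η (σ : Equiv.Perm (Fin p)),
    f (fun i => ξ (σ i)) η = (Equiv.Perm.sign σ : ℤ) * f ξ η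
  symmetric : ∀ ξ η (σ : Equiv.Perm (Fin k)), f ξ (fun j => η (σ j)) = f ξ η

variable (U₀ U₁)

/-- The space of `q`-cochains `C^q = ⨁_{p + k = q} Hom(∧^p U₀ ⊗ S^k U₁, ℂ)`. -/
def cochains (q : ℕ) : Submodule ℂ (Family U₀ U₁) where
  carrier := {c | (∀ p k, IsForm (c p k)) ∧ ∀ p k, p + k ≠ q → c p k = 0}
  zero_mem' := ⟨fun p k => by constructor <;> simp, fun p k _ => rfl⟩
  add_mem' := by
    rintro a b ⟨ha, ha'⟩ ⟨hb, hb'⟩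
    refine ⟨fun p k => ?_, fun p k h => by simp [ha' p k h, hb' p k h]⟩
    constructor <;> intros <;> simp only [Pi.add_apply]
    · rw [(ha p k).add_even, (hb p k).add_even]; ring
    · rw [(ha p k).smul_even, (hb p k).smul_even]; ring
    · rw [(ha p k).add_odd, (hb p k).add_odd]; ring
    · rw [(ha p k).smul_odd, (hb p k).smul_odd]; ring
    · rw [(ha p k).alternating, (hb p k).alternating]; ring
    · rw [(ha p k).symmetric, (hb p k).symmetric]
  smul_mem' := by
    rintro z a ⟨ha, ha'⟩
    refine ⟨fun p k => ?_, fun p k h => by simp [ha' p k h]⟩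
    constructor <;> intros <;> simp only [Pi.smul_apply, smul_eq_mul]
    · rw [(ha p k).add_even]; ring
    · rw [(ha p k).smul_even]; ring
    · rw [(ha p k).add_odd]; ring
    · rw [(ha p k).smul_odd]; ring
    · rw [(ha p k).alternating]; ring
    · rw [(ha p k).symmetric]

end Cochains

section Differential

variable {U₀ U₁ : Type*} [AddCommGroup U₀] [Module ℂ U₀] [AddCommGroup U₁] [Module ℂ U₁]
variable (S : LieSuperStructure U₀ U₁)

/-- The terms `∑_{s<t} (-1)^{s+t-1} c([ξ_s, ξ_t], …, ξ̂_s, …, ξ̂_t, …, η)` of the differential (with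
`s`, `t` counted from `1`).  A pair of positions `a < b` in `Fin (p + 2)` is written here as
`a = s`, `b = s.succAbove t` with `s ≤ t`; then `b = t + 1`, and the remaining positions are
`s.succAbove (t.succAbove j)`. -/
def dEE (c : Family U₀ U₁) : Family U₀ U₁
  | 0, _, _, _ => 0
  | 1, _, _, _ => 0
  | p + 2, k, ξ, η => ∑ s : Fin (p + 2), ∑ t : Fin (p + 1),
      if (s : ℕ) ≤ t then
        (-1 : ℂ) ^ ((s : ℕ) + t) * c (p + 1) k
          (Fin.cons (S.ee (ξ s) (ξ (s.succAbove t)))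
            fun j => ξ (s.succAbove (t.succAbove j))) η
      else 0

/-- The terms `∑_{s,t} (-1)^{s-1} c(…, ξ̂_s, …, [ξ_s, η_t], …, η̂_t, …)` of the differential (with
`s` counted from `1`). -/
def dEO (c : Family U₀ U₁) : Family U₀ U₁
  | 0, _, _, _ => 0
  | _ + 1, 0, _, _ => 0
  | p + 1, k + 1, ξ, η => ∑ s : Fin (p + 1), ∑ t : Fin (k + 1),
      (-1 : ℂ) ^ (s : ℕ) * c p (k + 1) (fun i => ξ (s.succAbove i))
        (Fin.cons (S.eo (ξ s) (η t)) fun j => η (t.succAbove j))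

/-- The terms `∑_{s<t} c([η_s, η_t], ξ, …, η̂_s, …, η̂_t, …)` of the differential; pairs of positions
are written as in `dEE`. -/
def dOO (c : Family U₀ U₁) : Family U₀ U₁
  | _, 0, _, _ => 0
  | _, 1, _, _ => 0
  | p, k + 2, ξ, η => ∑ s : Fin (k + 2), ∑ t : Fin (k + 1),
      if (s : ℕ) ≤ t then
        c (p + 1) k (Fin.cons (S.oo (η s) (η (s.succAbove t))) ξ)
          fun j => η (s.succAbove (t.succAbove j))
      else 0

/-- The differential of the cochain complex of a Lie superalgebra with coefficients in the trivial
module `ℂ`; the terms that involve the action on the coefficients are zero. -/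
def d : Family U₀ U₁ →ₗ[ℂ] Family U₀ U₁ where
  toFun c := dEE S c + dEO S c + dOO S c
  map_add' a b := by
    have h1 : dEE S (a + b) = dEE S a + dEE S b := by
      funext p k ξ η
      match p with
      | 0 => simp [dEE]
      | 1 => simp [dEE]
      | p + 2 => simp [dEE, mul_add, ← Finset.sum_add_distrib, ← ite_add_zero]
    have h2 : dEO S (a + b) = dEO S a + dEO S b := by
      funext p k ξ η
      match p, k with
      | 0, _ => simp [dEO]
      | _ + 1, 0 => simp [dEO]
      | p + 1, k + 1 => simp [dEO, mul_add, ← Finset.sum_add_distrib]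
    have h3 : dOO S (a + b) = dOO S a + dOO S b := by
      funext p k ξ η
      match k with
      | 0 => simp [dOO]
      | 1 => simp [dOO]
      | k + 2 => simp [dOO, ← Finset.sum_add_distrib, ← ite_add_zero]
    rw [h1, h2, h3]; abel
  map_smul' z a := by
    have h1 : dEE S (z • a) = z • dEE S a := by
      funext p k ξ η
      match p with
      | 0 => simp [dEE]
      | 1 => simp [dEE]
      | p + 2 => simp [dEE, Finset.mul_sum, mul_left_comm]
    have h2 : dEO S (z • a) = z • dEO S a := by
      funext p k ξ η
      match p, k with
      | 0, _ => simp [dEO]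
      | _ + 1, 0 => simp [dEO]
      | p + 1, k + 1 => simp [dEO, Finset.mul_sum, mul_left_comm]
    have h3 : dOO S (z • a) = z • dOO S a := by
      funext p k ξ η
      match k with
      | 0 => simp [dOO]
      | 1 => simp [dOO]
      | k + 2 => simp [dOO, Finset.mul_sum]
    rw [h1, h2, h3]; simp

end Differential

section Action

variable {U₀ U₁ : Type*} [AddCommGroup U₀] [Module ℂ U₀] [AddCommGroup U₁] [Module ℂ U₁]
variable {G : Type*} [LieRing G] [LieAlgebra ℂ G]
  [LieRingModule G U₀] [LieModule ℂ G U₀] [LieRingModule G U₁] [LieModule ℂ G U₁]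

/-- The natural (contragredient) action of `X` on cochains:
`(X·c)(v₁, …, v_q) = -∑ᵢ c(v₁, …, [X, vᵢ], …, v_q)`. -/
def act (X : G) : Family U₀ U₁ →ₗ[ℂ] Family U₀ U₁ where
  toFun c p k ξ η := -((∑ i, c p k (Function.update ξ i ⁅X, ξ i⁆) η) +
    ∑ j, c p k ξ (Function.update η j ⁅X, η j⁆))
  map_add' a b := by
    funext p k ξ η
    simp only [Pi.add_apply, Finset.sum_add_distrib]; ring
  map_smul' z a := by
    funext p k ξ η
    simp only [Pi.smul_apply, smul_eq_mul, ← Finset.mul_sum, RingHom.id_apply]; ring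

theorem act_apply (X : G) (c : Family U₀ U₁) (p k : ℕ) (ξ : Fin p → U₀) (η : Fin k → U₁) :
    act X c p k ξ η = -((∑ i, c p k (Function.update ξ i ⁅X, ξ i⁆) η) +
      ∑ j, c p k ξ (Function.update η j ⁅X, η j⁆)) := rfl

theorem update_comp_perm {A : Type*} {p : ℕ} (v : Fin p → A) (σ : Equiv.Perm (Fin p))
    (i : Fin p) (x : A) :
    Function.update (fun i => v (σ i)) i x = fun j => Function.update v (σ i) x (σ j) := by
  funext j
  by_cases h : j = i
  · subst h; simp
  · rw [Function.update_of_ne h, Function.update_of_ne (fun h' => h (σ.injective h'))]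

/-- One summand splits off when the `i`-th argument is a sum. -/
theorem sum_update_add {A : Type*} [AddCommGroup A] {p : ℕ} (g : (Fin p → A) → ℂ)
    (hg : ∀ v i x y, g (Function.update v i (x + y)) =
      g (Function.update v i x) + g (Function.update v i y))
    (D : A → A) (hD : ∀ x y, D (x + y) = D x + D y) (v : Fin p → A) (i : Fin p) (x y : A) :
    ∑ j, g (Function.update (Function.update v i (x + y)) j
        (D (Function.update v i (x + y) j))) =
      (∑ j, g (Function.update (Function.update v i x) j (D (Function.update v i x j)))) +
      ∑ j, g (Function.update (Function.update v i y) j (D (Function.update v i y j))) := by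
  rw [← Finset.sum_add_distrib]
  refine Finset.sum_congr rfl fun j _ => ?_
  by_cases h : j = i
  · subst h; simp [hD, hg]
  · rw [Function.update_of_ne h, Function.update_of_ne h, Function.update_of_ne h,
      Function.update_comm (Ne.symm h), Function.update_comm (Ne.symm h),
      Function.update_comm (Ne.symm h), hg]

theorem sum_update_smul {A : Type*} [AddCommGroup A] [Module ℂ A] {p : ℕ} (g : (Fin p → A) → ℂ)
    (hg : ∀ v i (a : ℂ) x, g (Function.update v i (a • x)) = a * g (Function.update v i x))
    (D : A → A) (hD : ∀ (a : ℂ) x, D (a • x) = a • D x) (v : Fin p → A) (i : Fin p)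
    (a : ℂ) (x : A) :
    ∑ j, g (Function.update (Function.update v i (a • x)) j
        (D (Function.update v i (a • x) j))) =
      a * ∑ j, g (Function.update (Function.update v i x) j (D (Function.update v i x j))) := by
  rw [Finset.mul_sum]
  refine Finset.sum_congr rfl fun j _ => ?_
  by_cases h : j = i
  · subst h; simp [hD, hg]
  · rw [Function.update_of_ne h, Function.update_of_ne h,
      Function.update_comm (Ne.symm h), Function.update_comm (Ne.symm h), hg]

theorem IsForm.act {c : Family U₀ U₁} {p k : ℕ} (h : IsForm (c p k)) (X : G) :
    IsForm (act X c p k) := by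
  constructor
  · intro ξ η i x y
    simp only [act_apply]
    rw [sum_update_add (fun v => c p k v η) (fun v i x y => h.add_even v η i x y)
      (fun u => ⁅X, u⁆) (fun x y => lie_add X x y)]
    simp only [h.add_even, Finset.sum_add_distrib]
    ring
  · intro ξ η i a x
    simp only [act_apply]
    rw [sum_update_smul (fun v => c p k v η) (fun v i a x => h.smul_even v η i a x)
      (fun u => ⁅X, u⁆) (fun a x => lie_smul a X x)]
    simp only [h.smul_even, ← Finset.mul_sum]
    ring
  · intro ξ η i x y
    simp only [act_apply]
    rw [sum_update_add (fun v => c p k ξ v) (fun v i x y => h.add_odd ξ v i x y)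
      (fun u => ⁅X, u⁆) (fun x y => lie_add X x y)]
    simp only [h.add_odd, Finset.sum_add_distrib]
    ring
  · intro ξ η i a x
    simp only [act_apply]
    rw [sum_update_smul (fun v => c p k ξ v) (fun v i a x => h.smul_odd ξ v i a x)
      (fun u => ⁅X, u⁆) (fun a x => lie_smul a X x)]
    simp only [h.smul_odd, ← Finset.mul_sum]
    ring
  · intro ξ η σ
    simp only [act_apply, update_comp_perm, h.alternating, ← Finset.mul_sum]
    rw [Equiv.sum_comp σ (fun i => c p k (Function.update ξ i ⁅X, ξ i⁆) η)]
    ring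
  · intro ξ η σ
    simp only [act_apply, update_comp_perm, h.symmetric]
    rw [Equiv.sum_comp σ (fun i => c p k ξ (Function.update η i ⁅X, η i⁆))]

theorem act_mem (q : ℕ) (X : G) {c : Family U₀ U₁} (hc : c ∈ cochains U₀ U₁ q) :
    act X c ∈ cochains U₀ U₁ q := by
  refine ⟨fun p k => (hc.1 p k).act X, fun p k h => ?_⟩
  funext ξ η
  simp [act_apply, hc.2 p k h]

theorem act_add (q : ℕ) (X Y : G) {c : Family U₀ U₁} (hc : c ∈ cochains U₀ U₁ q) :
    act (X + Y) c = act X c + act Y c := by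
  funext p k ξ η
  simp only [act_apply, Pi.add_apply, add_lie, (hc.1 p k).add_even, (hc.1 p k).add_odd,
    Finset.sum_add_distrib]
  ring

theorem act_smul (q : ℕ) (z : ℂ) (X : G) {c : Family U₀ U₁} (hc : c ∈ cochains U₀ U₁ q) :
    act (z • X) c = z • act X c := by
  funext p k ξ η
  simp only [act_apply, Pi.smul_apply, smul_lie, (hc.1 p k).smul_even, (hc.1 p k).smul_odd,
    ← Finset.mul_sum, smul_eq_mul]
  ring

theorem sum_sum_update {A : Type*} [AddCommGroup A] {p : ℕ} (g : (Fin p → A) → ℂ)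
    (hg : ∀ v i x y, g (Function.update v i (x + y)) =
      g (Function.update v i x) + g (Function.update v i y))
    (D E B : A → A) (hB : ∀ x, B x + E (D x) = D (E x)) (v : Fin p → A) :
    (∑ i, ∑ j, g (Function.update (Function.update v i (D (v i))) j
        (E (Function.update v i (D (v i)) j)))) + ∑ i, g (Function.update v i (B (v i))) =
    ∑ i, ∑ j, g (Function.update (Function.update v i (E (v i))) j
        (D (Function.update v i (E (v i)) j))) := by
  conv_rhs => rw [Finset.sum_comm]
  rw [← Finset.sum_add_distrib]
  refine Finset.sum_congr rfl fun i _ => ?_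
  rw [← Finset.add_sum_erase _ _ (Finset.mem_univ i),
    ← Finset.add_sum_erase (a := i) Finset.univ (fun j => g (Function.update
      (Function.update v j (E (v j))) i (D (Function.update v j (E (v j)) i)))) (Finset.mem_univ i)]
  have : ∀ j ∈ Finset.univ.erase i,
      g (Function.update (Function.update v i (D (v i))) j
        (E (Function.update v i (D (v i)) j))) =
      g (Function.update (Function.update v j (E (v j))) i
        (D (Function.update v j (E (v j)) i))) := by
    intro j hj
    have hji : j ≠ i := Finset.ne_of_mem_erase hj
    rw [Function.update_of_ne hji, Function.update_of_ne (Ne.symm hji),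
      Function.update_comm (Ne.symm hji)]
  rw [Finset.sum_congr rfl this]
  simp only [Function.update_self, Function.update_idem]
  rw [← hB, hg]
  ring

theorem act_lie (q : ℕ) (X Y : G) {c : Family U₀ U₁} (hc : c ∈ cochains U₀ U₁ q) :
    act X (act Y c) = act ⁅X, Y⁆ c + act Y (act X c) := by
  funext p k ξ η
  have h0 := sum_sum_update (fun v => c p k v η) (fun v i x y => (hc.1 p k).add_even v η i x y)
    (fun u => ⁅X, u⁆) (fun u => ⁅Y, u⁆) (fun u => ⁅⁅X, Y⁆, u⁆)
    (fun u => by rw [leibniz_lie X Y u]) ξ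
  have h1 := sum_sum_update (fun v => c p k ξ v) (fun v i x y => (hc.1 p k).add_odd ξ v i x y)
    (fun u => ⁅X, u⁆) (fun u => ⁅Y, u⁆) (fun u => ⁅⁅X, Y⁆, u⁆)
    (fun u => by rw [leibniz_lie X Y u]) η
  have h2 := Finset.sum_comm (s := Finset.univ) (t := Finset.univ)
    (f := fun i j => c p k (Function.update ξ i ⁅X, ξ i⁆) (Function.update η j ⁅Y, η j⁆))
  have h3 := Finset.sum_comm (s := Finset.univ) (t := Finset.univ)
    (f := fun i j => c p k (Function.update ξ i ⁅Y, ξ i⁆) (Function.update η j ⁅X, η j⁆))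
  simp only [act_apply, Pi.add_apply, Finset.sum_neg_distrib, Finset.sum_add_distrib]
  linear_combination h0 + h1 + h2 - h3

noncomputable instance (q : ℕ) : LieRingModule G (cochains U₀ U₁ q) where
  bracket X c := ⟨act X c.1, act_mem q X c.2⟩
  add_lie X Y c := Subtype.ext (act_add q X Y c.2)
  lie_add X a b := Subtype.ext (map_add (act X) a.1 b.1)
  leibniz_lie X Y c := Subtype.ext (act_lie q X Y c.2)

theorem coe_lie (q : ℕ) (X : G) (c : cochains U₀ U₁ q) :
    ((⁅X, c⁆ : cochains U₀ U₁ q) : Family U₀ U₁) = act X (c : Family U₀ U₁) := rfl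

instance (q : ℕ) : LieModule ℂ G (cochains U₀ U₁ q) where
  smul_lie z X c := Subtype.ext (act_smul q z X c.2)
  lie_smul z X c := Subtype.ext (map_smul (act X) z c.1)

/-- `G` acts on the Lie superalgebra by (even) derivations. -/
structure ActsByDerivations (G : Type*) [LieRing G] [LieAlgebra ℂ G]
    [LieRingModule G U₀] [LieModule ℂ G U₀] [LieRingModule G U₁] [LieModule ℂ G U₁]
    (S : LieSuperStructure U₀ U₁) : Prop where
  lie_ee : ∀ (X : G) x y, ⁅X, S.ee x y⁆ = S.ee ⁅X, x⁆ y + S.ee x ⁅X, y⁆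
  lie_eo : ∀ (X : G) x a, ⁅X, S.eo x a⁆ = S.eo ⁅X, x⁆ a + S.eo x ⁅X, a⁆
  lie_oo : ∀ (X : G) a b, ⁅X, S.oo a b⁆ = S.oo ⁅X, a⁆ b + S.oo a ⁅X, b⁆

theorem sum_update_remove {A : Type*} {n : ℕ} (D : A → A) (s : Fin (n + 1))
    (g : A → (Fin n → A) → ℂ) (v : Fin (n + 1) → A) :
    ∑ i, g (Function.update v i (D (v i)) s)
        (fun j => Function.update v i (D (v i)) (s.succAbove j)) =
      g (D (v s)) (fun j => v (s.succAbove j)) +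
      ∑ j, g (v s) (Function.update (fun j => v (s.succAbove j)) j (D (v (s.succAbove j)))) := by
  rw [Fin.sum_univ_succAbove _ s]
  congr 1
  · simp [Function.update_of_ne]
  · refine Finset.sum_congr rfl fun j _ => ?_
    rw [Function.update_of_ne (Fin.succAbove_ne s j).symm]
    congr 1
    funext l
    by_cases h : l = j
    · subst h; simp
    · rw [Function.update_of_ne h, Function.update_of_ne]
      exact fun h' => h (Fin.succAbove_right_injective h')

theorem sum_update_remove_two {A : Type*} {n : ℕ} (D : A → A) (s : Fin (n + 2)) (t : Fin (n + 1))
    (g : A → A → (Fin n → A) → ℂ) (v : Fin (n + 2) → A) :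
    ∑ i, g (Function.update v i (D (v i)) s) (Function.update v i (D (v i)) (s.succAbove t))
        (fun j => Function.update v i (D (v i)) (s.succAbove (t.succAbove j))) =
      g (D (v s)) (v (s.succAbove t)) (fun j => v (s.succAbove (t.succAbove j))) +
      (g (v s) (D (v (s.succAbove t))) (fun j => v (s.succAbove (t.succAbove j))) +
      ∑ j, g (v s) (v (s.succAbove t)) (Function.update
        (fun j => v (s.succAbove (t.succAbove j))) j (D (v (s.succAbove (t.succAbove j)))))) := by
  rw [sum_update_remove D s (fun a w => g a (w t) fun j => w (t.succAbove j)) v]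
  congr 1
  exact sum_update_remove D t (fun a w => g (v s) a w) fun j => v (s.succAbove j)

variable {S : LieSuperStructure U₀ U₁}

theorem IsForm.add_cons_even {p k : ℕ} {f : (Fin (p + 1) → U₀) → (Fin k → U₁) → ℂ}
    (h : IsForm f) (x y : U₀) (ξ : Fin p → U₀) (η : Fin k → U₁) :
    f (Fin.cons (x + y) ξ) η = f (Fin.cons x ξ) η + f (Fin.cons y ξ) η := by
  have := h.add_even (Fin.cons 0 ξ) η 0 x y
  simpa only [Fin.update_cons_zero] using this

theorem IsForm.add_cons_odd {p k : ℕ} {f : (Fin p → U₀) → (Fin (k + 1) → U₁) → ℂ}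
    (h : IsForm f) (x y : U₁) (ξ : Fin p → U₀) (η : Fin k → U₁) :
    f ξ (Fin.cons (x + y) η) = f ξ (Fin.cons x η) + f ξ (Fin.cons y η) := by
  have := h.add_odd ξ (Fin.cons 0 η) 0 x y
  simpa only [Fin.update_cons_zero] using this

theorem neg_sum_add_sum {ι ι' κ τ : Type*} [Fintype ι] [Fintype ι'] [Fintype κ] [Fintype τ]
    (F : ι → κ → τ → ℂ) (F' : ι' → κ → τ → ℂ) :
    -((∑ i, ∑ s, ∑ t, F i s t) + ∑ j, ∑ s, ∑ t, F' j s t) =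
      ∑ s, ∑ t, -((∑ i, F i s t) + ∑ j, F' j s t) := by
  simp only [Finset.sum_neg_distrib, Finset.sum_add_distrib]
  congr 2
  · rw [Finset.sum_comm]
    exact Finset.sum_congr rfl fun s _ => Finset.sum_comm
  · rw [Finset.sum_comm]
    exact Finset.sum_congr rfl fun s _ => Finset.sum_comm

theorem dEE_act (hS : ActsByDerivations G S) (q : ℕ) (X : G) {c : Family U₀ U₁}
    (hc : c ∈ cochains U₀ U₁ q) : dEE S (act X c) = act X (dEE S c) := by
  funext p k ξ η
  match p with
  | 0 => simp [dEE, act_apply]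
  | 1 => simp [dEE, act_apply]
  | p + 2 =>
    simp only [act_apply, dEE]
    rw [neg_sum_add_sum]
    refine Finset.sum_congr rfl fun s _ => Finset.sum_congr rfl fun t _ => ?_
    split_ifs
    · have h := sum_update_remove_two (fun u => ⁅X, u⁆) s t
        (fun a b w => c (p + 1) k (Fin.cons (S.ee a b) w) η) ξ
      rw [← Finset.mul_sum, ← Finset.mul_sum, h, Fin.sum_univ_succ]
      simp only [Fin.update_cons_zero, ← Fin.cons_update, Fin.cons_zero, Fin.cons_succ,
        hS.lie_ee, (hc.1 (p + 1) k).add_cons_even]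
      ring
    · simp

theorem dEO_act (hS : ActsByDerivations G S) (q : ℕ) (X : G) {c : Family U₀ U₁}
    (hc : c ∈ cochains U₀ U₁ q) : dEO S (act X c) = act X (dEO S c) := by
  funext p k ξ η
  match p, k with
  | 0, _ => simp [dEO, act_apply]
  | _ + 1, 0 => simp [dEO, act_apply]
  | p + 1, k + 1 =>
    simp only [act_apply, dEO]
    rw [neg_sum_add_sum]
    refine Finset.sum_congr rfl fun s _ => Finset.sum_congr rfl fun t _ => ?_
    have h0 := sum_update_remove (fun u => ⁅X, u⁆) s
      (fun a w => c p (k + 1) w (Fin.cons (S.eo a (η t)) fun j => η (t.succAbove j))) ξ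
    have h1 := sum_update_remove (fun u => ⁅X, u⁆) t
      (fun a w => c p (k + 1) (fun i => ξ (s.succAbove i)) (Fin.cons (S.eo (ξ s) a) w)) η
    rw [← Finset.mul_sum, ← Finset.mul_sum, h0, h1, Fin.sum_univ_succ (n := k)]
    simp only [Fin.update_cons_zero, ← Fin.cons_update, Fin.cons_zero, Fin.cons_succ,
      hS.lie_eo, (hc.1 p (k + 1)).add_cons_odd]
    ring

theorem dOO_act (hS : ActsByDerivations G S) (q : ℕ) (X : G) {c : Family U₀ U₁}
    (hc : c ∈ cochains U₀ U₁ q) : dOO S (act X c) = act X (dOO S c) := by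
  funext p k ξ η
  match k with
  | 0 => simp [dOO, act_apply]
  | 1 => simp [dOO, act_apply]
  | k + 2 =>
    simp only [act_apply, dOO]
    rw [neg_sum_add_sum]
    refine Finset.sum_congr rfl fun s _ => Finset.sum_congr rfl fun t _ => ?_
    split_ifs
    · have h := sum_update_remove_two (fun u => ⁅X, u⁆) s t
        (fun a b w => c (p + 1) k (Fin.cons (S.oo a b) ξ) w) η
      rw [h, Fin.sum_univ_succ (n := p)]
      simp only [Fin.update_cons_zero, ← Fin.cons_update, Fin.cons_zero, Fin.cons_succ,
        hS.lie_oo, (hc.1 (p + 1) k).add_cons_even]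
      ring
    · simp

theorem d_act (hS : ActsByDerivations G S) (q : ℕ) (X : G) {c : Family U₀ U₁}
    (hc : c ∈ cochains U₀ U₁ q) : d S (act X c) = act X (d S c) := by
  change dEE S (act X c) + dEO S (act X c) + dOO S (act X c) =
    act X (dEE S c + dEO S c + dOO S c)
  rw [dEE_act hS q X hc, dEO_act hS q X hc, dOO_act hS q X hc, map_add, map_add]

/-- The `q`-cocycles, a `G`-submodule of `C^q`. -/
noncomputable def cocycles (hS : ActsByDerivations G S) (q : ℕ) : LieSubmodule ℂ G (cochains U₀ U₁ q) where
  __ := LinearMap.ker (d S ∘ₗ (cochains U₀ U₁ q).subtype)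
  lie_mem := by
    intro X c hc
    change d S (c : Family U₀ U₁) = 0 at hc
    change d S (act X (c : Family U₀ U₁)) = 0
    rw [d_act hS q X c.2, hc, map_zero]

/-- The `q`-coboundaries, as a `G`-submodule of the `q`-cocycles: the cocycles of the form `d b`
with `b` a `(q-1)`-cochain (only `0` if `q = 0`). -/
noncomputable def coboundaries (hS : ActsByDerivations G S) : ∀ q : ℕ, LieSubmodule ℂ G (cocycles hS q)
  | 0 => ⊥
  | q + 1 =>
    { __ := ((cochains U₀ U₁ q).map (d S)).comap
        ((cochains U₀ U₁ (q + 1)).subtype ∘ₗ (cocycles hS (q + 1)).toSubmodule.subtype)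
      lie_mem := by
        rintro X c ⟨b, hb, hbc⟩
        refine ⟨act X b, act_mem q X hb, ?_⟩
        rw [d_act hS q X hb, hbc]
        rfl }

/-- The cohomology `H^q` with trivial coefficients, as a `G`-module. -/
abbrev cohomology (hS : ActsByDerivations G S) (q : ℕ) : Type _ :=
  cocycles hS q ⧸ coboundaries hS q

end Action

end LieSuperCohomology

/-! ### The Lie superalgebra `𝔬𝔰𝔭(n|2)`, `n = 2m + r` with `r ∈ {0, 1}` -/

namespace OrthoSymplectic

/-- Index set of the standard basis of the even part `ℂ^n` of `V = ℂ^{n|2}`, `n = 2m + r`. -/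
abbrev EvenIdx (m r : ℕ) : Type := (Fin m ⊕ Fin m) ⊕ Fin r

/-- Index set of the standard basis of `V = ℂ^{n|2}`. -/
abbrev Idx (m r : ℕ) : Type := EvenIdx m r ⊕ Fin 2

/-- Matrices, that is, endomorphisms of `V`. -/
abbrev Mat (m r : ℕ) : Type := Matrix (Idx m r) (Idx m r) ℂ

/-- The commutator bracket on matrices. -/
instance (m r : ℕ) : LieRing (Mat m r) := LieRing.ofAssociativeRing

instance (m r : ℕ) : LieAlgebra ℂ (Mat m r) := LieAlgebra.ofAssociativeAlgebra

/-- The homogeneous components of `V`. -/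
def V (m r : ℕ) (τ : ZMod 2) : Submodule ℂ (Idx m r → ℂ) where
  carrier := {x | (τ = 0 → ∀ j, x (Sum.inr j) = 0) ∧ (τ = 1 → ∀ i, x (Sum.inl i) = 0)}
  zero_mem' := by simp
  add_mem' := by
    rintro x y ⟨hx, hx'⟩ ⟨hy, hy'⟩
    exact ⟨fun h j => by simp [hx h j, hy h j], fun h i => by simp [hx' h i, hy' h i]⟩
  smul_mem' := by
    rintro a x ⟨hx, hx'⟩
    exact ⟨fun h j => by simp [hx h j], fun h i => by simp [hx' h i]⟩

/-- The Gram matrix of the form `F`: symmetric on the even part of `V`, skew-symmetric on the odd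
part. -/
def formMatrix (m r : ℕ) : Mat m r :=
  fromBlocks (fromBlocks (fromBlocks 0 1 1 0) 0 0 1) 0 0 !![0, 1; -1, 0]

/-- The bilinear form `F` on `V`. -/
def F {m r : ℕ} (x y : Idx m r → ℂ) : ℂ := x ⬝ᵥ (formMatrix m r *ᵥ y)

/-- The sign `(-1)^{σ τ}`. -/
def sgn (σ τ : ZMod 2) : ℂ := (-1) ^ (σ.val * τ.val)

/-- `𝔬𝔰𝔭(n|2)_σ`: the endomorphisms `ξ` of degree `σ` with
`F(ξ x, y) = -(-1)^{σ deg x} F(x, ξ y)`. -/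
def osp (m r : ℕ) (σ : ZMod 2) : Submodule ℂ (Mat m r) where
  carrier := {ξ | (∀ τ, ∀ x ∈ V m r τ, ξ *ᵥ x ∈ V m r (σ + τ)) ∧
    ∀ τ, ∀ x ∈ V m r τ, ∀ y, F (ξ *ᵥ x) y = - sgn σ τ * F x (ξ *ᵥ y)}
  zero_mem' := by simp [F]
  add_mem' := by
    rintro a b ⟨ha, ha'⟩ ⟨hb, hb'⟩
    refine ⟨fun τ x hx => ?_, fun τ x hx y => ?_⟩
    · rw [add_mulVec]; exact add_mem (ha τ x hx) (hb τ x hx)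
    · have h1 := ha' τ x hx y
      have h2 := hb' τ x hx y
      simp only [F, add_mulVec, add_dotProduct, mulVec_add, dotProduct_add] at *
      rw [h1, h2]; ring
  smul_mem' := by
    rintro z a ⟨ha, ha'⟩
    refine ⟨fun τ x hx => ?_, fun τ x hx y => ?_⟩
    · rw [smul_mulVec]; exact Submodule.smul_mem _ _ (ha τ x hx)
    · have h1 := ha' τ x hx y
      simp only [F, smul_mulVec, smul_dotProduct, mulVec_smul, dotProduct_smul, smul_eq_mul] at *
      rw [h1]; ring

theorem bracket_mem_osp {m r : ℕ} {σ τ : ZMod 2} {a b : Mat m r} (ha : a ∈ osp m r σ)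
    (hb : b ∈ osp m r τ) : a * b - sgn σ τ • (b * a) ∈ osp m r (σ + τ) := by
  refine ⟨fun ν x hx => ?_, fun ν x hx y => ?_⟩
  · rw [sub_mulVec, smul_mulVec, ← mulVec_mulVec, ← mulVec_mulVec]
    refine sub_mem ?_ (Submodule.smul_mem _ _ ?_)
    · rw [add_assoc]; exact ha.1 _ _ (hb.1 _ _ hx)
    · rw [add_comm σ τ, add_assoc]; exact hb.1 _ _ (ha.1 _ _ hx)
  · have h1 := ha.2 _ _ (hb.1 _ _ hx) y
    have h2 := hb.2 _ _ hx (a *ᵥ y)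
    have h3 := hb.2 _ _ (ha.1 _ _ hx) y
    have h4 := ha.2 _ _ hx (b *ᵥ y)
    have e1 : F ((a * b - sgn σ τ • (b * a)) *ᵥ x) y =
        F (a *ᵥ b *ᵥ x) y - sgn σ τ * F (b *ᵥ a *ᵥ x) y := by
      simp [F, sub_mulVec, smul_mulVec]
    have e2 : F x ((a * b - sgn σ τ • (b * a)) *ᵥ y) =
        F x (a *ᵥ b *ᵥ y) - sgn σ τ * F x (b *ᵥ a *ᵥ y) := by
      simp [F, sub_mulVec, smul_mulVec, mulVec_sub, mulVec_smul]
    rw [e1, e2, h1, h2, h3, h4]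
    have hs : sgn σ (τ + ν) * sgn τ ν = sgn (σ + τ) ν * sgn σ τ ∧
        sgn σ τ * (sgn τ (σ + ν) * sgn σ ν) = sgn (σ + τ) ν := by
      have h2 : (1 + 1 : ZMod 2) = 0 := rfl
      have hd : ∀ z : ZMod 2, z = 0 ∨ z = 1 := by decide
      clear * - h2 hd
      rcases hd σ with rfl | rfl <;> rcases hd τ with rfl | rfl <;> rcases hd ν with rfl | rfl <;>
        simp [sgn, h2, ZMod.val_one]
    linear_combination F x (b *ᵥ a *ᵥ y) * hs.1 - F x (a *ᵥ b *ᵥ y) * hs.2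

/-- The element `E` of the Cartan subalgebra with `δ(E) = 1` and `ε_i(E) = 0`. -/
def gradingElement (m r : ℕ) : Mat m r := diagonal (Sum.elim (fun _ => 0) ![1, -1])

/-- The part of parity `σ` of the component `𝔤_k` of the `ℤ`-grading of `𝔤 = 𝔬𝔰𝔭(n|2)`: the
eigenspace of `ad E` for `k`, which is spanned by the `𝔤_α` for the roots `α` whose coefficient at
`δ` is `k` (and by the Cartan subalgebra if `k = 0`). -/
def gradedPiece (m r : ℕ) (σ : ZMod 2) (k : ℤ) : Submodule ℂ (Mat m r) where
  carrier := {X | X ∈ osp m r σ ∧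
    gradingElement m r * X - X * gradingElement m r = (k : ℂ) • X}
  zero_mem' := ⟨zero_mem _, by simp⟩
  add_mem' := by
    rintro a b ⟨ha, ha'⟩ ⟨hb, hb'⟩
    refine ⟨add_mem ha hb, ?_⟩
    rw [smul_add, ← ha', ← hb']; noncomm_ring
  smul_mem' := by
    rintro z a ⟨ha, ha'⟩
    refine ⟨Submodule.smul_mem _ _ ha, ?_⟩
    rw [smul_comm, ← ha', mul_smul_comm, smul_mul_assoc, smul_sub]

theorem bracket_mem {m r : ℕ} {σ τ : ZMod 2} {k l : ℤ} {a b : Mat m r}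
    (ha : a ∈ gradedPiece m r σ k) (hb : b ∈ gradedPiece m r τ l) :
    a * b - sgn σ τ • (b * a) ∈ gradedPiece m r (σ + τ) (k + l) := by
  refine ⟨bracket_mem_osp ha.1 hb.1, ?_⟩
  have h1 := ha.2
  have h2 := hb.2
  set E := gradingElement m r
  have e : E * (a * b - sgn σ τ • (b * a)) - (a * b - sgn σ τ • (b * a)) * E =
      ((E * a - a * E) * b + a * (E * b - b * E)) -
        sgn σ τ • ((E * b - b * E) * a + b * (E * a - a * E)) := by
    simp only [mul_sub, sub_mul, mul_smul_comm, smul_mul_assoc, smul_add, smul_sub, mul_assoc]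
    abel
  rw [e, h1, h2]
  push_cast
  simp only [smul_mul_assoc, mul_smul_comm, add_smul, smul_add, smul_sub]
  simp only [smul_comm (sgn σ τ)]
  abel

theorem eq_zero_of_mem {m r : ℕ} {σ : ZMod 2} {k : ℤ} (hk : 2 < k) {a : Mat m r}
    (ha : a ∈ gradedPiece m r σ k) : a = 0 := by
  ext i j
  have h := congrFun (congrFun ha.2 i) j
  simp only [gradingElement, Matrix.sub_apply, diagonal_mul, mul_diagonal, Matrix.smul_apply, smul_eq_mul] at h
  obtain ⟨z, hz, hz'⟩ : ∃ z : ℤ, z ≤ 2 ∧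
      (Sum.elim (fun _ => (0 : ℂ)) ![1, -1] i - Sum.elim (fun _ => (0 : ℂ)) ![1, -1] j) = z := by
    rcases i with i | i <;> rcases j with j | j
    · exact ⟨0, by norm_num, by simp⟩
    · fin_cases j
      · exact ⟨-1, by norm_num, by simp⟩
      · exact ⟨1, by norm_num, by simp⟩
    · fin_cases i
      · exact ⟨1, by norm_num, by simp⟩
      · exact ⟨-1, by norm_num, by simp⟩
    · fin_cases i <;> fin_cases j
      · exact ⟨0, by norm_num, by simp⟩
      · exact ⟨2, by norm_num, by norm_num⟩
      · exact ⟨-2, by norm_num, by norm_num⟩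
      · exact ⟨0, by norm_num, by simp⟩
  have h' : ((z - k : ℤ) : ℂ) * a i j = 0 := by
    push_cast
    rw [← hz']
    linear_combination h
  rcases mul_eq_zero.mp h' with h0 | h0
  · have : z - k = 0 := by exact_mod_cast h0
    omega
  · simpa using h0

@[simp] theorem sgn_zero_left (τ : ZMod 2) : sgn 0 τ = 1 := by simp [sgn]

@[simp] theorem sgn_one_one : sgn 1 1 = -1 := by simp [sgn, ZMod.val_one]

/-- The Lie algebra `𝔤_0 ≅ 𝔬(n) ⊕ ℂ`; the odd part of `𝔤` has no component of degree `0`. -/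
def g0 (m r : ℕ) : LieSubalgebra ℂ (Mat m r) where
  __ := gradedPiece m r 0 0
  lie_mem' := by
    intro a b ha hb
    simpa [Ring.lie_def] using bracket_mem ha hb

/-- The even part `𝔲_0 = 𝔤_2` of `𝔲 = 𝔤_1 ⊕ 𝔤_2`. -/
abbrev uEven (m r : ℕ) : Submodule ℂ (Mat m r) := gradedPiece m r 0 2

/-- The odd part `𝔲_1 = 𝔤_1` of `𝔲 = 𝔤_1 ⊕ 𝔤_2`. -/
abbrev uOdd (m r : ℕ) : Submodule ℂ (Mat m r) := gradedPiece m r 1 1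

theorem lie_mem_gradedPiece {m r : ℕ} {σ : ZMod 2} {k : ℤ} {X a : Mat m r} (hX : X ∈ g0 m r)
    (ha : a ∈ gradedPiece m r σ k) : X * a - a * X ∈ gradedPiece m r σ k := by
  have hX' : X ∈ gradedPiece m r 0 0 := hX
  simpa using bracket_mem hX' ha

/-- The adjoint action of `𝔤_0` on the graded pieces of `𝔤`. -/
instance (m r : ℕ) (σ : ZMod 2) (k : ℤ) : LieRingModule (g0 m r) (gradedPiece m r σ k) where
  bracket X a := ⟨X.1 * a.1 - a.1 * X.1, lie_mem_gradedPiece X.2 a.2⟩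
  add_lie X Y a := Subtype.ext (by
    change (X.1 + Y.1) * a.1 - a.1 * (X.1 + Y.1) =
      (X.1 * a.1 - a.1 * X.1) + (Y.1 * a.1 - a.1 * Y.1)
    noncomm_ring)
  lie_add X a b := Subtype.ext (by
    change X.1 * (a.1 + b.1) - (a.1 + b.1) * X.1 =
      (X.1 * a.1 - a.1 * X.1) + (X.1 * b.1 - b.1 * X.1)
    noncomm_ring)
  leibniz_lie X Y a := Subtype.ext (by
    change X.1 * (Y.1 * a.1 - a.1 * Y.1) - (Y.1 * a.1 - a.1 * Y.1) * X.1 =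
      ((X.1 * Y.1 - Y.1 * X.1) * a.1 - a.1 * (X.1 * Y.1 - Y.1 * X.1)) +
        (Y.1 * (X.1 * a.1 - a.1 * X.1) - (X.1 * a.1 - a.1 * X.1) * Y.1)
    noncomm_ring)

theorem coe_lie {m r : ℕ} {σ : ZMod 2} {k : ℤ} (X : g0 m r) (a : gradedPiece m r σ k) :
    ((⁅X, a⁆ : gradedPiece m r σ k) : Mat m r) = X.1 * a.1 - a.1 * X.1 := rfl

instance (m r : ℕ) (σ : ZMod 2) (k : ℤ) : LieModule ℂ (g0 m r) (gradedPiece m r σ k) where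
  smul_lie z X a := Subtype.ext (by
    change (z • X.1) * a.1 - a.1 * (z • X.1) = z • (X.1 * a.1 - a.1 * X.1)
    rw [smul_mul_assoc, mul_smul_comm, smul_sub])
  lie_smul z X a := Subtype.ext (by
    change X.1 * (z • a.1) - (z • a.1) * X.1 = z • (X.1 * a.1 - a.1 * X.1)
    rw [smul_mul_assoc, mul_smul_comm, smul_sub])

/-- The Lie superalgebra structure of `𝔲`: supercommutators of matrices. -/
def uStructure (m r : ℕ) : LieSuperStructure (uEven m r) (uOdd m r) where
  ee := LinearMap.mk₂ ℂ
    (fun x y => ⟨x.1 * y.1 - y.1 * x.1, by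
      have h := bracket_mem x.2 y.2
      rw [sgn_zero_left, one_smul] at h
      rw [eq_zero_of_mem (by norm_num) h]
      exact zero_mem _⟩)
    (fun x y z => Subtype.ext (by simp [add_mul, mul_add]; abel))
    (fun c x y => Subtype.ext (by simp [smul_sub]))
    (fun x y z => Subtype.ext (by simp [add_mul, mul_add]; abel))
    (fun c x y => Subtype.ext (by simp [smul_sub]))
  eo := LinearMap.mk₂ ℂ
    (fun x a => ⟨x.1 * a.1 - a.1 * x.1, by
      have h := bracket_mem x.2 a.2
      rw [sgn_zero_left, one_smul] at h
      rw [eq_zero_of_mem (by norm_num) h]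
      exact zero_mem _⟩)
    (fun x y z => Subtype.ext (by simp [add_mul, mul_add]; abel))
    (fun c x y => Subtype.ext (by simp [smul_sub]))
    (fun x y z => Subtype.ext (by simp [add_mul, mul_add]; abel))
    (fun c x y => Subtype.ext (by simp [smul_sub]))
  oo := LinearMap.mk₂ ℂ
    (fun a b => ⟨a.1 * b.1 + b.1 * a.1, by
      have h := bracket_mem a.2 b.2
      rw [sgn_one_one, neg_one_smul, sub_neg_eq_add] at h
      exact h⟩)
    (fun x y z => Subtype.ext (by simp [add_mul, mul_add]; abel))
    (fun c x y => Subtype.ext (by simp [smul_add]))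
    (fun x y z => Subtype.ext (by simp [add_mul, mul_add]; abel))
    (fun c x y => Subtype.ext (by simp [smul_add]))
  ee_skew x y := Subtype.ext (by simp)
  oo_symm a b := Subtype.ext (by simp [add_comm])
  jacobi_eee x y z := Subtype.ext (by simp; noncomm_ring)
  jacobi_eeo x y a := Subtype.ext (by simp; noncomm_ring)
  jacobi_eoo x a b := Subtype.ext (by simp; noncomm_ring)
  jacobi_ooo a b c := Subtype.ext (by simp; noncomm_ring)

theorem actsByDerivations (m r : ℕ) :
    LieSuperCohomology.ActsByDerivations (g0 m r) (uStructure m r) where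
  lie_ee X x y := Subtype.ext (by simp [uStructure, coe_lie]; noncomm_ring)
  lie_eo X x a := Subtype.ext (by simp [uStructure, coe_lie]; noncomm_ring)
  lie_oo X a b := Subtype.ext (by simp [uStructure, coe_lie]; noncomm_ring)

/-- The cocycles `Z^q(𝔲)` with trivial coefficients. -/
abbrev Z (m r q : ℕ) : Type :=
  LieSuperCohomology.cocycles (actsByDerivations m r) q

/-- The coboundaries `B^q(𝔲)`, inside the cocycles. -/
noncomputable abbrev B (m r q : ℕ) : LieSubmodule ℂ (g0 m r) (Z m r q) :=
  LieSuperCohomology.coboundaries (actsByDerivations m r) q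

/-- The `𝔤_0`-module `H^q(𝔲) = Z^q(𝔲) / B^q(𝔲)`. -/
abbrev H (m r q : ℕ) : Type := Z m r q ⧸ B m r q

/-! ### Weights and irreducible `𝔤_0`-modules -/

/-- The Cartan subalgebra `𝔥`: the diagonal matrices in `𝔬𝔰𝔭(n|2)`.  All of them lie in `𝔤_0`. -/
def cartan (m r : ℕ) : Set (g0 m r) := {h | (h : Mat m r).IsDiag}

/-- The value at `h` of the weight `λ = λ₀ δ + ∑ᵢ λᵢ ε_i`, where `ε_i(h)` and `δ(h)` are the
diagonal entries of `h` at the `i`-th even and the first odd basis vector. -/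
def weight {m r : ℕ} (l₀ : ℤ) (l : Fin m → ℤ) (h : g0 m r) : ℂ :=
  (l₀ : ℂ) * (h : Mat m r) (Sum.inr 0) (Sum.inr 0) +
    ∑ i, (l i : ℂ) * (h : Mat m r) (Sum.inl (Sum.inl (Sum.inl i))) (Sum.inl (Sum.inl (Sum.inl i)))

/-- The positive roots of `𝔤_0`, that is, the positive even roots of `𝔬𝔰𝔭(n|2)` other than `2δ`:
`ε_i ± ε_j` for `i < j` and, if `n` is odd, `ε_i`. -/
def positiveRoots (m r : ℕ) : Set (Fin m → ℤ) :=
  {a | (∃ i j, i < j ∧ (a = Pi.single i 1 + Pi.single j 1 ∨ a = Pi.single i 1 - Pi.single j 1)) ∨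
    (r = 1 ∧ ∃ i, a = Pi.single i 1)}

/-- `e` is a root vector of `𝔤_0` (or zero) for the root `a`. -/
def IsRootVector {m r : ℕ} (a : Fin m → ℤ) (e : g0 m r) : Prop :=
  ∀ h ∈ cartan m r, ⁅h, e⁆ = weight 0 a h • e

/-- `M` is the finite-dimensional irreducible `𝔤_0`-module `L^{(0)}_λ` of highest weight
`λ = λ₀ δ + ∑ᵢ λᵢ ε_i`. -/
def IsIrreducibleOfHighestWeight (m r : ℕ) (l₀ : ℤ) (l : Fin m → ℤ) (M : Type*) [AddCommGroup M]
    [Module ℂ M] [LieRingModule (g0 m r) M] [LieModule ℂ (g0 m r) M] : Prop :=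
  FiniteDimensional ℂ M ∧ LieModule.IsIrreducible ℂ (g0 m r) M ∧
    ∃ v : M, v ≠ 0 ∧ (∀ h ∈ cartan m r, ⁅h, v⁆ = weight l₀ l h • v) ∧
      ∀ a ∈ positiveRoots m r, ∀ e : g0 m r, IsRootVector a e → ⁅e, v⁆ = 0

/-- The coefficients at `ε_1, …, ε_m` of the weight `z ε_1`. -/
def multEps1 (m : ℕ) (z : ℤ) : Fin m → ℤ := fun i => if (i : ℕ) = 0 then z else 0

/-- The odd positive roots are `δ + ε_i`, `δ - ε_i` and, if `n` is odd, `δ`; they are indexed by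
`EvenIdx m r`, and this is the part of the root without `δ`. -/
def oddRoot (m r : ℕ) : EvenIdx m r → Fin m → ℤ
  | Sum.inl (Sum.inl i) => Pi.single i 1
  | Sum.inl (Sum.inr i) => - Pi.single i 1
  | Sum.inr _ => 0

/-- `e` is a basis of `𝔲_1 = 𝔤_1` consisting of root vectors `e_α ∈ 𝔤_α` for the odd positive
roots `α`. -/
def IsRootBasis {m r : ℕ} (e : Module.Basis (EvenIdx m r) ℂ (uOdd m r)) : Prop :=
  ∀ i, ∀ h ∈ cartan m r, ⁅h, e i⁆ = weight 1 (oddRoot m r i) h • e i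

/-- The quadric `∑ᵢ e*_{δ-ε_i} e*_{δ+ε_i}` if `n = 2m`, and
`e*_δ e*_δ + ∑ᵢ e*_{δ-ε_i} e*_{δ+ε_i}` if `n = 2m + 1`, in the polynomial ring in the variables
`e*_α`, `α` an odd positive root. -/
noncomputable def quadric (m r : ℕ) : MvPolynomial (EvenIdx m r) ℂ :=
  (∑ i : Fin r, MvPolynomial.X (Sum.inr i) * MvPolynomial.X (Sum.inr i)) +
    ∑ i : Fin m, MvPolynomial.X (Sum.inl (Sum.inr i)) * MvPolynomial.X (Sum.inl (Sum.inl i))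

end OrthoSymplectic

/-! The algebra `𝔲` is of Heisenberg type. As `𝔤` has nothing in degree above 2, the line `𝔤_2` is
central in `𝔲`, and the only bracket left is the pairing of odd elements, a quadric `P` in the
coordinates of `𝔤_1 ≅ ℂ^n`. Alternating forms in two or more variables on a line vanish, so with `S
= ℂ[𝔤_1]` the `q`-cochains are `S^q ⊕ (𝔤_2)^* ⊗ S^(q-1)`. The differential kills the first summand
and maps the second to `S^(q+1)` by multiplication with `P`, up to a nonzero constant
(`IsHeisenberg.toPoly_dOO`). Since `S` is a domain, the cocycles are `S^q` and the coboundaries are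
`P S^(q-2)` (`IsHeisenberg.cocyclePoly_bijective`, `IsHeisenberg.mem_coboundaries_iff`). This is
equivariant (`cocyclePoly_lie`), so it remains to study the `𝔬(n)`-module `S^q / P S^(q-2)` of
functions of degree `q` on the isotropic cone `P = 0`.

Irreducibility is `homogeneousSubmodule_le_of_stable`. In the chart `X_x = 1` of the cone, for an
isotropic coordinate `x`, the coordinate `X_{τ x}` is a function of the others, and the operators
`X_x ∂_k - X_{τ k} ∂_{τ x}` of `𝔬(n)` become the partial derivatives. Repeated differentiation turns
any function that is nonzero on the chart into a nonzero constant, that is, into a multiple of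
`X_x^q` modulo `P`. So every nonzero submodule of the quotient contains the class of `X_x^q`. The
Fischer inner product is positive definite and `𝔬(n)` is closed under adjoints, so a proper
submodule would have a nonzero stable complement, which would contain that class as well: a
contradiction. That a homogeneous polynomial vanishing on the chart is a multiple of `P` needs a
third coordinate; this is where `n ≥ 3` enters.

For `x` the index of `δ - ε₁`, the class of `X_x^q` has weight `-q(δ - ε₁)` and is killed by the
positive root vectors. Two irreducible modules with the same highest weight are isomorphic because
the submodule of their product generated by the pair of highest weight vectors is the graph of an
isomorphism (`HighestWeight.nonempty_equiv`). -/

/-! ### Symmetric multilinear forms and homogeneous polynomials -/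

namespace SymmForm

variable {U : Type*} [AddCommGroup U] [Module ℂ U]

/-- `f` is a symmetric `k`-linear form on `U`. -/
structure IsSymm {k : ℕ} (f : (Fin k → U) → ℂ) : Prop where
  add : ∀ η j x y, f (Function.update η j (x + y)) =
    f (Function.update η j x) + f (Function.update η j y)
  smul : ∀ η j (a : ℂ) x, f (Function.update η j (a • x)) = a * f (Function.update η j x)
  symm : ∀ η (σ : Equiv.Perm (Fin k)), f (fun j => η (σ j)) = f η

namespace IsSymm

theorem const_mul {k : ℕ} {f : (Fin k → U) → ℂ} (hf : IsSymm f) (a : ℂ) :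
    IsSymm fun η => a * f η where
  add η j x y := by rw [hf.add]; ring
  smul η j b x := by rw [hf.smul]; ring
  symm η σ := by rw [hf.symm]

theorem sub {k : ℕ} {f g : (Fin k → U) → ℂ} (hf : IsSymm f) (hg : IsSymm g) :
    IsSymm fun η => f η - g η where
  add η j x y := by rw [hf.add, hg.add]; ring
  smul η j b x := by rw [hf.smul, hg.smul]; ring
  symm η σ := by rw [hf.symm, hg.symm]

theorem sum {ι : Type*} (s : Finset ι) {k : ℕ} {f : ι → (Fin k → U) → ℂ}
    (hf : ∀ i, IsSymm (f i)) : IsSymm fun η => ∑ i ∈ s, f i η where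
  add η j x y := by simp only [(hf _).add, Finset.sum_add_distrib]
  smul η j b x := by simp only [(hf _).smul, Finset.mul_sum]
  symm η σ := by simp only [(hf _).symm]

theorem cons {k : ℕ} {f : (Fin (k + 1) → U) → ℂ} (hf : IsSymm f) (v : U) :
    IsSymm fun w => f (Fin.cons v w) where
  add η j x y := by simp only [Fin.cons_update, hf.add]
  smul η j b x := by simp only [Fin.cons_update, hf.smul]
  symm η σ := by
    -- This permutation fixes the first position and acts by `σ` on the others.
    rw [← hf.symm (Fin.cons v η) (Equiv.Perm.decomposeFin.symm (0, σ))]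
    congr 1
    funext j
    refine Fin.cases ?_ (fun j => ?_) j
    · simp
    · simp

theorem cons_cons_comm {k : ℕ} {f : (Fin (k + 2) → U) → ℂ} (hf : IsSymm f) (a b : U)
    (w : Fin k → U) : f (Fin.cons a (Fin.cons b w)) = f (Fin.cons b (Fin.cons a w)) := by
  rw [← hf.symm (Fin.cons b (Fin.cons a w)) (Equiv.swap 0 1)]
  congr 1
  funext j
  refine Fin.cases ?_ (fun j => Fin.cases ?_ (fun j => ?_) j) j
  · rw [Equiv.swap_apply_left]; rfl
  · rw [show (Fin.succ 0 : Fin (k + 2)) = 1 from rfl, Equiv.swap_apply_right]; rfl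
  · rw [Equiv.swap_apply_of_ne_of_ne (Fin.succ_ne_zero _)]
    · simp
    · intro h
      exact Fin.succ_ne_zero j (Fin.succ_injective _ h)

theorem add_cons {k : ℕ} {f : (Fin (k + 1) → U) → ℂ} (hf : IsSymm f) (x y : U) (w : Fin k → U) :
    f (Fin.cons (x + y) w) = f (Fin.cons x w) + f (Fin.cons y w) := by
  have := hf.add (Fin.cons 0 w) 0 x y
  simpa only [Fin.update_cons_zero] using this

theorem smul_cons {k : ℕ} {f : (Fin (k + 1) → U) → ℂ} (hf : IsSymm f) (a : ℂ) (x : U)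
    (w : Fin k → U) : f (Fin.cons (a • x) w) = a * f (Fin.cons x w) := by
  have := hf.smul (Fin.cons 0 w) 0 a x
  simpa only [Fin.update_cons_zero] using this

theorem cons_eq_sum {ι : Type*} [Fintype ι] (e : Module.Basis ι ℂ U) {k : ℕ}
    {f : (Fin (k + 1) → U) → ℂ} (hf : IsSymm f) (v : U) (w : Fin k → U) :
    f (Fin.cons v w) = ∑ i, e.repr v i * f (Fin.cons (e i) w) := by
  let g : U →ₗ[ℂ] ℂ :=
    { toFun := fun x => f (Fin.cons x w)
      map_add' := fun x y => hf.add_cons x y w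
      map_smul' := fun a x => hf.smul_cons a x w }
  change g v = ∑ i, e.repr v i * g (e i)
  conv_lhs => rw [← e.sum_repr v, map_sum]
  simp

theorem update_const {k : ℕ} {f : (Fin (k + 1) → U) → ℂ} (hf : IsSymm f) (η x : U)
    (j : Fin (k + 1)) :
    f (Function.update (fun _ => η) j x) = f (Fin.cons x fun _ => η) := by
  rw [← hf.symm _ (Equiv.swap 0 j)]
  congr 1
  funext l
  refine Fin.cases ?_ (fun l => ?_) l
  · simp
  · have : Equiv.swap 0 j l.succ ≠ j := by
      intro h
      have h' := congrArg (Equiv.swap 0 j) h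
      rw [Equiv.swap_apply_self, Equiv.swap_apply_right] at h'
      exact Fin.succ_ne_zero l h'
    simp [Function.update_of_ne this]

end IsSymm

/-- Deleting `s` from the source and `σ s` from the target leaves a permutation of the remaining
positions. It gives the symmetry of sums over one distinguished argument. -/
theorem exists_perm_succAbove {k : ℕ} (σ : Equiv.Perm (Fin (k + 1))) (s : Fin (k + 1)) :
    ∃ τ : Equiv.Perm (Fin k), ∀ j, σ (s.succAbove j) = (σ s).succAbove (τ j) := by
  refine ⟨((finSuccAboveEquiv s).trans (σ.subtypeEquiv
    (p := fun x => x ≠ s) (q := fun x => x ≠ σ s) (fun a => by simp))).trans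
    (finSuccAboveEquiv (σ s)).symm, fun j => ?_⟩
  have h := (finSuccAboveEquiv (σ s)).apply_symm_apply
    ((σ.subtypeEquiv (p := fun x => x ≠ s) (q := fun x => x ≠ σ s) (fun a => by simp))
      (finSuccAboveEquiv s j))
  have h' := congrArg Subtype.val h
  rw [finSuccAboveEquiv_apply] at h'
  exact h'.symm

/-- Symmetrization: summing over the choice of one distinguished argument. -/
theorem IsSymm.sum_succAbove {k : ℕ} (h : U → (Fin k → U) → ℂ)
    (hadd : ∀ a b w, h (a + b) w = h a w + h b w)
    (hsmul : ∀ (z : ℂ) a w, h (z • a) w = z * h a w) (hsymm : ∀ a, IsSymm (h a)) :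
    IsSymm fun η : Fin (k + 1) → U => ∑ s, h (η s) fun j => η (s.succAbove j) := by
  have upd : ∀ (η : Fin (k + 1) → U) (s : Fin (k + 1)) (l : Fin k) (x : U),
      (fun j => Function.update η (s.succAbove l) x (s.succAbove j)) =
        Function.update (fun j => η (s.succAbove j)) l x := by
    intro η s l x
    funext j
    by_cases hj : j = l
    · subst hj; simp
    · rw [Function.update_of_ne hj, Function.update_of_ne]
      exact fun h' => hj (Fin.succAbove_right_injective h')
  have upd' : ∀ (η : Fin (k + 1) → U) (s : Fin (k + 1)) (x : U),
      (fun j => Function.update η s x (s.succAbove j)) = fun j => η (s.succAbove j) := by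
    intro η s x
    funext j
    rw [Function.update_of_ne (Fin.succAbove_ne s j)]
  refine ⟨fun η i x y => ?_, fun η i a x => ?_, fun η σ => ?_⟩
  · rw [← Finset.sum_add_distrib]
    refine Finset.sum_congr rfl fun s _ => ?_
    rcases Fin.eq_self_or_eq_succAbove s i with rfl | ⟨l, rfl⟩
    · simp only [Function.update_self, upd', hadd]
    · simp only [upd, (hsymm _).add, Function.update_of_ne (Fin.succAbove_ne s l).symm]
  · rw [Finset.mul_sum]
    refine Finset.sum_congr rfl fun s _ => ?_
    rcases Fin.eq_self_or_eq_succAbove s i with rfl | ⟨l, rfl⟩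
    · simp only [Function.update_self, upd', hsmul]
    · simp only [upd, (hsymm _).smul, Function.update_of_ne (Fin.succAbove_ne s l).symm]
  · rw [← Equiv.sum_comp σ fun s => h (η s) fun j => η (s.succAbove j)]
    refine Finset.sum_congr rfl fun s _ => ?_
    obtain ⟨τ, hτ⟩ := exists_perm_succAbove σ s
    simp only [hτ]
    exact (hsymm _).symm (fun j => η ((σ s).succAbove j)) τ

/-! ### Polarization: symmetric forms and homogeneous polynomials -/

section Poly

open MvPolynomial

variable {ι : Type*} [Fintype ι] (e : Module.Basis ι ℂ U)

/-- The polynomial function `η ↦ f (η, …, η)` in the coordinates of the basis `e`. -/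
noncomputable def toPoly : ∀ k : ℕ, ((Fin k → U) → ℂ) →ₗ[ℂ] MvPolynomial ι ℂ
  | 0 => Algebra.linearMap ℂ _ ∘ₗ LinearMap.proj Fin.elim0
  | k + 1 => ∑ i, LinearMap.mulLeft ℂ (X i) ∘ₗ toPoly k ∘ₗ
      LinearMap.funLeft ℂ ℂ fun v => Fin.cons (e i) v

theorem toPoly_zero (f : (Fin 0 → U) → ℂ) : toPoly e 0 f = C (f Fin.elim0) := rfl

theorem toPoly_succ {k : ℕ} (f : (Fin (k + 1) → U) → ℂ) :
    toPoly e (k + 1) f = ∑ i, X i * toPoly e k fun v => f (Fin.cons (e i) v) := by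
  simp [toPoly, LinearMap.sum_apply]
  rfl

theorem toPoly_isHomogeneous {k : ℕ} (f : (Fin k → U) → ℂ) : (toPoly e k f).IsHomogeneous k := by
  induction k with
  | zero => exact isHomogeneous_C _ _
  | succ k ih =>
    rw [toPoly_succ]
    refine IsHomogeneous.sum _ _ _ fun i _ => ?_
    have h := (isHomogeneous_X ℂ i).mul (ih fun v => f (Fin.cons (e i) v))
    rwa [add_comm 1 k] at h

/-- The sum over basis vectors in the first slot, weighted by the coordinates of `η`, recombines to
`η` itself. -/
theorem eval_toPoly {k : ℕ} {f : (Fin k → U) → ℂ} (hf : IsSymm f) (η : U) :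
    eval (e.repr η) (toPoly e k f) = f fun _ => η := by
  induction k with
  | zero =>
    rw [toPoly_zero, eval_C]
    exact congrArg f (Subsingleton.elim _ _)
  | succ k ih =>
    rw [toPoly_succ, map_sum]
    simp only [map_mul, eval_X, ih (hf.cons _)]
    rw [← hf.cons_eq_sum e]
    congr 1
    funext j
    refine Fin.cases rfl (fun _ => rfl) j

/-- Two polynomials with the same values at all coordinate vectors agree. -/
theorem ext_eval {p q : MvPolynomial ι ℂ} (h : ∀ η : U, eval (e.repr η) p = eval (e.repr η) q) :
    p = q := by
  refine MvPolynomial.funext fun x => ?_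
  have := h (e.equivFun.symm x)
  rwa [show (e.repr (e.equivFun.symm x) : ι → ℂ) = x from e.equivFun.apply_symm_apply x] at this

theorem derivation_sum_apply {κ : Type*} (s : Finset κ)
    (D : κ → Derivation ℂ (MvPolynomial ι ℂ) (MvPolynomial ι ℂ)) (p : MvPolynomial ι ℂ) :
    (∑ i ∈ s, D i) p = ∑ i ∈ s, D i p := by
  rw [← Derivation.coeFnAddMonoidHom_apply, map_sum, Finset.sum_apply]
  rfl

/-- The derivative in the direction `v`. -/
noncomputable def dirDeriv (v : U) : Derivation ℂ (MvPolynomial ι ℂ) (MvPolynomial ι ℂ) :=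
  ∑ i, e.repr v i • pderiv i

theorem dirDeriv_apply (v : U) (p : MvPolynomial ι ℂ) :
    dirDeriv e v p = ∑ i, e.repr v i • pderiv i p := by
  simp [dirDeriv, derivation_sum_apply]

theorem dirDeriv_X (v : U) (i : ι) : dirDeriv e v (X i) = C (e.repr v i) := by
  classical
  rw [dirDeriv_apply, Finset.sum_eq_single i]
  · simp [smul_eq_C_mul]
  · intro j _ hj
    simp [pderiv_X_of_ne hj.symm]
  · simp

/-- Leibniz rule on the recursion for `toPoly`: one term comes from the leading variable, and the
induction hypothesis supplies the others once `v` has been moved in front of `e i`. Differentiation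
thus recovers the form from its polynomial. -/
theorem dirDeriv_toPoly (v : U) {k : ℕ} {f : (Fin (k + 1) → U) → ℂ} (hf : IsSymm f) :
    dirDeriv e v (toPoly e (k + 1) f) =
      ((k + 1 : ℕ) : ℂ) • toPoly e k fun w => f (Fin.cons v w) := by
  have key : ∀ {k : ℕ} {f : (Fin (k + 1) → U) → ℂ}, IsSymm f →
      ∑ i, C (e.repr v i) * toPoly e k (fun w => f (Fin.cons (e i) w)) =
        toPoly e k fun w => f (Fin.cons v w) := by
    intro k f hf
    have : (fun w => f (Fin.cons v w)) =
        ∑ i, e.repr v i • fun w => f (Fin.cons (e i) w) := by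
      funext w
      rw [hf.cons_eq_sum e]
      simp
    rw [this, map_sum]
    simp [smul_eq_C_mul]
  induction k with
  | zero =>
    rw [toPoly_succ, map_sum, ← key hf]
    simp only [Derivation.leibniz, dirDeriv_X, toPoly_zero, derivation_C, smul_eq_mul,
      mul_zero, zero_add]
    simp [mul_comm]
  | succ k ih =>
    rw [toPoly_succ, map_sum]
    simp only [Derivation.leibniz, dirDeriv_X, smul_eq_mul, Finset.sum_add_distrib]
    have h1 : ∀ i, dirDeriv e v (toPoly e (k + 1) fun w => f (Fin.cons (e i) w)) =
        ((k + 1 : ℕ) : ℂ) • toPoly e k fun w => f (Fin.cons v (Fin.cons (e i) w)) := by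
      intro i
      rw [ih (hf.cons (e i))]
      simp only [hf.cons_cons_comm (e i) v]
    simp only [h1, mul_smul_comm, ← Finset.smul_sum]
    rw [← toPoly_succ e fun w => f (Fin.cons v w), ← key hf]
    rw [Finset.sum_congr rfl fun i _ => mul_comm _ _, add_comm]
    push_cast
    module

/-- Polarization: a symmetric form is determined by its diagonal values. -/
theorem IsSymm.eq_zero_of_toPoly {k : ℕ} {f : (Fin k → U) → ℂ} (hf : IsSymm f)
    (h : toPoly e k f = 0) : f = 0 := by
  induction k with
  | zero =>
    rw [toPoly_zero, C_eq_zero] at h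
    funext η
    rw [Subsingleton.elim η Fin.elim0, h]; rfl
  | succ k ih =>
    funext η
    have h1 := dirDeriv_toPoly e (η 0) hf
    -- In characteristic zero the factor `k + 1` cancels, so the form with its first argument fixed
    -- also has polynomial zero.
    rw [h, map_zero, eq_comm, smul_eq_zero] at h1
    have h2 := congrFun (ih (hf.cons (η 0)) (h1.resolve_left (by norm_cast))) (Fin.tail η)
    simpa using h2

/-- The form is found by integration: symmetrize the forms attached to the partial derivatives of
`p` and apply Euler's identity. -/
theorem exists_toPoly_eq {k : ℕ} {p : MvPolynomial ι ℂ} (hp : p.IsHomogeneous k) :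
    ∃ f : (Fin k → U) → ℂ, IsSymm f ∧ toPoly e k f = p := by
  induction k generalizing p with
  | zero =>
    refine ⟨fun _ => coeff 0 p, ⟨fun _ j => j.elim0, fun _ j => j.elim0, fun _ _ => rfl⟩, ?_⟩
    rw [toPoly_zero]
    exact (totalDegree_eq_zero_iff_eq_C.mp ((totalDegree_zero_iff_isHomogeneous _).mpr hp)).symm
  | succ k ih =>
    choose g hg hgp using fun i => ih (p := pderiv i p) hp.pderiv
    have hk : ((k : ℂ) + 1) ≠ 0 := by norm_cast
    have hs : IsSymm fun η : Fin (k + 1) → U => ∑ s, ∑ i, e.repr (η s) i *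
        g i fun j => η (s.succAbove j) :=
      IsSymm.sum_succAbove (fun a w => ∑ i, e.repr a i * g i w)
        (fun a b w => by simp [add_mul, Finset.sum_add_distrib])
        (fun z a w => by simp [mul_assoc, Finset.mul_sum])
        fun a => IsSymm.sum _ fun i => (hg i).const_mul _
    -- One factor averages over the distinguished argument, the other compensates Euler's identity
    -- `∑ Xᵢ ∂ᵢ p = (k + 1) p`.
    refine ⟨_, (hs.const_mul ((k + 1 : ℂ)⁻¹)).const_mul ((k + 1 : ℂ)⁻¹), ext_eval e fun η => ?_⟩
    rw [eval_toPoly e ((hs.const_mul _).const_mul _)]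
    have h1 := congrArg (eval (e.repr η)) hp.sum_X_mul_pderiv
    simp only [map_sum, map_mul, eval_X, ← hgp, eval_toPoly e (hg _), nsmul_eq_mul,
      map_natCast] at h1
    simp only [h1, Finset.sum_const, Finset.card_univ, Fintype.card_fin, nsmul_eq_mul]
    push_cast
    field_simp

/-- The action of a linear map `A` on polynomial functions: `(A p)(η) = -p'(η)(A η)`. -/
noncomputable def linDeriv (A : Matrix ι ι ℂ) :
    Derivation ℂ (MvPolynomial ι ℂ) (MvPolynomial ι ℂ) :=
  mkDerivation ℂ fun i => -∑ j, C (A i j) * X j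

theorem linDeriv_X (A : Matrix ι ι ℂ) (i : ι) :
    linDeriv A (X i) = -∑ j, C (A i j) * X j := mkDerivation_X _ _ _

theorem linDeriv_apply (A : Matrix ι ι ℂ) (p : MvPolynomial ι ℂ) :
    linDeriv A p = -∑ i, ∑ j, C (A i j) * (X j * pderiv i p) := by
  classical
  have : linDeriv A = ∑ i, linDeriv A (X i) • pderiv i := by
    refine derivation_ext fun i => ?_
    simp only [derivation_sum_apply, Derivation.smul_apply]
    rw [Finset.sum_eq_single i]
    · simp
    · intro j _ hj
      simp [pderiv_X_of_ne hj.symm]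
    · simp
  rw [this]
  simp only [derivation_sum_apply, Derivation.smul_apply, linDeriv_X, smul_eq_mul,
    neg_mul, Finset.sum_neg_distrib, Finset.sum_mul, mul_assoc]

/-- On the diagonal the contragredient action gives `-k f(A η, η, …, η)`, which is minus the
derivative of the polynomial at `η` in the direction `A η`. -/
theorem toPoly_act [DecidableEq ι] (A : U →ₗ[ℂ] U) {k : ℕ} {f : (Fin k → U) → ℂ} (hf : IsSymm f)
    (hAf : IsSymm fun η => -∑ j, f (Function.update η j (A (η j)))) :
    toPoly e k (fun η => -∑ j, f (Function.update η j (A (η j)))) =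
      linDeriv (LinearMap.toMatrix e e A) (toPoly e k f) := by
  refine ext_eval e fun η => ?_
  rw [eval_toPoly e hAf]
  have h1 : eval (e.repr η) (linDeriv (LinearMap.toMatrix e e A) (toPoly e k f)) =
      -eval (e.repr η) (dirDeriv e (A η) (toPoly e k f)) := by
    rw [linDeriv_apply, dirDeriv_apply]
    simp only [map_neg, map_sum, map_mul, eval_C, eval_X, smul_eval]
    congr 1
    refine Finset.sum_congr rfl fun i _ => ?_
    rw [← LinearMap.toMatrix_mulVec_repr e e A η]
    simp [Matrix.mulVec, dotProduct, Finset.sum_mul, mul_assoc]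
  rw [h1]
  congr 1
  cases k with
  | zero => simp [toPoly_zero]
  | succ k =>
    rw [dirDeriv_toPoly e _ hf, smul_eval, eval_toPoly e (hf.cons _)]
    simp [hf.update_const]

end Poly

end SymmForm

/-! ### Polynomials modulo a nondegenerate quadric -/

namespace Quadric

open MvPolynomial SymmForm

variable {ι : Type*}

theorem aeval_mul_of_isHomogeneous [Fintype ι] {R : Type*} [CommRing R] [Algebra ℂ R] {q : ℕ}
    {f : MvPolynomial ι ℂ} (hf : f.IsHomogeneous q) (t : R) (g : ι → R) :
    aeval (fun i => t * g i) f = t ^ q * aeval g f := by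
  rw [aeval_def, aeval_def, eval₂_eq', eval₂_eq', Finset.mul_sum]
  refine Finset.sum_congr rfl fun a ha => ?_
  have : ∑ i, a i = q := by
    rw [← Finsupp.degree_eq_sum]
    exact (hf.degree_eq_sum_deg_support ha).symm
  rw [← this]
  simp only [mul_pow, Finset.prod_mul_distrib, Finset.prod_pow_eq_pow_sum]
  ring

theorem totalDegree_pderiv_le {g : MvPolynomial ι ℂ} {n : ℕ} (hg : g.totalDegree ≤ n + 1) (i : ι) :
    (pderiv i g).totalDegree ≤ n := by
  refine Finset.sup_le fun b hb => ?_
  rw [mem_support_iff, coeff_pderiv] at hb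
  have h1 := (le_totalDegree (mem_support_iff.mpr (left_ne_zero_of_mul hb))).trans hg
  have h2 : (b + Finsupp.single i 1).degree = b.degree + 1 := by
    rw [map_add, Finsupp.degree_single]
  change (b + Finsupp.single i 1).degree ≤ n + 1 at h1
  change b.degree ≤ n
  omega

theorem eq_C_of_pderiv_eq_zero {g : MvPolynomial ι ℂ} (h : ∀ i, pderiv i g = 0) :
    g = C (coeff 0 g) := by
  classical
  ext a
  rw [coeff_C]
  split_ifs with ha
  · rw [ha]
  · obtain ⟨i, hi⟩ : ∃ i, a i ≠ 0 := by
      by_contra! h'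
      exact ha (Finsupp.ext fun i => (h' i).symm)
    have h1 := coeff_pderiv (i := i) g (a - Finsupp.single i 1)
    rw [h i, coeff_zero, tsub_add_cancel_of_le
      (Finsupp.single_le_iff.mpr (Nat.one_le_iff_ne_zero.mpr hi))] at h1
    exact (mul_eq_zero.mp h1.symm).resolve_right (by norm_cast)

variable [Fintype ι] [DecidableEq ι]

/-- The quadric `∑ᵢ Xᵢ X_{τ i}`. -/
noncomputable def form (τ : ι → ι) : MvPolynomial ι ℂ := ∑ i, X i * X (τ i)

/-- The matrices in the orthogonal Lie algebra of `form τ`. -/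
def IsOrtho (τ : ι → ι) (A : Matrix ι ι ℂ) : Prop := ∀ i j, A (τ j) (τ i) = -A i j

/-- The defining condition only permutes entries and changes a sign. Closure under adjoints makes
Fischer-orthogonal complements stable. -/
theorem IsOrtho.conjTranspose {τ : ι → ι} {A : Matrix ι ι ℂ} (hA : IsOrtho τ A) :
    IsOrtho τ Aᴴ := by
  intro i j
  simp only [Matrix.conjTranspose_apply, hA j i, star_neg]

/-! ### The isotropic cone in an affine chart -/

section Raising

variable {τ : ι → ι} (hτ : ∀ i, τ (τ i) = i) {x : ι} (hx : τ x ≠ x)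

/-- The matrix of the operator `X_x ∂_k - X_{τ k} ∂_{τ x}`. -/
noncomputable def raising (τ : ι → ι) (x k : ι) : Matrix ι ι ℂ :=
  Matrix.single (τ x) (τ k) 1 - Matrix.single k x 1

-- The reflection `(i, j) ↦ (τ j, τ i)` interchanges the two matrix units, which have opposite
-- signs.
include hτ in
theorem isOrtho_raising (k : ι) : IsOrtho τ (raising τ x k) := by
  intro i j
  have h1 : ∀ a b, τ a = b ↔ a = τ b := fun a b =>
    ⟨fun h => by rw [← h, hτ], fun h => by rw [h, hτ]⟩
  simp only [raising, Matrix.sub_apply, Matrix.single_apply, ← h1, hτ]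
  simp only [h1, and_comm]
  ring

theorem linDeriv_raising_X (k i : ι) : linDeriv (raising τ x k) (X i) =
    (if i = k then X x else 0) - if i = τ x then X (τ k) else 0 := by
  rw [linDeriv_X]
  simp only [raising, Matrix.sub_apply, Matrix.single_apply, map_sub, sub_mul,
    Finset.sum_sub_distrib, neg_sub]
  congr 1
  · by_cases h : i = k
    · simp [h, eq_comm]
    · simp [h, Ne.symm h]
  · by_cases h : i = τ x
    · simp [h, eq_comm]
    · simp [h, Ne.symm h]

/-- The sum of the terms of `form τ` in the variables other than `x` and `τ x`. -/
noncomputable def restForm (τ : ι → ι) (x : ι) : MvPolynomial ι ℂ :=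
  ∑ i ∈ Finset.univ.filter fun i => i ≠ x ∧ i ≠ τ x, X i * X (τ i)

-- The pair `{x, τ x}` occurs twice in the sum over all `i`; hence the 2 here and the 1/2 in
-- `chart`.
include hτ hx in
theorem form_eq : form τ = 2 * X x * X (τ x) + restForm τ x := by
  have : Finset.univ.filter (fun i => ¬(i ≠ x ∧ i ≠ τ x)) = {x, τ x} := by
    ext i; simp; tauto
  rw [form, restForm, ← Finset.sum_filter_add_sum_filter_not Finset.univ
    fun i => i ≠ x ∧ i ≠ τ x, this, Finset.sum_pair hx.symm, hτ]
  ring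

/-- Restriction to the chart `x = 1` of the cone `form τ = 0`. -/
noncomputable def chart (τ : ι → ι) (x : ι) : MvPolynomial ι ℂ →ₐ[ℂ] MvPolynomial ι ℂ :=
  aeval fun i => if i = x then 1 else if i = τ x then -(C (1 / 2) * restForm τ x) else X i

include hτ in
theorem pderiv_restForm {k : ι} (h1 : k ≠ x) (h2 : k ≠ τ x) :
    pderiv k (restForm τ x) = 2 * X (τ k) := by
  have h3 : τ k ≠ x := fun h => h2 (by rw [← h, hτ])
  have h4 : τ k ≠ τ x := fun h => h1 (by rw [← hτ k, h, hτ])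
  have h5 : ∀ i, τ i = k ↔ i = τ k := fun i =>
    ⟨fun h => by rw [← h, hτ], fun h => by rw [h, hτ]⟩
  simp only [restForm, map_sum, Derivation.leibniz, pderiv_X, Pi.single_apply, smul_eq_mul,
    mul_ite, mul_one, mul_zero, Finset.sum_add_distrib, h5]
  rw [Finset.sum_ite_eq', Finset.sum_ite_eq']
  simp [h1, h2, h3, h4]
  ring

include hτ in
theorem pderiv_restForm_self : pderiv x (restForm τ x) = 0 ∧ pderiv (τ x) (restForm τ x) = 0 := by
  constructor
  all_goals
    rw [restForm, map_sum]
    refine Finset.sum_eq_zero fun i hi => ?_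
    simp only [Finset.mem_filter, Finset.mem_univ, true_and] at hi
    have h3 : τ i ≠ x := fun h => hi.2 (by rw [← h, hτ])
    have h4 : τ i ≠ τ x := fun h => hi.1 (by rw [← hτ i, h, hτ])
    simp [Derivation.leibniz, hi.1, hi.2, h3, h4]

-- Both sides are derivations along `chart`, so it suffices to compare them on variables. The
-- decisive one is `X (τ x)`: its image `-restForm / 2` has derivative `-X (τ k)`.
include hτ hx in
theorem chart_raising {k : ι} (h1 : k ≠ x) (h2 : k ≠ τ x) (f : MvPolynomial ι ℂ) :
    chart τ x (linDeriv (raising τ x k) f) = pderiv k (chart τ x f) := by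
  have h3 : τ k ≠ x := fun h => h2 (by rw [← h, hτ])
  have h4 : τ k ≠ τ x := fun h => h1 (by rw [← hτ k, h, hτ])
  have hX : ∀ i, chart τ x (linDeriv (raising τ x k) (X i)) = pderiv k (chart τ x (X i)) := by
    intro i
    rw [linDeriv_raising_X]
    by_cases hi : i = x
    · subst hi
      simp [chart, h1.symm, hx.symm]
    by_cases hi2 : i = τ x
    · subst hi2
      simp only [chart, h2.symm, if_false, if_true, zero_sub, map_neg, aeval_X, h3, h4, hx,
        Derivation.leibniz, pderiv_restForm hτ h1 h2, derivation_C, smul_eq_mul, mul_zero, add_zero]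
      rw [← mul_assoc, show (2 : MvPolynomial ι ℂ) = C 2 from (map_ofNat C 2).symm, ← C_mul]
      norm_num
    by_cases hi3 : i = k
    · subst hi3
      simp [chart, h1, h2]
    · simp [chart, hi, hi2, hi3]
  induction f using MvPolynomial.induction_on with
  | C a => simp [chart]
  | add p q hp hq => simp [hp, hq]
  | mul_X p i hp =>
    simp only [Derivation.leibniz, map_add, map_mul, smul_eq_mul, hp, hX]

-- The image of `chart` does not involve the variables `x` and `τ x`, so the raising operators
-- realize every partial derivative that can be nonzero there.
include hτ hx in
theorem pderiv_chart (f : MvPolynomial ι ℂ) :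
    pderiv x (chart τ x f) = 0 ∧ pderiv (τ x) (chart τ x f) = 0 := by
  have h := pderiv_restForm_self (x := x) hτ
  have hX : ∀ i, pderiv x (chart τ x (X i)) = 0 ∧ pderiv (τ x) (chart τ x (X i)) = 0 := by
    intro i
    by_cases hi : i = x
    · subst hi; simp [chart]
    by_cases hi2 : i = τ x
    · subst hi2; simp [chart, hx, h, Derivation.leibniz]
    · simp [chart, hi, hi2]
  induction f using MvPolynomial.induction_on with
  | C a => simp [chart]
  | add p q hp hq => simp [hp, hq]
  | mul_X p i hp => simp [Derivation.leibniz, hp, hX]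

include hτ hx in
/-- A space of polynomials stable under the raising operators, and not contained in the kernel
of `chart`, contains a polynomial that is constant on the chart. -/
theorem exists_chart_eq_C (N : Submodule ℂ (MvPolynomial ι ℂ))
    (hN : ∀ k, k ≠ x → k ≠ τ x → ∀ f ∈ N, linDeriv (raising τ x k) f ∈ N)
    {f : MvPolynomial ι ℂ} (hf : f ∈ N) (hf0 : chart τ x f ≠ 0) :
    ∃ g ∈ N, ∃ c : ℂ, c ≠ 0 ∧ chart τ x g = C c := by
  suffices H : ∀ n, ∀ f ∈ N, chart τ x f ≠ 0 → (chart τ x f).totalDegree ≤ n →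
      ∃ g ∈ N, ∃ c : ℂ, c ≠ 0 ∧ chart τ x g = C c from H _ f hf hf0 le_rfl
  clear hf hf0 f
  intro n
  induction n with
  | zero =>
    intro f hf hf0 hd
    have h := totalDegree_eq_zero_iff_eq_C.mp (Nat.le_zero.mp hd)
    exact ⟨f, hf, _, fun h0 => hf0 (by rw [h, h0, C_0]), h⟩
  | succ n ih =>
    intro f hf hf0 hd
    by_cases h : ∀ i, pderiv i (chart τ x f) = 0
    · have h := eq_C_of_pderiv_eq_zero h
      exact ⟨f, hf, _, fun h0 => hf0 (by rw [h, h0, C_0]), h⟩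
    · push Not at h
      obtain ⟨k, hk⟩ := h
      have h1 : k ≠ x := by
        rintro rfl
        exact hk (pderiv_chart hτ hx f).1
      have h2 : k ≠ τ x := by
        rintro rfl
        exact hk (pderiv_chart hτ hx f).2
      rw [← chart_raising hτ hx h1 h2] at hk
      -- The surviving derivative is realized by a raising operator, hence stays in `N`, and it has
      -- smaller degree.
      refine ih _ (hN k h1 h2 f hf) hk ?_
      rw [chart_raising hτ hx h1 h2]
      exact totalDegree_pderiv_le hd k

theorem eval_chart (b : ι → ℂ) (f : MvPolynomial ι ℂ) : eval b (chart τ x f) =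
    eval (fun i => if i = x then 1 else if i = τ x then -(1 / 2 * eval b (restForm τ x))
      else b i) f := by
  rw [chart, ← coe_aeval_eq_eval, ← coe_aeval_eq_eval, RingHom.coe_coe, RingHom.coe_coe,
    ← AlgHom.comp_apply]
  congr 1
  refine algHom_ext fun i => ?_
  simp only [AlgHom.comp_apply, aeval_X]
  split_ifs <;> simp [coe_aeval_eq_eval]

include hτ hx in
/-- On homogeneous polynomials, the kernel of `chart` consists of the multiples of the quadric. -/
theorem form_dvd_of_chart_eq_zero (hk : ∃ k, k ≠ x ∧ k ≠ τ x) {q : ℕ} {f : MvPolynomial ι ℂ}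
    (hf : f.IsHomogeneous q) (h0 : chart τ x f = 0) : form τ ∣ f := by
  -- This is `chart` with denominators cleared: on degree `q` it is `X_x^(2q)` times `chart τ x f`
  -- evaluated at the quotients `X_i / X_x`.
  let χ : MvPolynomial ι ℂ →ₐ[ℂ] MvPolynomial ι ℂ := aeval fun i =>
    if i = x then X x * X x else if i = τ x then -(C (1 / 2) * restForm τ x) else X x * X i
  have hrest : ∀ (t : ℂ) (b : ι → ℂ), eval (fun i => t * b i) (restForm τ x) =
      t ^ 2 * eval b (restForm τ x) := by
    intro t b
    simp only [restForm, map_sum, map_mul, eval_X, Finset.mul_sum]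
    exact Finset.sum_congr rfl fun i _ => by ring
  have hχ : χ f = 0 := by
    -- The extra factor `X x` disposes of the points with `b x = 0`, where division is impossible.
    refine (mul_eq_zero.mp (?_ : X x * χ f = 0)).resolve_left (X_ne_zero x)
    refine MvPolynomial.funext fun b => ?_
    rw [map_zero, map_mul, eval_X]
    by_cases hb : b x = 0
    · rw [hb, zero_mul]
    · have e1 : eval b (χ f) = (b x ^ 2) ^ q * eval (fun i => b i / b x) (chart τ x f) := by
        rw [eval_chart, ← coe_aeval_eq_eval (fun i => if i = x then (1 : ℂ) else _),
          RingHom.coe_coe, ← aeval_mul_of_isHomogeneous hf, ← coe_aeval_eq_eval, RingHom.coe_coe,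
          ← AlgHom.comp_apply]
        congr 1
        refine algHom_ext fun i => ?_
        simp only [χ, AlgHom.comp_apply, aeval_X]
        have := hrest (b x) fun i => b i / b x
        rw [show (fun i => b x * (b i / b x)) = b from funext fun i => by field_simp] at this
        split_ifs
        · simp; ring
        · simp [coe_aeval_eq_eval, this]
          ring
        · simp; field_simp
      rw [e1, h0]; simp
  -- Modulo the quadric, `X_x X_{τ x} = -restForm / 2`, so `χ` agrees with scaling every variable by
  -- `X_x`.
  have hχ' : Ideal.Quotient.mk (Ideal.span {form τ}) (χ f) =
      Ideal.Quotient.mk (Ideal.span {form τ}) (X x ^ q * f) := by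
    have e2 : X x ^ q * f = aeval (fun i => X x * X i) f := by
      rw [aeval_mul_of_isHomogeneous hf, aeval_X_left_apply]
    rw [e2, ← Ideal.Quotient.mkₐ_eq_mk ℂ, ← AlgHom.comp_apply, ← AlgHom.comp_apply]
    congr 1
    refine algHom_ext fun i => ?_
    simp only [χ, AlgHom.comp_apply, aeval_X, Ideal.Quotient.mkₐ_eq_mk]
    split_ifs with h1 h2
    · rw [h1]
    · rw [h2, eq_comm, Ideal.Quotient.eq, Ideal.mem_span_singleton, form_eq hτ hx]
      refine ⟨C (1 / 2), ?_⟩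
      have : (C (1 / 2) : MvPolynomial ι ℂ) * 2 = 1 := by
        rw [show (2 : MvPolynomial ι ℂ) = C 2 from (map_ofNat C 2).symm, ← C_mul]; norm_num
      linear_combination (-(X x * X (τ x))) * this
    · rfl
  rw [hχ, map_zero, eq_comm, Ideal.Quotient.eq_zero_iff_mem, Ideal.mem_span_singleton] at hχ'
  obtain ⟨g, hg⟩ := hχ'
  -- At the point with coordinates 0 at `x`, `τ x` and 1 elsewhere, the quadric takes as value the
  -- number of remaining coordinates, which is positive by `hk`.
  have hnd : ¬ (X x ∣ form τ) := by
    rintro ⟨u, hu⟩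
    have h := congrArg (eval fun i => if i = x ∨ i = τ x then (0 : ℂ) else 1) hu
    rw [form_eq hτ hx] at h
    have h' : ∀ i, (τ i = x ∨ τ i = τ x) ↔ (i = x ∨ i = τ x) := by
      intro i
      constructor
      · rintro (h | h)
        · exact Or.inr (by rw [← h, hτ])
        · exact Or.inl (by rw [← hτ i, h, hτ])
      · rintro (h | h)
        · exact Or.inr (by rw [h])
        · exact Or.inl (by rw [h, hτ])
    simp only [restForm, map_add, map_mul, map_sum, eval_X, h', true_or, if_true, mul_zero,
      zero_mul, zero_add] at h
    rw [Finset.sum_congr rfl (g := fun _ => (1 : ℂ))] at h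
    · rw [Finset.sum_const, nsmul_eq_mul, mul_one, Nat.cast_eq_zero, Finset.card_eq_zero] at h
      obtain ⟨k, hk⟩ := hk
      exact Finset.notMem_empty k (h ▸ by simpa using hk)
    · intro i hi
      simp only [Finset.mem_filter, Finset.mem_univ, true_and] at hi
      simp [hi.1, hi.2]
  -- The prime `X_x` does not divide the quadric, so all of `X_x^q` divides the cofactor and
  -- cancels.
  obtain ⟨g', rfl⟩ := (X_prime (i := x)).pow_dvd_of_dvd_mul_left q hnd ⟨f, hg.symm⟩
  refine ⟨g', mul_left_cancel₀ (pow_ne_zero q (X_ne_zero (R := ℂ) x)) ?_⟩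
  rw [hg]; ring

end Raising

end Quadric

/-! ### The Fischer inner product -/

namespace Quadric

open MvPolynomial SymmForm ComplexConjugate

variable {ι : Type*} [Fintype ι] [DecidableEq ι]

/-- The product of the factorials of the exponents of a monomial. -/
def multiFactorial (a : ι →₀ ℕ) : ℕ := ∏ i, (a i).factorial

theorem multiFactorial_ne_zero (a : ι →₀ ℕ) : multiFactorial a ≠ 0 :=
  Finset.prod_ne_zero_iff.mpr fun i _ => Nat.factorial_ne_zero (a i)

theorem multiFactorial_add_single (a : ι →₀ ℕ) (i : ι) :
    multiFactorial (a + Finsupp.single i 1) = (a i + 1) * multiFactorial a := by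
  rw [multiFactorial, multiFactorial, ← Finset.mul_prod_erase _ _ (Finset.mem_univ i),
    ← Finset.mul_prod_erase _ (fun l => (a l).factorial) (Finset.mem_univ i), ← mul_assoc]
  congr 1
  · simp [Nat.factorial_succ]
  · refine Finset.prod_congr rfl fun l hl => ?_
    simp [Finsupp.single_eq_of_ne (Finset.ne_of_mem_erase hl)]

/-- The Fischer inner product: monomials are orthogonal and `X^a` has square length `a!`.
It is antilinear in the first argument. -/
noncomputable def fischer (f : MvPolynomial ι ℂ) : MvPolynomial ι ℂ →ₗ[ℂ] ℂ :=
  (basisMonomials ι ℂ).constr ℂ fun a => (multiFactorial a : ℂ) * conj (coeff a f)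

theorem fischer_monomial (f : MvPolynomial ι ℂ) (a : ι →₀ ℕ) :
    fischer f (monomial a 1) = (multiFactorial a : ℂ) * conj (coeff a f) := by
  have := (basisMonomials ι ℂ).constr_basis ℂ
    (fun a => (multiFactorial a : ℂ) * conj (coeff a f)) a
  rwa [coe_basisMonomials] at this

theorem linearMap_ext_monomial {V : Type*} [AddCommGroup V] [Module ℂ V]
    {u v : MvPolynomial ι ℂ →ₗ[ℂ] V}
    (h : ∀ a, u (monomial a 1) = v (monomial a 1)) : u = v :=
  (basisMonomials ι ℂ).ext fun a => by rw [coe_basisMonomials]; exact h a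

theorem linearMap_apply_eq_sum (u : MvPolynomial ι ℂ →ₗ[ℂ] ℂ) (g : MvPolynomial ι ℂ) :
    u g = ∑ a ∈ g.support, coeff a g * u (monomial a 1) := by
  conv_lhs => rw [g.as_sum, map_sum]
  refine Finset.sum_congr rfl fun a _ => ?_
  rw [← smul_eq_mul, ← map_smul, smul_monomial, smul_eq_mul, mul_one]

theorem fischer_add (f f' g : MvPolynomial ι ℂ) :
    fischer (f + f') g = fischer f g + fischer f' g := by
  rw [← LinearMap.add_apply]
  congr 1
  refine linearMap_ext_monomial fun a => ?_
  simp only [LinearMap.add_apply, fischer_monomial, coeff_add, map_add]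
  ring

theorem fischer_smul (z : ℂ) (f g : MvPolynomial ι ℂ) :
    fischer (z • f) g = conj z * fischer f g := by
  rw [← smul_eq_mul, ← LinearMap.smul_apply]
  congr 1
  refine linearMap_ext_monomial fun a => ?_
  simp only [LinearMap.smul_apply, fischer_monomial, coeff_smul, smul_eq_mul, map_mul]
  ring

theorem fischer_zero (g : MvPolynomial ι ℂ) : fischer 0 g = 0 := by
  simpa using fischer_smul 0 0 g

/-- The Fischer inner product as an additive map in the first argument. -/
noncomputable def fischerHom (g : MvPolynomial ι ℂ) : MvPolynomial ι ℂ →+ ℂ where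
  toFun f := fischer f g
  map_zero' := fischer_zero g
  map_add' f f' := fischer_add f f' g

/-- The value is the sum of the positive numbers `a! |coeff a f|²` over the support. Hence a
subspace meets its complement only in 0. -/
theorem fischer_self_ne_zero {f : MvPolynomial ι ℂ} (hf : f ≠ 0) : fischer f f ≠ 0 := by
  have h : fischer f f =
      ((∑ a ∈ f.support, (multiFactorial a : ℝ) * Complex.normSq (coeff a f) : ℝ) : ℂ) := by
    rw [linearMap_apply_eq_sum, Complex.ofReal_sum]
    refine Finset.sum_congr rfl fun a _ => ?_
    rw [fischer_monomial, Complex.ofReal_mul, Complex.normSq_eq_conj_mul_self]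
    push_cast
    ring
  rw [h, Complex.ofReal_ne_zero]
  refine (Finset.sum_pos (fun a ha => ?_) (support_nonempty.mpr hf)).ne'
  exact mul_pos (by exact_mod_cast Nat.pos_of_ne_zero (multiFactorial_ne_zero a))
    (Complex.normSq_pos.mpr (mem_support_iff.mp ha))

/-- On monomials this is `(aᵢ + 1)! = (aᵢ + 1) aᵢ!`, which is why the inner product carries
factorials. -/
theorem fischer_X_mul (i : ι) (f g : MvPolynomial ι ℂ) :
    fischer (X i * f) g = fischer f (pderiv i g) := by
  change fischer (X i * f) g = (fischer f ∘ₗ (pderiv i).toLinearMap) g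
  congr 1
  refine linearMap_ext_monomial fun a => ?_
  rw [fischer_monomial, coeff_X_mul', LinearMap.comp_apply]
  change _ = fischer f (pderiv i (monomial a 1))
  rw [pderiv_monomial, one_mul]
  by_cases ha : a i = 0
  · simp [ha]
  · obtain ⟨b, rfl⟩ : ∃ b, a = b + Finsupp.single i 1 :=
      ⟨a - Finsupp.single i 1, (tsub_add_cancel_of_le
        (Finsupp.single_le_iff.mpr (Nat.one_le_iff_ne_zero.mpr ha))).symm⟩
    have h : (monomial b (((b + Finsupp.single i 1 : ι →₀ ℕ) i : ℕ) : ℂ) : MvPolynomial ι ℂ) =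
        ((b i : ℂ) + 1) • monomial b 1 := by
      rw [smul_monomial]
      simp
    rw [if_pos (by simp), add_tsub_cancel_right, multiFactorial_add_single, h, map_smul,
      fischer_monomial]
    push_cast
    rw [smul_eq_mul, mul_assoc]

theorem fischer_pderiv (i : ι) (f g : MvPolynomial ι ℂ) :
    fischer (pderiv i f) g = fischer f (X i * g) := by
  change fischer (pderiv i f) g = (fischer f ∘ₗ LinearMap.mulLeft ℂ (X i)) g
  congr 1
  refine linearMap_ext_monomial fun a => ?_
  rw [fischer_monomial, coeff_pderiv, LinearMap.comp_apply, LinearMap.mulLeft_apply, mul_comm (X i),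
    X, monomial_mul, mul_one, fischer_monomial, multiFactorial_add_single]
  simp
  ring

/-- The adjoint of `X_j ∂_i` is `X_i ∂_j`, so the coefficient matrix is transposed and conjugated.
-/
theorem fischer_linDeriv (A : Matrix ι ι ℂ) (f g : MvPolynomial ι ℂ) :
    fischer (linDeriv A f) g = fischer f (linDeriv Aᴴ g) := by
  rw [linDeriv_apply, linDeriv_apply]
  change fischerHom g _ = _
  simp only [map_neg, map_sum]
  congr 1
  rw [Finset.sum_comm]
  refine Finset.sum_congr rfl fun i _ => Finset.sum_congr rfl fun j _ => ?_
  change fischer _ g = _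
  rw [← smul_eq_C_mul, ← smul_eq_C_mul, fischer_smul, map_smul, fischer_X_mul, fischer_pderiv,
    smul_eq_mul, Matrix.conjTranspose_apply]
  rfl

/-- Every linear functional on homogeneous polynomials is given by the Fischer product. -/
theorem exists_fischer_eq (q : ℕ) (u : MvPolynomial ι ℂ →ₗ[ℂ] ℂ) :
    ∃ f : MvPolynomial ι ℂ, f.IsHomogeneous q ∧
      ∀ g : MvPolynomial ι ℂ, g.IsHomogeneous q → fischer f g = u g := by
  refine ⟨∑ a ∈ Finset.univ.finsuppAntidiag q,
    -- The coefficients are forced by testing on the monomials of degree `q`.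
    monomial a (conj (u (monomial a 1)) / (multiFactorial a : ℂ)), ?_, fun g hg => ?_⟩
  · refine IsHomogeneous.sum _ _ _ fun a ha => isHomogeneous_monomial _ ?_
    rw [Finsupp.degree_eq_sum]
    exact (Finset.mem_finsuppAntidiag.mp ha).1
  · rw [linearMap_apply_eq_sum, linearMap_apply_eq_sum u]
    refine Finset.sum_congr rfl fun a ha => ?_
    have : a ∈ Finset.univ.finsuppAntidiag q := by
      rw [Finset.mem_finsuppAntidiag, ← Finsupp.degree_eq_sum]
      exact ⟨(hg.degree_eq_sum_deg_support ha).symm, Finset.subset_univ _⟩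
    rw [fischer_monomial, coeff_sum]
    simp only [coeff_monomial]
    rw [Finset.sum_ite_eq' _ a, if_pos this]
    simp [multiFactorial_ne_zero a, mul_div_cancel₀]

/-- Homogeneous polynomials of degree `q` modulo the multiples of `form τ` are an irreducible
module of the orthogonal Lie algebra. -/
theorem homogeneousSubmodule_le_of_stable {τ : ι → ι} (hτ : ∀ i, τ (τ i) = i) {x : ι}
    (hx : τ x ≠ x) (hk : ∃ k, k ≠ x ∧ k ≠ τ x) {q : ℕ} {N : Submodule ℂ (MvPolynomial ι ℂ)}
    (hNq : N ≤ homogeneousSubmodule ι ℂ q)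
    (hN : ∀ A, IsOrtho τ A → ∀ f ∈ N, linDeriv A f ∈ N)
    (hK : ∀ f : MvPolynomial ι ℂ, f.IsHomogeneous q → form τ ∣ f → f ∈ N)
    {f : MvPolynomial ι ℂ} (hf : f ∈ N) (hf0 : ¬ form τ ∣ f) :
    homogeneousSubmodule ι ℂ q ≤ N := by
  by_contra hlt
  obtain ⟨s, hs, hsN⟩ := Set.not_subset.mp hlt
  -- A functional that vanishes on `N` but not at `s` yields a nonzero polynomial `p` orthogonal to
  -- `N`.
  obtain ⟨u, hu, huN⟩ := Submodule.exists_le_ker_of_notMem hsN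
  obtain ⟨p, hp, hpu⟩ := exists_fischer_eq q u
  have hpN : ∀ g ∈ N, fischer p g = 0 := fun g hg => by
    rw [hpu g (hNq hg)]; exact huN hg
  have hp0 : p ≠ 0 := by
    rintro rfl
    exact hu (by rw [← hpu s hs, fischer_zero])
  let N' : Submodule ℂ (MvPolynomial ι ℂ) :=
    { carrier := {f | f.IsHomogeneous q ∧ ∀ g ∈ N, fischer f g = 0}
      zero_mem' := ⟨isHomogeneous_zero _ _ _, fun g _ => fischer_zero g⟩
      add_mem' := fun {a b} ha hb => ⟨ha.1.add hb.1, fun g hg => by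
        rw [fischer_add, ha.2 g hg, hb.2 g hg, add_zero]⟩
      smul_mem' := fun z a ha => ⟨(homogeneousSubmodule ι ℂ q).smul_mem z ha.1, fun g hg => by
        rw [fischer_smul, ha.2 g hg, mul_zero]⟩ }
  have hNN' : ∀ f ∈ N, f ∈ N' → f = 0 := fun f hf hf' => by
    by_contra h
    exact fischer_self_ne_zero h (hf'.2 f hf)
  have hN' : ∀ A, IsOrtho τ A → ∀ f ∈ N', linDeriv A f ∈ N' := by
    refine fun A hA f hf => ⟨?_, fun g hg => ?_⟩
    · rw [linDeriv_apply]
      refine IsHomogeneous.neg (IsHomogeneous.sum _ _ _ fun i _ => IsHomogeneous.sum _ _ _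
        fun j _ => IsHomogeneous.C_mul ?_ _)
      -- In degree 0 the truncated `q - 1` gives no degree count, but there all derivatives vanish.
      rcases Nat.eq_zero_or_pos q with rfl | hq
      · have h := totalDegree_eq_zero_iff_eq_C.mp ((totalDegree_zero_iff_isHomogeneous _).mpr hf.1)
        rw [h, pderiv_C, mul_zero]
        exact isHomogeneous_zero _ _ _
      · have h := (isHomogeneous_X ℂ j).mul (hf.1.pderiv (i := i))
        rwa [Nat.add_sub_cancel' hq] at h
    · rw [fischer_linDeriv]
      exact hf.2 _ (hN _ hA.conjTranspose g hg)
  -- To be applied both to `N` and to its complement `N'`: each contains a polynomial congruent to a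
  -- multiple of `X_x^q` and not divisible by the quadric.
  have key : ∀ M : Submodule ℂ (MvPolynomial ι ℂ),
      (∀ A, IsOrtho τ A → ∀ f ∈ M, linDeriv A f ∈ M) → M ≤ homogeneousSubmodule ι ℂ q →
      ∀ f ∈ M, ¬ form τ ∣ f → ∃ g ∈ M, ∃ c : ℂ, c ≠ 0 ∧ form τ ∣ g - C c * X x ^ q ∧ ¬ form τ ∣ g := by
    intro M hM hMq f hfM hf0
    obtain ⟨g, hg, c, hc, hgc⟩ := exists_chart_eq_C hτ hx M
      (fun k _ _ => hM _ (isOrtho_raising hτ k)) hfM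
      fun h => hf0 (form_dvd_of_chart_eq_zero hτ hx hk (hMq hfM) h)
    refine ⟨g, hg, c, hc, form_dvd_of_chart_eq_zero hτ hx hk (q := q)
      ((hMq hg).sub ((isHomogeneous_X_pow x q).C_mul c)) ?_, ?_⟩
    · rw [map_sub, hgc]
      simp [chart]
    -- The quadric vanishes on the chart, whereas `g` is a nonzero constant there.
    · rintro ⟨w, rfl⟩
      refine hc (C_injective ι ℂ ?_)
      rw [← hgc, map_mul, form_eq hτ hx]
      simp only [chart, map_add, map_mul, aeval_X, if_true, hx, if_false, map_ofNat, mul_one]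
      have h2 : chart τ x (restForm τ x) = restForm τ x := by
        simp only [restForm, map_sum, map_mul]
        refine Finset.sum_congr rfl fun i hi => ?_
        simp only [Finset.mem_filter, Finset.mem_univ, true_and] at hi
        have h3 : τ i ≠ x := fun h => hi.2 (by rw [← h, hτ])
        have h4 : τ i ≠ τ x := fun h => hi.1 (by rw [← hτ i, h, hτ])
        simp [chart, hi.1, hi.2, h3, h4]
      rw [chart] at h2
      rw [h2]
      have : (2 : MvPolynomial ι ℂ) * C (1 / 2) = 1 := by
        rw [show (2 : MvPolynomial ι ℂ) = C 2 from (map_ofNat C 2).symm, ← C_mul]; norm_num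
      rw [C_0]
      linear_combination (-restForm τ x * (aeval fun i => if i = x then 1 else if i = τ x then
        -(C (1 / 2) * restForm τ x) else X i) w) * this
  obtain ⟨g, hg, c, hc, hgc, -⟩ := key N hN hNq f hf hf0
  have hxq : X x ^ q ∈ N := by
    have h1 := N.sub_mem hg (hK _ ((hNq hg).sub ((isHomogeneous_X_pow x q).C_mul c)) hgc)
    rw [sub_sub_cancel, ← smul_eq_C_mul] at h1
    exact (N.smul_mem_iff hc).mp h1
  have hpN' : p ∈ N' := ⟨hp, hpN⟩
  -- Multiples of the quadric lie in `N`, so such a multiple in `N'` would be zero.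
  have hp0' : ¬ form τ ∣ p := fun h => hp0 (hNN' p (hK p hp h) hpN')
  obtain ⟨g', hg', c', -, hgc', hg0'⟩ := key N' hN' (fun f hf => hf.1) p hpN' hp0'
  refine hg0' ?_
  -- Both `X_x^q` and the multiples of the quadric are in `N`; thus `g'` lies in `N` and in `N'`,
  -- hence is zero, against `hg0'`.
  have : g' ∈ N := by
    have h1 := N.add_mem (hK _ (hg'.1.sub ((isHomogeneous_X_pow x q).C_mul c')) hgc')
      (N.smul_mem c' hxq)
    rwa [smul_eq_C_mul, sub_add_cancel] at h1
  rw [hNN' g' this hg']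
  exact dvd_zero _

end Quadric

/-! ### Uniqueness of irreducible modules of a given highest weight -/

namespace HighestWeight

variable {G : Type*} [LieRing G] [LieAlgebra ℂ G]

/-! ### Submodules generated by a highest weight vector -/

section Span

variable {M : Type*} [AddCommGroup M] [Module ℂ M] [LieRingModule G M] [LieModule ℂ G M]

/-- The span of all `f₁ ⋯ f_k x` with `k ≥ 1` and `fᵢ` in `N`. -/
inductive Words (N : Set G) (x : M) : M → Prop
  | base (f : G) (hf : f ∈ N) : Words N x ⁅f, x⁆
  | step (f : G) (hf : f ∈ N) (y : M) (hy : Words N x y) : Words N x ⁅f, y⁆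

/-- If `G` is spanned by `T` and `N`, and `x` is a common eigenvector of `T`, then the words in
`N` applied to `x` span a submodule. -/
theorem lie_mem_span_words {T N : Set G} (hTN : Submodule.span ℂ (T ∪ N) = ⊤) {x : M}
    (hx : ∀ t ∈ T, ∃ c : ℂ, ⁅t, x⁆ = c • x) (g : G) {y : M}
    (hy : y ∈ Submodule.span ℂ (insert x {w | Words N x w})) :
    ⁅g, y⁆ ∈ Submodule.span ℂ (insert x {w | Words N x w}) := by
  set W := Submodule.span ℂ (insert x {w | Words N x w})
  have hxW : x ∈ W := Submodule.subset_span (Set.mem_insert _ _)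
  have hwW : ∀ w, Words N x w → w ∈ W := fun w hw => Submodule.subset_span (Or.inr hw)
  have ofGen : ∀ {y : M}, (∀ g ∈ T ∪ N, ⁅g, y⁆ ∈ W) → ∀ g : G, ⁅g, y⁆ ∈ W := by
    intro y h g
    have hg : g ∈ Submodule.span ℂ (T ∪ N) := hTN ▸ Submodule.mem_top
    induction hg using Submodule.span_induction with
    | mem g hg => exact h g hg
    | zero => simp
    | add a b _ _ ha hb => rw [add_lie]; exact W.add_mem ha hb
    | smul c a _ ha => rw [smul_lie]; exact W.smul_mem c ha
  have hN : ∀ f ∈ N, ∀ y ∈ W, ⁅f, y⁆ ∈ W := by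
    intro f hf y hy
    induction hy using Submodule.span_induction with
    | mem y hy =>
      rcases hy with rfl | hy
      · exact hwW _ (.base f hf)
      · exact hwW _ (.step f hf y hy)
    | zero => simp
    | add a b _ _ ha hb => rw [lie_add]; exact W.add_mem ha hb
    | smul c a _ ha => rw [lie_smul]; exact W.smul_mem c ha
  have hgx : ∀ g : G, ⁅g, x⁆ ∈ W := ofGen fun g hg => by
    rcases hg with hg | hg
    · obtain ⟨c, hc⟩ := hx g hg
      rw [hc]; exact W.smul_mem c hxW
    · exact hN g hg x hxW
  -- The induction on words treats all `g` at once, since `g f w = [g, f] w + f g w` and `[g, f]`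
  -- can be any element of `G`. Neither `T` nor `N` has to be a subalgebra.
  have hgw : ∀ w, Words N x w → ∀ g : G, ⁅g, w⁆ ∈ W := by
    intro w hw
    induction hw with
    | base f hf =>
      intro g
      rw [leibniz_lie]
      exact W.add_mem (hgx _) (hN f hf _ (hgx g))
    | step f hf y hy ih =>
      intro g
      rw [leibniz_lie]
      exact W.add_mem (ih _) (hN f hf _ (ih g))
  induction hy using Submodule.span_induction with
  | mem y hy =>
    rcases hy with rfl | hy
    · exact hgx g
    · exact hgw y hy g
  | zero => simp
  | add a b _ _ ha hb => rw [lie_add]; exact W.add_mem ha hb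
  | smul c a _ ha => rw [lie_smul]; exact W.smul_mem c ha

/-- A vector of the weight of `x` in the submodule generated by `x` is a multiple of `x`. -/
theorem mem_span_of_lie_eq {N : Set G} {h : G} {c : ℂ}
    (hN : ∀ f ∈ N, ∃ k : ℕ, 0 < k ∧ ⁅h, f⁆ = -(k : ℂ) • f) {x : M} (hx : ⁅h, x⁆ = c • x) {y : M}
    (hy : ⁅h, y⁆ = c • y) (hyW : y ∈ Submodule.span ℂ (insert x {w | Words N x w})) :
    ∃ a : ℂ, y = a • x := by
  -- A word has at least one letter, so its eigenvalue differs from `c`.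
  have hw : ∀ w, Words N x w → ∃ k : ℕ, 0 < k ∧ ⁅h, w⁆ = (c - k) • w := by
    intro w hw
    induction hw with
    | base f hf =>
      obtain ⟨k, hk, hkf⟩ := hN f hf
      refine ⟨k, hk, ?_⟩
      rw [leibniz_lie, hkf, hx, smul_lie, lie_smul]
      module
    | step f hf w _ ih =>
      obtain ⟨k, hk, hkf⟩ := hN f hf
      obtain ⟨l, hl, hlw⟩ := ih
      refine ⟨k + l, by omega, ?_⟩
      rw [leibniz_lie, hkf, hlw, smul_lie, lie_smul]
      push_cast
      module
  let φ : Module.End ℂ M := LieModule.toEnd ℂ G M h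
  rw [Submodule.mem_span_insert] at hyW
  obtain ⟨a, z, hz, rfl⟩ := hyW
  refine ⟨a, ?_⟩
  have hz1 : z ∈ ⨆ μ ∈ {μ : ℂ | μ ≠ c}, φ.eigenspace μ := by
    refine (Submodule.span_le.mpr ?_ : Submodule.span ℂ {w | Words N x w} ≤ _) hz
    intro w hww
    obtain ⟨k, hk, hkw⟩ := hw w hww
    refine Submodule.mem_iSup_of_mem (c - k) (Submodule.mem_iSup_of_mem ?_ ?_)
    · simp [hk.ne']
    · exact Module.End.mem_eigenspace_iff.mpr hkw
  have hz2 : z ∈ φ.eigenspace c := by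
    refine Module.End.mem_eigenspace_iff.mpr ?_
    change ⁅h, z⁆ = c • z
    rw [lie_add, lie_smul, hx, smul_add, smul_comm a c] at hy
    exact add_left_cancel hy
  -- The remainder `z` lies in the eigenspace of `c` and in the sum of the other eigenspaces, which
  -- are independent.
  have hd := (φ.eigenspaces_iSupIndep c).le_bot
  have h0 : z = 0 := by
    refine (Submodule.mem_bot ℂ).mp (hd ⟨hz2, ?_⟩)
    simpa using hz1
  rw [h0, add_zero]

end Span

/-! ### Comparison of two irreducible modules inside their product -/

section Prod

variable {M₁ M₂ : Type*} [AddCommGroup M₁] [Module ℂ M₁] [LieRingModule G M₁] [LieModule ℂ G M₁]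
  [AddCommGroup M₂] [Module ℂ M₂] [LieRingModule G M₂] [LieModule ℂ G M₂]

instance : LieRingModule G (M₁ × M₂) where
  bracket g y := (⁅g, y.1⁆, ⁅g, y.2⁆)
  add_lie a b y := Prod.ext (add_lie a b y.1) (add_lie a b y.2)
  lie_add a y z := Prod.ext (lie_add a y.1 z.1) (lie_add a y.2 z.2)
  leibniz_lie a b y := Prod.ext (leibniz_lie a b y.1) (leibniz_lie a b y.2)

instance : LieModule ℂ G (M₁ × M₂) where
  smul_lie z a y := Prod.ext (smul_lie z a y.1) (smul_lie z a y.2)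
  lie_smul z a y := Prod.ext (lie_smul z a y.1) (lie_smul z a y.2)

/-- A bijective homomorphism of Lie modules is an equivalence. -/
noncomputable def equivOfBijective (f : M₁ →ₗ⁅ℂ, G⁆ M₂) (hf : Function.Bijective f) :
    M₁ ≃ₗ⁅ℂ, G⁆ M₂ :=
  { LinearEquiv.ofBijective f.toLinearMap hf with
    map_lie' := fun {g y} => f.map_lie g y }

/-- Two irreducible modules generated by highest weight vectors of the same weight are isomorphic:
`T` is the Borel subalgebra (or a spanning set of it), `N` consists of lowering operators. -/
theorem nonempty_equiv [LieModule.IsIrreducible ℂ G M₁] [LieModule.IsIrreducible ℂ G M₂]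
    {T N : Set G} (hTN : Submodule.span ℂ (T ∪ N) = ⊤) {h : G} (hT : h ∈ T)
    (hN : ∀ f ∈ N, ∃ k : ℕ, 0 < k ∧ ⁅h, f⁆ = -(k : ℂ) • f) {v₁ : M₁} {v₂ : M₂}
    (h₁ : v₁ ≠ 0) (h₂ : v₂ ≠ 0) (hv : ∀ t ∈ T, ∃ c : ℂ, ⁅t, v₁⁆ = c • v₁ ∧ ⁅t, v₂⁆ = c • v₂) :
    Nonempty (M₁ ≃ₗ⁅ℂ, G⁆ M₂) := by
  let x : M₁ × M₂ := (v₁, v₂)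
  have hx : ∀ t ∈ T, ∃ c : ℂ, ⁅t, x⁆ = c • x := fun t ht => by
    obtain ⟨c, hc1, hc2⟩ := hv t ht
    exact ⟨c, Prod.ext hc1 hc2⟩
  let W : LieSubmodule ℂ G (M₁ × M₂) :=
    { Submodule.span ℂ (insert x {w | Words N x w}) with
      lie_mem := fun {g y} hy => lie_mem_span_words hTN hx g hy }
  have hxW : x ∈ W := Submodule.subset_span (Set.mem_insert _ _)
  obtain ⟨c, hc1, hc2⟩ := hv h hT
  have hxc : ⁅h, x⁆ = c • x := Prod.ext hc1 hc2
  have hmul : ∀ y ∈ W, ⁅h, y⁆ = c • y → ∃ a : ℂ, y = a • x := fun y hy hyc =>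
    mem_span_of_lie_eq hN hxc hyc hy
  let p₁ : W →ₗ⁅ℂ, G⁆ M₁ :=
    { toLinearMap := LinearMap.fst ℂ M₁ M₂ ∘ₗ W.toSubmodule.subtype
      map_lie' := rfl }
  let p₂ : W →ₗ⁅ℂ, G⁆ M₂ :=
    { toLinearMap := LinearMap.snd ℂ M₁ M₂ ∘ₗ W.toSubmodule.subtype
      map_lie' := rfl }
  have s₁ : Function.Surjective p₁ := by
    rw [← LieModuleHom.range_eq_top]
    refine (eq_bot_or_eq_top _).resolve_left fun hb => h₁ ?_
    have : v₁ ∈ p₁.range := (LieModuleHom.mem_range _ _).mpr ⟨⟨x, hxW⟩, rfl⟩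
    rw [hb] at this
    simpa using this
  have s₂ : Function.Surjective p₂ := by
    rw [← LieModuleHom.range_eq_top]
    refine (eq_bot_or_eq_top _).resolve_left fun hb => h₂ ?_
    have : v₂ ∈ p₂.range := (LieModuleHom.mem_range _ _).mpr ⟨⟨x, hxW⟩, rfl⟩
    rw [hb] at this
    simpa using this
  -- The second projection embeds the kernel of `p₁` in the irreducible `M₂`. If it were onto, `(0,
  -- v₂)` would lie in `W` with eigenvalue `c`, hence be a multiple of `(v₁, v₂)`, which is
  -- impossible.
  have i₁ : Function.Injective p₁ := by
    rw [← LieModuleHom.ker_eq_bot]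
    rcases eq_bot_or_eq_top ((p₁.ker).map p₂) with hb | ht
    · rw [eq_bot_iff]
      intro w hw
      have h1 : p₁ w = 0 := hw
      have h2 : p₂ w ∈ (p₁.ker).map p₂ := LieSubmodule.mem_map_of_mem hw
      rw [hb] at h2
      rw [LieSubmodule.mem_bot]
      exact Subtype.ext (Prod.ext h1 ((LieSubmodule.mem_bot _).mp h2))
    · exfalso
      have : v₂ ∈ (p₁.ker).map p₂ := ht ▸ LieSubmodule.mem_top _
      obtain ⟨w, hw, hw2⟩ := (LieSubmodule.mem_map _).mp this
      have hw1 : w.1 = (0, v₂) := Prod.ext hw hw2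
      obtain ⟨a, ha⟩ := hmul w.1 w.2 (by rw [hw1]; exact Prod.ext ((lie_zero h).trans (smul_zero c).symm) hc2)
      rw [hw1] at ha
      have ha1 : (0 : M₁) = a • v₁ := congrArg Prod.fst ha
      have ha2 : v₂ = a • v₂ := congrArg Prod.snd ha
      rcases smul_eq_zero.mp ha1.symm with h | h
      · exact h₂ (by rw [ha2, h, zero_smul])
      · exact h₁ h
  have i₂ : Function.Injective p₂ := by
    rw [← LieModuleHom.ker_eq_bot]
    rcases eq_bot_or_eq_top ((p₂.ker).map p₁) with hb | ht
    · rw [eq_bot_iff]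
      intro w hw
      have h1 : p₂ w = 0 := hw
      have h2 : p₁ w ∈ (p₂.ker).map p₁ := LieSubmodule.mem_map_of_mem hw
      rw [hb] at h2
      rw [LieSubmodule.mem_bot]
      exact Subtype.ext (Prod.ext ((LieSubmodule.mem_bot _).mp h2) h1)
    · exfalso
      have : v₁ ∈ (p₂.ker).map p₁ := ht ▸ LieSubmodule.mem_top _
      obtain ⟨w, hw, hw2⟩ := (LieSubmodule.mem_map _).mp this
      have hw1 : w.1 = (v₁, 0) := Prod.ext hw2 hw
      obtain ⟨a, ha⟩ := hmul w.1 w.2 (by rw [hw1]; exact Prod.ext hc1 ((lie_zero h).trans (smul_zero c).symm))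
      rw [hw1] at ha
      have ha1 : v₁ = a • v₁ := congrArg Prod.fst ha
      have ha2 : (0 : M₂) = a • v₂ := congrArg Prod.snd ha
      rcases smul_eq_zero.mp ha2.symm with h | h
      · exact h₁ (by rw [ha1, h, zero_smul])
      · exact h₂ h
  let e₁ : W ≃ₗ⁅ℂ, G⁆ M₁ := equivOfBijective p₁ ⟨i₁, s₁⟩
  let e₂ : W ≃ₗ⁅ℂ, G⁆ M₂ := equivOfBijective p₂ ⟨i₂, s₂⟩
  exact ⟨e₁.symm.trans e₂⟩

end Prod

end HighestWeight

/-! ### Cohomology of Lie superalgebras with a one-dimensional central even part -/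

namespace LieSuperCohomology

open MvPolynomial SymmForm

/-! ### Sums over pairs of arguments -/

section Pairs

/-- A function of pairs of distinct positions that is invariant under exchanging the positions. -/
theorem two_mul_sum_pairs {k : ℕ} (f : Fin (k + 2) → Fin (k + 1) → ℂ)
    (hf : ∀ s t, f (s.succAbove t) (t.predAbove s) = f s t) :
    ∑ s, ∑ t, f s t = 2 * ∑ s : Fin (k + 2), ∑ t : Fin (k + 1),
      if (s : ℕ) ≤ t then f s t else 0 := by
  -- This involution exchanges the two chosen positions; exactly one of a pair and its image
  -- satisfies `s ≤ t`.
  let i : Fin (k + 2) × Fin (k + 1) → Fin (k + 2) × Fin (k + 1) :=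
    fun x => (x.1.succAbove x.2, x.2.predAbove x.1)
  have hi : Function.Involutive i := fun x => Prod.ext
    (Fin.succAbove_succAbove_predAbove x.1 x.2) (Fin.predAbove_predAbove_succAbove x.1 x.2)
  have hle : ∀ x : Fin (k + 2) × Fin (k + 1),
      ((i x).1 : ℕ) ≤ (i x).2 ↔ ¬ (x.1 : ℕ) ≤ x.2 := by
    rintro ⟨s, t⟩
    simp only [i]
    rcases le_or_gt s t.castSucc with h | h
    · rw [Fin.succAbove_of_le_castSucc _ _ h, Fin.predAbove_of_le_castSucc _ _ h]
      have : (s : ℕ) ≤ t := h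
      simpa using Nat.lt_succ_of_le this
    · rw [Fin.succAbove_of_castSucc_lt _ _ h, Fin.predAbove_of_castSucc_lt _ _ h]
      have : (t : ℕ) < s := h
      simp; omega
  simp only [← Fintype.sum_prod_type']
  have h := Equiv.sum_comp hi.toPerm fun x : Fin (k + 2) × Fin (k + 1) =>
    if (x.1 : ℕ) ≤ x.2 then f x.1 x.2 else 0
  rw [two_mul]
  nth_rewrite 1 [← h]
  rw [← Finset.sum_add_distrib]
  refine Finset.sum_congr rfl fun x _ => ?_
  change f x.1 x.2 = (if ((i x).1 : ℕ) ≤ (i x).2 then f (i x).1 (i x).2 else 0) + _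
  simp only [hle]
  have := hf x.1 x.2
  by_cases hx : (x.1 : ℕ) ≤ x.2
  · simp [hx]
  · simp only [hx, not_false_eq_true, if_true, if_false, add_zero]
    exact this.symm

end Pairs

variable {U₀ U₁ : Type*} [AddCommGroup U₀] [Module ℂ U₀] [AddCommGroup U₁] [Module ℂ U₁]

theorem IsForm.isSymm {p k : ℕ} {f : (Fin p → U₀) → (Fin k → U₁) → ℂ} (hf : IsForm f)
    (ξ : Fin p → U₀) : IsSymm (f ξ) :=
  ⟨hf.add_odd ξ, hf.smul_odd ξ, hf.symmetric ξ⟩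

theorem IsForm.apply_smul {k : ℕ} {f : (Fin 1 → U₀) → (Fin k → U₁) → ℂ} (hf : IsForm f) (a : ℂ)
    (z : U₀) (η : Fin k → U₁) : f (fun _ => a • z) η = a * f (fun _ => z) η := by
  have h := hf.smul_even (fun _ => z) η 0 a z
  rw [show Function.update (fun _ : Fin 1 => z) 0 (a • z) = fun _ => a • z from
    funext fun j => by rw [Subsingleton.elim j 0, Function.update_self],
    Function.update_eq_self (0 : Fin 1) (fun _ : Fin 1 => z)] at h
  exact h

theorem isForm_zero (p k : ℕ) : IsForm (0 : (Fin p → U₀) → (Fin k → U₁) → ℂ) := by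
  constructor <;> simp

/-- An alternating form in at least two variables on a line vanishes. -/
theorem IsForm.eq_zero (ζ : U₀ ≃ₗ[ℂ] ℂ) {p k : ℕ}
    {f : (Fin (p + 2) → U₀) → (Fin k → U₁) → ℂ} (hf : IsForm f) : f = 0 := by
  funext ξ η
  have h01 : (0 : Fin (p + 2)) ≠ 1 := by simp
  set z := ζ.symm 1
  have hz : ∀ x : U₀, ζ x • z = x := fun x => by
    rw [← map_smul, smul_eq_mul, mul_one, ζ.symm_apply_apply]
  let ξ' := Function.update (Function.update ξ 0 z) 1 z
  have h0 : f ξ' η = 0 := by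
    have h := hf.alternating ξ' η (Equiv.swap 0 1)
    have : (fun i => ξ' (Equiv.swap 0 1 i)) = ξ' := by
      funext i
      by_cases hi0 : i = 0
      · subst hi0; simp [ξ', h01]
      by_cases hi1 : i = 1
      · subst hi1; simp [ξ', h01]
      · rw [Equiv.swap_apply_of_ne_of_ne hi0 hi1]
    rw [this, Equiv.Perm.sign_swap h01] at h
    push_cast at h
    linear_combination h / 2
  have h1 : ξ = Function.update (Function.update ξ 0 (ζ (ξ 0) • z)) 1 (ζ (ξ 1) • z) := by
    rw [hz, hz, Function.update_eq_self, Function.update_eq_self]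
  rw [h1, hf.smul_even, Function.update_comm h01, hf.smul_even, Function.update_comm h01.symm]
  change _ * (_ * f ξ' η) = 0
  rw [h0, mul_zero, mul_zero]

/-! ### The differential when the even part is a central line -/

section Differential

variable {S : LieSuperStructure U₀ U₁}

theorem IsForm.cons_zero_even {p k : ℕ} {f : (Fin (p + 1) → U₀) → (Fin k → U₁) → ℂ}
    (hf : IsForm f) (ξ : Fin p → U₀) (η : Fin k → U₁) : f (Fin.cons 0 ξ) η = 0 := by
  have := hf.add_cons_even 0 0 ξ η
  rw [add_zero] at this
  linear_combination -this

theorem d_eq_dOO (hee : ∀ x y, S.ee x y = 0) (heo : ∀ x a, S.eo x a = 0) {c : Family U₀ U₁}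
    (hc : ∀ p k, IsForm (c p k)) : d S c = dOO S c := by
  have h1 : dEE S c = 0 := by
    funext p k ξ η
    match p with
    | 0 => rfl
    | 1 => rfl
    | p + 2 => simp [dEE, hee, (hc _ _).cons_zero_even]
  have h2 : dEO S c = 0 := by
    funext p k ξ η
    match p, k with
    | 0, _ => rfl
    | _ + 1, 0 => rfl
    | p + 1, k + 1 =>
      have h0 : ∀ ξ' (η' : Fin k → U₁), c p (k + 1) ξ' (Fin.cons 0 η') = 0 := fun ξ' η' => by
        simpa using ((hc p (k + 1)).isSymm ξ').smul_cons 0 0 η'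
      simp [dEO, heo, h0]
  change dEE S c + dEO S c + dOO S c = dOO S c
  rw [h1, h2, zero_add, zero_add]

/-- The part of the differential that involves brackets of odd elements, as a sum over all ordered
pairs of arguments. -/
theorem two_mul_dOO (c : Family U₀ U₁) (p k : ℕ) (ξ : Fin p → U₀)
    (η : Fin (k + 2) → U₁) : 2 * dOO S c p (k + 2) ξ η = ∑ s, ∑ t,
      c (p + 1) k (Fin.cons (S.oo (η s) (η (s.succAbove t))) ξ)
        fun j => η (s.succAbove (t.succAbove j)) := by
  rw [two_mul_sum_pairs]
  · rfl
  · intro s t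
    simp only [Fin.succAbove_succAbove_predAbove, Fin.succAbove_succAbove_succAbove_predAbove]
    rw [S.oo_symm]

/-- As half of the sum over ordered pairs, this is a symmetrization in two stages, so
`IsSymm.sum_succAbove` applies twice. Symmetry allows the differential to be computed on the
diagonal. -/
theorem isSymm_dOO {c : Family U₀ U₁} (hc : ∀ p k, IsForm (c p k)) (p k : ℕ) (ξ : Fin p → U₀) :
    IsSymm (dOO S c p (k + 2) ξ) := by
  have hin : ∀ a : U₁, IsSymm fun w : Fin (k + 1) → U₁ => ∑ t,
      c (p + 1) k (Fin.cons (S.oo a (w t)) ξ) fun j => w (t.succAbove j) := fun a => by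
    refine IsSymm.sum_succAbove (fun b w => c (p + 1) k (Fin.cons (S.oo a b) ξ) w) ?_ ?_
      fun b => (hc _ _).isSymm _
    · intro b b' w
      rw [map_add, (hc _ _).add_cons_even]
    · intro r b w
      have := (hc (p + 1) k).smul_even (Fin.cons 0 ξ) w 0 r (S.oo a b)
      rwa [Fin.update_cons_zero, Fin.update_cons_zero, ← map_smul] at this
  have hout : IsSymm fun η : Fin (k + 2) → U₁ => ∑ s, ∑ t,
      c (p + 1) k (Fin.cons (S.oo (η s) (η (s.succAbove t))) ξ)
        fun j => η (s.succAbove (t.succAbove j)) := by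
    refine IsSymm.sum_succAbove (fun a w => ∑ t, c (p + 1) k (Fin.cons (S.oo a (w t)) ξ)
      fun j => w (t.succAbove j)) ?_ ?_ hin
    · intro a a' w
      simp only [map_add, LinearMap.add_apply, (hc _ _).add_cons_even, Finset.sum_add_distrib]
    · intro r a w
      rw [Finset.mul_sum]
      refine Finset.sum_congr rfl fun t _ => ?_
      have := (hc (p + 1) k).smul_even (Fin.cons 0 ξ) (fun j => w (t.succAbove j)) 0 r
        (S.oo a (w t))
      rwa [Fin.update_cons_zero, Fin.update_cons_zero, ← LinearMap.smul_apply, ← map_smul] at this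
  have h := hout.const_mul (1 / 2)
  have e : dOO S c p (k + 2) ξ = fun η : Fin (k + 2) → U₁ => 1 / 2 * ∑ s, ∑ t,
      c (p + 1) k (Fin.cons (S.oo (η s) (η (s.succAbove t))) ξ)
        fun j => η (s.succAbove (t.succAbove j)) := by
    funext η
    rw [← two_mul_dOO]
    ring
  rw [e]
  exact h

/-- On the diagonal all `(k + 2)(k + 1)` ordered pairs contribute the same term, and linearity on
the line extracts the coordinate of `[η, η]`. -/
theorem dOO_diag (ζ : U₀ ≃ₗ[ℂ] ℂ) {c : Family U₀ U₁} (hc : ∀ p k, IsForm (c p k)) (k : ℕ)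
    (ξ : Fin 0 → U₀) (η : U₁) : 2 * dOO S c 0 (k + 2) ξ (fun _ => η) =
      ((k + 2) * (k + 1) : ℂ) * (ζ (S.oo η η) * c 1 k (fun _ => ζ.symm 1) fun _ => η) := by
  rw [two_mul_dOO, ← (hc 1 k).apply_smul, ← map_smul, smul_eq_mul, mul_one,
    ζ.symm_apply_apply]
  have : (Fin.cons (S.oo η η) ξ : Fin 1 → U₀) = fun _ => S.oo η η :=
    funext fun j => Fin.cases rfl (fun i => i.elim0) j
  simp only [this, Finset.sum_const, Finset.card_univ, Fintype.card_fin, nsmul_eq_mul]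
  push_cast
  ring

end Differential

theorem isForm_of_isSymm_zero {k : ℕ} {f : (Fin k → U₁) → ℂ} (hf : IsSymm f) :
    IsForm fun (_ : Fin 0 → U₀) η => f η where
  add_even _ _ i := i.elim0
  smul_even _ _ i := i.elim0
  add_odd _ := hf.add
  smul_odd _ := hf.smul
  alternating ξ η σ := by rw [Subsingleton.elim σ 1]; simp
  symmetric _ := hf.symm

theorem isForm_of_isSymm_one (ζ : U₀ ≃ₗ[ℂ] ℂ) {k : ℕ} {f : (Fin k → U₁) → ℂ} (hf : IsSymm f) :
    IsForm fun (ξ : Fin 1 → U₀) η => ζ (ξ 0) * f η where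
  add_even ξ η i x y := by
    rw [Subsingleton.elim i 0]
    simp only [Function.update_self, map_add]; ring
  smul_even ξ η i a x := by
    rw [Subsingleton.elim i 0]
    simp only [Function.update_self, map_smul, smul_eq_mul]; ring
  add_odd ξ := (hf.const_mul (ζ (ξ 0))).add
  smul_odd ξ := (hf.const_mul (ζ (ξ 0))).smul
  alternating ξ η σ := by rw [Subsingleton.elim σ 1]; simp
  symmetric ξ := (hf.const_mul (ζ (ξ 0))).symm

/-- The family with only one nonzero member. -/
noncomputable def singleFamily (p k : ℕ) (f : (Fin p → U₀) → (Fin k → U₁) → ℂ) : Family U₀ U₁ :=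
  Pi.single p (Pi.single k f)

theorem singleFamily_self (p k : ℕ) (f : (Fin p → U₀) → (Fin k → U₁) → ℂ) :
    singleFamily p k f p k = f := by simp [singleFamily]

theorem singleFamily_of_ne {p k p' k' : ℕ} (f : (Fin p → U₀) → (Fin k → U₁) → ℂ)
    (h : ¬ (p' = p ∧ k' = k)) : singleFamily p k f p' k' = 0 := by
  by_cases hp : p' = p
  · subst hp
    have hk : k' ≠ k := fun hk => h ⟨rfl, hk⟩
    simp [singleFamily, Pi.single_eq_of_ne hk]
  · simp [singleFamily, Pi.single_eq_of_ne hp]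

theorem singleFamily_mem {p k q : ℕ} (hq : p + k = q) {f : (Fin p → U₀) → (Fin k → U₁) → ℂ}
    (hf : IsForm f) : singleFamily p k f ∈ cochains U₀ U₁ q := by
  refine ⟨fun p' k' => ?_, fun p' k' h => singleFamily_of_ne _ ?_⟩
  · by_cases h : p' = p ∧ k' = k
    · obtain ⟨rfl, rfl⟩ := h
      rw [singleFamily_self]; exact hf
    · rw [singleFamily_of_ne _ h]; exact isForm_zero _ _
  · rintro ⟨rfl, rfl⟩; exact h hq

/-! ### Cocycles and coboundaries as polynomials -/

section Cocycles

variable {ι : Type*} [Fintype ι]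

/-- The data of a Lie superalgebra whose even part is a line with vanishing brackets, and in which
the bracket of odd elements is given by a quadric `P` in the coordinates of a basis `e`. -/
structure IsHeisenberg (S : LieSuperStructure U₀ U₁) (ζ : U₀ ≃ₗ[ℂ] ℂ) (e : Module.Basis ι ℂ U₁)
    (P : MvPolynomial ι ℂ) (κ : ℂ) : Prop where
  ee : ∀ x y, S.ee x y = 0
  eo : ∀ x a, S.eo x a = 0
  oo : ∀ a, ζ (S.oo a a) = κ * eval (e.repr a) P
  ne_zero : P ≠ 0
  scalar_ne_zero : κ ≠ 0
  homogeneous : P.IsHomogeneous 2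

variable {S : LieSuperStructure U₀ U₁} {ζ : U₀ ≃ₗ[ℂ] ℂ} {e : Module.Basis ι ℂ U₁}
  {P : MvPolynomial ι ℂ} {κ : ℂ} (hS : IsHeisenberg S ζ e P κ)

-- The heart of the computation: on polynomials the differential is multiplication by the quadric,
-- up to a nonzero constant. The values agree by `dOO_diag`.
include hS in
theorem IsHeisenberg.toPoly_dOO {c : Family U₀ U₁} (hc : ∀ p k, IsForm (c p k)) (k : ℕ) :
    C 2 * toPoly e (k + 2) (dOO S c 0 (k + 2) Fin.elim0) =
      C ((k + 2) * (k + 1) * κ) * (P * toPoly e k (c 1 k fun _ => ζ.symm 1)) := by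
  refine ext_eval e fun η => ?_
  simp only [map_mul, eval_C, eval_toPoly e (isSymm_dOO hc 0 k Fin.elim0),
    eval_toPoly e ((hc 1 k).isSymm _)]
  rw [dOO_diag ζ hc, hS.oo]
  ring

theorem eq_zero_of_apply_symm_one {k : ℕ} {f : (Fin 1 → U₀) → (Fin k → U₁) → ℂ} (hf : IsForm f)
    (ζ : U₀ ≃ₗ[ℂ] ℂ) (h : (f fun _ => ζ.symm 1) = 0) : f = 0 := by
  funext ξ η
  have : ξ = fun _ => ζ (ξ 0) • ζ.symm 1 := funext fun j => by
    rw [← map_smul, smul_eq_mul, mul_one, ζ.symm_apply_apply, Subsingleton.elim j 0]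
  rw [this, hf.apply_smul, h]
  simp

include hS in
/-- The cocycles are the cochains without even arguments. -/
theorem IsHeisenberg.d_eq_zero_iff {c : Family U₀ U₁} (hc : ∀ p k, IsForm (c p k)) :
    d S c = 0 ↔ ∀ p k, c (p + 1) k = 0 := by
  rw [d_eq_dOO hS.ee hS.eo hc]
  constructor
  · intro h p k
    cases p with
    | succ p => exact (hc _ _).eq_zero ζ
    | zero =>
      refine eq_zero_of_apply_symm_one (hc 1 k) ζ ?_
      refine ((hc 1 k).isSymm _).eq_zero_of_toPoly e ?_
      have h1 := hS.toPoly_dOO hc k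
      rw [h, show (0 : Family U₀ U₁) 0 (k + 2) Fin.elim0 = 0 from rfl, map_zero, mul_zero,
        eq_comm, mul_eq_zero, mul_eq_zero] at h1
      -- The polynomial ring is a domain and neither the constant nor `P` is zero, so the
      -- differential is injective on forms with one even argument.
      refine (h1.resolve_left ?_).resolve_left hS.ne_zero
      rw [C_eq_zero]
      exact mul_ne_zero (mul_ne_zero (by norm_cast) (by norm_cast)) hS.scalar_ne_zero
  · intro h
    funext p k ξ η
    match k with
    | 0 => rfl
    | 1 => rfl
    | k + 2 => simp [dOO, h]

variable {G : Type*} [LieRing G] [LieAlgebra ℂ G]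
  [LieRingModule G U₀] [LieModule ℂ G U₀] [LieRingModule G U₁] [LieModule ℂ G U₁]
  (hG : ActsByDerivations G S)

/-- The polynomial function `η ↦ c (η, …, η)` of a cocycle `c`. -/
noncomputable def cocyclePoly (e : Module.Basis ι ℂ U₁) (q : ℕ) :
    cocycles hG q →ₗ[ℂ] homogeneousSubmodule ι ℂ q :=
  LinearMap.codRestrict _
    { toFun := fun c => toPoly e q (c.1.1 0 q Fin.elim0)
      map_add' := fun _ _ => map_add (toPoly e q) _ _
      map_smul' := fun r _ => map_smul (toPoly e q) r _ } fun _ => toPoly_isHomogeneous e _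

theorem coe_cocyclePoly (q : ℕ) (c : cocycles hG q) :
    (cocyclePoly hG e q c : MvPolynomial ι ℂ) = toPoly e q (c.1.1 0 q Fin.elim0) := rfl

theorem eval_cocyclePoly (q : ℕ) (c : cocycles hG q) (η : U₁) :
    eval (e.repr η) (cocyclePoly hG e q c : MvPolynomial ι ℂ) =
      c.1.1 0 q Fin.elim0 fun _ => η :=
  eval_toPoly e ((c.1.2.1 0 q).isSymm Fin.elim0) η

theorem cocycle_mem (q : ℕ) (c : cocycles hG q) : d S c.1.1 = 0 := c.2

-- A cocycle amounts to its component without even arguments, an arbitrary symmetric form;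
-- polarization does the rest.
include hS in
theorem IsHeisenberg.cocyclePoly_bijective (q : ℕ) :
    Function.Bijective (cocyclePoly hG e q) := by
  constructor
  · refine (injective_iff_map_eq_zero _).mpr fun c hc => ?_
    have h1 := (hS.d_eq_zero_iff c.1.2.1).mp (cocycle_mem hG q c)
    have h2 := ((c.1.2.1 0 q).isSymm Fin.elim0).eq_zero_of_toPoly e (congrArg Subtype.val hc)
    refine Subtype.ext (Subtype.ext ?_)
    funext p k
    match p with
    | p + 1 => exact h1 p k
    | 0 =>
      by_cases hk : k = q
      · subst hk
        funext ξ
        rw [Subsingleton.elim ξ Fin.elim0, h2]; rfl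
      · exact c.1.2.2 0 k (by omega)
  · rintro ⟨p, hp⟩
    obtain ⟨f, hf, hfp⟩ := exists_toPoly_eq e hp
    let c : cochains U₀ U₁ q := ⟨singleFamily 0 q fun _ η => f η,
      singleFamily_mem (zero_add q) (isForm_of_isSymm_zero hf)⟩
    have hc : c ∈ cocycles hG q := (hS.d_eq_zero_iff c.2.1).mpr fun p k =>
      singleFamily_of_ne (fun _ η => f η) fun h => Nat.succ_ne_zero p h.1
    refine ⟨⟨c, hc⟩, Subtype.ext (Eq.trans ?_ hfp)⟩
    change toPoly e q (singleFamily 0 q (fun _ η => f η) 0 q Fin.elim0) = _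
    rw [singleFamily_self]

/-- The component of degree `q - 2` of any cofactor is again a cofactor; for `q < 2` only the zero
multiple is homogeneous of degree `q`. -/
theorem exists_isHomogeneous_factor {P p : MvPolynomial ι ℂ} (hP : P.IsHomogeneous 2) {q : ℕ}
    (hp : p.IsHomogeneous q) (h : P ∣ p) :
    p = 0 ∨ ∃ k g, q = k + 2 ∧ IsHomogeneous g k ∧ p = P * g := by
  obtain ⟨g, rfl⟩ := h
  let _ : GradedAlgebra (homogeneousSubmodule ι ℂ) := gradedAlgebra
  have hcomp := DirectSum.decompose_of_mem_same (homogeneousSubmodule ι ℂ) hp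
  by_cases hq : 2 ≤ q
  · obtain ⟨k, rfl⟩ := Nat.exists_eq_add_of_le hq
    refine Or.inr ⟨k, DirectSum.decompose (homogeneousSubmodule ι ℂ) g k, add_comm _ _,
      SetLike.coe_mem (DirectSum.decompose (homogeneousSubmodule ι ℂ) g k), ?_⟩
    rw [← DirectSum.coe_decompose_mul_add_of_left_mem (homogeneousSubmodule ι ℂ) hP, hcomp]
  · left
    rw [← hcomp]
    exact DirectSum.coe_decompose_mul_of_left_mem_of_not_le (homogeneousSubmodule ι ℂ) hP hq

include hS in
/-- The coboundaries correspond to the multiples of the quadric. -/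
theorem IsHeisenberg.mem_coboundaries_iff (q : ℕ) (c : cocycles hG q) :
    c ∈ coboundaries hG q ↔ P ∣ (cocyclePoly hG e q c : MvPolynomial ι ℂ) := by
  constructor
  · intro h
    match q with
    | 0 =>
      have h0 : c = 0 := (LieSubmodule.mem_bot c).mp h
      rw [h0, map_zero]
      exact dvd_zero P
    -- A single odd argument leaves no pair to bracket.
    | 1 =>
      obtain ⟨b, hb, hbc⟩ := h
      have : c.1.1 = dOO S b := by rw [← d_eq_dOO hS.ee hS.eo hb.1, hbc]; rfl
      rw [coe_cocyclePoly, this, show dOO S b 0 1 Fin.elim0 = 0 from rfl, map_zero]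
      exact dvd_zero P
    | q + 2 =>
      obtain ⟨b, hb, hbc⟩ := h
      have : c.1.1 = dOO S b := by rw [← d_eq_dOO hS.ee hS.eo hb.1, hbc]; rfl
      rw [coe_cocyclePoly, this]
      have h2 : (C 2 : MvPolynomial ι ℂ) * C (1 / 2) = 1 := by rw [← C_mul]; norm_num
      have h1 := hS.toPoly_dOO hb.1 q
      refine ⟨C (1 / 2) * (C ((q + 2) * (q + 1) * κ) *
        toPoly e q (b 1 q fun _ => ζ.symm 1)), ?_⟩
      linear_combination C (1 / 2) * h1 - toPoly e (q + 2) (dOO S b 0 (q + 2) Fin.elim0) * h2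
  · intro h
    rcases exists_isHomogeneous_factor hS.homogeneous (cocyclePoly hG e q c).2 h with
      h0 | ⟨k, g, rfl, hg, hgc⟩
    · have hc0 : c = 0 := (hS.cocyclePoly_bijective hG q).1 (by rw [map_zero]; exact Subtype.ext h0)
      rw [hc0]
      exact zero_mem _
    · obtain ⟨f, hf, hfg⟩ := exists_toPoly_eq e hg
      have hn : ((k + 2) * (k + 1) * κ : ℂ) ≠ 0 :=
        mul_ne_zero (mul_ne_zero (by norm_cast) (by norm_cast)) hS.scalar_ne_zero
      -- The scalar inverts the factor `(k + 2)(k + 1)κ / 2` by which the differential multiplies.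
      have hf' := hf.const_mul (2 / ((k + 2) * (k + 1) * κ))
      have hb : singleFamily 1 k (fun ξ η => ζ (ξ 0) * (2 / ((k + 2) * (k + 1) * κ) * f η)) ∈
          cochains U₀ U₁ (k + 1) := singleFamily_mem (add_comm _ _) (isForm_of_isSymm_one ζ hf')
      refine ⟨_, hb, ?_⟩
      rw [d_eq_dOO hS.ee hS.eo hb.1]
      have hc1 := (hS.d_eq_zero_iff c.1.2.1).mp (cocycle_mem hG _ c)
      change _ = c.1.1
      funext p l
      match p, l with
      | p + 1, 0 => rw [hc1]; rfl
      | p + 1, 1 => rw [hc1]; rfl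
      | p + 1, l + 2 =>
        rw [hc1]
        funext ξ η
        simp [dOO, singleFamily_of_ne]
      | 0, 0 => rw [c.1.2.2 0 0 (by omega)]; rfl
      | 0, 1 => rw [c.1.2.2 0 1 (by omega)]; rfl
      | 0, l + 2 =>
        by_cases hl : l = k
        · subst hl
          funext ξ
          rw [Subsingleton.elim ξ Fin.elim0]
          -- Both forms are symmetric, so comparing their diagonal values is enough.
          have hs := (isSymm_dOO (S := S) hb.1 0 l Fin.elim0).sub ((c.1.2.1 0 (l + 2)).isSymm Fin.elim0)
          have hz := hs.eq_zero_of_toPoly e (ext_eval e fun η => by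
            rw [eval_toPoly e hs, map_zero, ← eval_cocyclePoly (e := e), hgc, ← hfg,
              sub_eq_zero]
            have h1 := dOO_diag (S := S) ζ hb.1 l Fin.elim0 η
            rw [singleFamily_self, hS.oo] at h1
            simp only [LinearEquiv.apply_symm_apply, one_mul] at h1
            rw [map_mul, eval_toPoly e hf]
            have h2 : ((l + 2) * (l + 1) * κ : ℂ) * (2 / ((l + 2) * (l + 1) * κ)) = 2 :=
              mul_div_cancel₀ _ hn
            linear_combination h1 / 2 + (eval (e.repr η) P * f fun _ => η) / 2 * h2)
          funext η
          exact sub_eq_zero.mp (congrFun hz η)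
        · rw [c.1.2.2 0 (l + 2) (by omega)]
          funext ξ η
          have : singleFamily 1 k (fun (ξ : Fin 1 → U₀) η =>
              ζ (ξ 0) * (2 / ((k + 2) * (k + 1) * κ) * f η)) 1 l = 0 :=
            singleFamily_of_ne _ fun h => hl h.2
          simp [dOO, this]

theorem cocyclePoly_lie [DecidableEq ι] (q : ℕ) (X : G) (c : cocycles hG q) :
    (cocyclePoly hG e q ⁅X, c⁆ : MvPolynomial ι ℂ) =
      linDeriv (LinearMap.toMatrix e e (LieModule.toEnd ℂ G U₁ X))
        (cocyclePoly hG e q c : MvPolynomial ι ℂ) := by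
  have h1 : (⁅X, c⁆ : cocycles hG q).1.1 0 q Fin.elim0 = fun η =>
      -∑ j, c.1.1 0 q Fin.elim0 (Function.update η j (LieModule.toEnd ℂ G U₁ X (η j))) := by
    funext η
    change act X c.1.1 0 q Fin.elim0 η = _
    rw [act_apply]
    simp
  have h2 := ((c.1.2.1 0 q).act X).isSymm Fin.elim0
  rw [coe_cocyclePoly, coe_cocyclePoly, h1]
  refine toPoly_act e _ ((c.1.2.1 0 q).isSymm _) ?_
  rw [← h1]
  exact h2

end Cocycles

end LieSuperCohomology

/-! ### The graded pieces of `𝔬𝔰𝔭(n|2)` in coordinates -/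

namespace OrthoSymplectic

open Quadric SymmForm

variable {m r : ℕ}

/-- The involution of the basis of `ℂ^n` given by the form. -/
def dualIdx : EvenIdx m r → EvenIdx m r := Sum.map Sum.swap id

@[simp] theorem dualIdx_dualIdx (i : EvenIdx m r) : dualIdx (dualIdx i) = i := by
  rcases i with (i | i) | i <;> rfl

theorem dualIdx_eq_iff {i j : EvenIdx m r} : dualIdx i = j ↔ i = dualIdx j :=
  ⟨fun h => by rw [← h, dualIdx_dualIdx], fun h => by rw [h, dualIdx_dualIdx]⟩

theorem formMatrix_inl_inl (i j : EvenIdx m r) :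
    formMatrix m r (Sum.inl i) (Sum.inl j) = if j = dualIdx i then 1 else 0 := by
  rcases i with (i | i) | i <;> rcases j with (j | j) | j <;>
    simp [formMatrix, dualIdx, Matrix.one_apply, eq_comm]

theorem formMatrix_inl_inr (i : EvenIdx m r) (j : Fin 2) :
    formMatrix m r (Sum.inl i) (Sum.inr j) = 0 := rfl

theorem formMatrix_inr_inl (i : Fin 2) (j : EvenIdx m r) :
    formMatrix m r (Sum.inr i) (Sum.inl j) = 0 := rfl

theorem formMatrix_inr_inr (i j : Fin 2) :
    formMatrix m r (Sum.inr i) (Sum.inr j) = !![0, 1; -1, 0] i j := rfl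

/-- The parity of a basis vector. -/
def parity : Idx m r → ZMod 2 := Sum.elim (fun _ => 0) fun _ => 1

/-- The degree of a basis vector in the `ℤ`-grading. -/
def degree : Idx m r → ℤ := Sum.elim (fun _ => 0) ![1, -1]

theorem mem_V_iff {τ : ZMod 2} {x : Idx m r → ℂ} : x ∈ V m r τ ↔ ∀ i, parity i ≠ τ → x i = 0 := by
  have hd : τ = 0 ∨ τ = 1 := by revert τ; decide
  change ((τ = 0 → ∀ j, x (Sum.inr j) = 0) ∧ (τ = 1 → ∀ i, x (Sum.inl i) = 0)) ↔ _
  rcases hd with rfl | rfl <;> simp [parity]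

theorem single_mem_V (i : Idx m r) : Pi.single i 1 ∈ V m r (parity i) := by
  rw [mem_V_iff]
  intro j hj
  rw [Pi.single_eq_of_ne]
  rintro rfl
  exact hj rfl

theorem mul_apply_idx (a b : Mat m r) (i j : Idx m r) : (a * b) i j =
    (∑ k, a i (Sum.inl k) * b (Sum.inl k) j) +
      (a i (Sum.inr 0) * b (Sum.inr 0) j + a i (Sum.inr 1) * b (Sum.inr 1) j) := by
  rw [Matrix.mul_apply, Fintype.sum_sum_type, Fin.sum_univ_two]

theorem F_mulVec_left (a : Mat m r) (x y : Idx m r → ℂ) :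
    F (a *ᵥ x) y = ∑ i, ∑ j, x i * y j * (aᵀ * formMatrix m r) i j := by
  rw [F, ← vecMul_transpose a x, ← dotProduct_mulVec, mulVec_mulVec]
  simp only [dotProduct, mulVec, Finset.mul_sum]
  exact Finset.sum_congr rfl fun i _ => Finset.sum_congr rfl fun j _ => by ring

theorem F_mulVec_right (a : Mat m r) (x y : Idx m r → ℂ) :
    F x (a *ᵥ y) = ∑ i, ∑ j, x i * y j * (formMatrix m r * a) i j := by
  rw [F, mulVec_mulVec]
  simp only [dotProduct, mulVec, Finset.mul_sum]
  exact Finset.sum_congr rfl fun i _ => Finset.sum_congr rfl fun j _ => by ring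

theorem sum_single_single (i j : Idx m r) (B : Mat m r) :
    ∑ k, ∑ l, (Pi.single i 1 : Idx m r → ℂ) k * (Pi.single j 1 : Idx m r → ℂ) l * B k l =
      B i j := by
  rw [Finset.sum_eq_single i, Finset.sum_eq_single j] <;> simp +contextual [Pi.single_apply]

/-- The basis vectors are homogeneous and the conditions linear, so testing on them suffices. -/
theorem mem_osp_iff {σ : ZMod 2} {a : Mat m r} : a ∈ osp m r σ ↔
    (∀ i j, parity i ≠ σ + parity j → a i j = 0) ∧
      ∀ i j, (aᵀ * formMatrix m r) i j = -sgn σ (parity i) * (formMatrix m r * a) i j := by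
  constructor
  · rintro ⟨h1, h2⟩
    refine ⟨fun i j hij => ?_, fun i j => ?_⟩
    · have h := mem_V_iff.mp (h1 _ _ (single_mem_V j)) i hij
      simpa using h
    · have h := h2 _ _ (single_mem_V i) (Pi.single j 1)
      rwa [F_mulVec_left, F_mulVec_right, sum_single_single, sum_single_single] at h
  · rintro ⟨h1, h2⟩
    refine ⟨fun τ x hx => ?_, fun τ x hx y => ?_⟩
    · rw [mem_V_iff] at hx ⊢
      intro i hi
      change ∑ j, a i j * x j = 0
      refine Finset.sum_eq_zero fun j _ => ?_
      by_cases hj : parity j = τ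
      · rw [h1 i j (by rwa [hj]), zero_mul]
      · rw [hx j hj, mul_zero]
    · rw [mem_V_iff] at hx
      rw [F_mulVec_left, F_mulVec_right, Finset.mul_sum]
      refine Finset.sum_congr rfl fun i _ => ?_
      rw [Finset.mul_sum]
      refine Finset.sum_congr rfl fun j _ => ?_
      by_cases hi : parity i = τ
      · rw [h2, hi]; ring
      · rw [hx i hi]; ring

theorem transpose_mul_form_inl (a : Mat m r) (i : Idx m r) (j : EvenIdx m r) :
    (aᵀ * formMatrix m r) i (Sum.inl j) = a (Sum.inl (dualIdx j)) i := by
  rw [Matrix.mul_apply, Fintype.sum_sum_type]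
  simp only [formMatrix_inl_inl, formMatrix_inr_inl, Matrix.transpose_apply, mul_zero,
    Finset.sum_const_zero, add_zero, mul_ite, mul_one]
  rw [Finset.sum_eq_single (dualIdx j)]
  · simp
  · intro k _ hk
    rw [if_neg]
    rintro rfl
    simp at hk
  · simp

theorem form_mul_inl (a : Mat m r) (i : EvenIdx m r) (j : Idx m r) :
    (formMatrix m r * a) (Sum.inl i) j = a (Sum.inl (dualIdx i)) j := by
  rw [Matrix.mul_apply, Fintype.sum_sum_type]
  simp [formMatrix_inl_inl, formMatrix_inl_inr]

theorem transpose_mul_form_zero (a : Mat m r) (i : Idx m r) :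
    (aᵀ * formMatrix m r) i (Sum.inr 0) = -a (Sum.inr 1) i := by
  rw [Matrix.mul_apply, Fintype.sum_sum_type]
  simp [formMatrix_inl_inr, formMatrix_inr_inr]

theorem transpose_mul_form_one (a : Mat m r) (i : Idx m r) :
    (aᵀ * formMatrix m r) i (Sum.inr 1) = a (Sum.inr 0) i := by
  rw [Matrix.mul_apply, Fintype.sum_sum_type]
  simp [formMatrix_inl_inr, formMatrix_inr_inr]

theorem form_mul_zero (a : Mat m r) (j : Idx m r) :
    (formMatrix m r * a) (Sum.inr 0) j = a (Sum.inr 1) j := by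
  rw [Matrix.mul_apply, Fintype.sum_sum_type]
  simp [formMatrix_inr_inl, formMatrix_inr_inr]

theorem form_mul_one (a : Mat m r) (j : Idx m r) :
    (formMatrix m r * a) (Sum.inr 1) j = -a (Sum.inr 0) j := by
  rw [Matrix.mul_apply, Fintype.sum_sum_type]
  simp [formMatrix_inr_inl, formMatrix_inr_inr]

/-- The operator `ad E` multiplies the entry at `(i, j)` by `degree i - degree j`. -/
theorem mem_gradedPiece_iff {σ : ZMod 2} {k : ℤ} {a : Mat m r} : a ∈ gradedPiece m r σ k ↔
    a ∈ osp m r σ ∧ ∀ i j, degree i - degree j ≠ k → a i j = 0 := by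
  change _ ∧ _ ↔ _
  refine and_congr_right fun _ => ?_
  have hE : ∀ i, Sum.elim (fun _ : EvenIdx m r => (0 : ℂ)) ![1, -1] i = (degree i : ℂ) := by
    rintro (i | i)
    · simp [degree]
    · fin_cases i <;> simp [degree]
  have key : ∀ i j, (gradingElement m r * a - a * gradingElement m r) i j =
      ((degree i : ℂ) - degree j) * a i j := by
    intro i j
    rw [Matrix.sub_apply, gradingElement, diagonal_mul, mul_diagonal, hE, hE]
    ring
  constructor
  · intro h i j hij
    have h1 := congrFun (congrFun h i) j
    rw [key, Matrix.smul_apply, smul_eq_mul] at h1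
    have h2 : ((degree i - degree j - k : ℤ) : ℂ) * a i j = 0 := by
      push_cast; linear_combination h1
    refine (mul_eq_zero.mp h2).resolve_left ?_
    exact_mod_cast sub_ne_zero.mpr hij
  · intro h
    ext i j
    rw [key, Matrix.smul_apply, smul_eq_mul]
    by_cases hij : degree i - degree j = k
    · rw [← hij]; push_cast; ring
    · rw [h i j hij]; ring

/-! #### The odd part of the nilradical -/

section Odd

theorem uOdd_apply_eq_zero (η : uOdd m r) {i j : Idx m r} (h : degree i - degree j ≠ 1) :
    (η : Mat m r) i j = 0 := (mem_gradedPiece_iff.mp η.2).2 i j h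

theorem uOdd_apply_inr_inl (η : uOdd m r) (i : EvenIdx m r) :
    (η : Mat m r) (Sum.inr 0) (Sum.inl i) = -(η : Mat m r) (Sum.inl (dualIdx i)) (Sum.inr 1) := by
  have h := (mem_osp_iff.mp (mem_gradedPiece_iff.mp η.2).1).2 (Sum.inl i) (Sum.inr 1)
  rw [transpose_mul_form_one, form_mul_inl] at h
  rw [h]
  simp [parity, sgn]

/-- The element of `𝔤_1` with coordinates `w`. -/
def oddMatrix (w : EvenIdx m r → ℂ) : Mat m r :=
  fromBlocks 0 (Matrix.of fun i j => if j = 1 then w i else 0)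
    (Matrix.of fun i j => if i = 0 then -w (dualIdx j) else 0) 0

theorem oddMatrix_mem (w : EvenIdx m r → ℂ) : oddMatrix w ∈ uOdd m r := by
  rw [mem_gradedPiece_iff, mem_osp_iff]
  refine ⟨⟨?_, ?_⟩, ?_⟩
  · rintro (i | i) (j | j) h
    · rfl
    · simp [parity] at h
      exact absurd rfl h
    · simp [parity] at h
    · rfl
  · rintro (i | i) (j | j)
    · rw [transpose_mul_form_inl, form_mul_inl]
      simp [oddMatrix]
    · fin_cases j
      · simp only [Fin.zero_eta]
        rw [transpose_mul_form_zero, form_mul_inl]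
        simp [oddMatrix]
      · simp only [Fin.mk_one]
        rw [transpose_mul_form_one, form_mul_inl]
        simp [oddMatrix, parity, sgn]
    · fin_cases i
      · simp only [Fin.zero_eta]
        rw [transpose_mul_form_inl, form_mul_zero]
        simp [oddMatrix]
      · simp only [Fin.mk_one]
        rw [transpose_mul_form_inl, form_mul_one]
        simp [oddMatrix, parity]
    · fin_cases i <;> fin_cases j <;> simp only [Fin.zero_eta, Fin.mk_one]
      · rw [transpose_mul_form_zero, form_mul_zero]; simp [oddMatrix]
      · rw [transpose_mul_form_one, form_mul_zero]; simp [oddMatrix]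
      · rw [transpose_mul_form_zero, form_mul_one]; simp [oddMatrix]
      · rw [transpose_mul_form_one, form_mul_one]; simp [oddMatrix]
  · rintro (i | i) (j | j) h
    · rfl
    · fin_cases j
      · simp [oddMatrix]
      · simp [degree] at h
    · fin_cases i
      · simp [degree] at h
      · simp [oddMatrix]
    · rfl

/-- The coordinates on `𝔤_1 ≅ ℂ^n`. -/
def oddEquiv : uOdd m r ≃ₗ[ℂ] (EvenIdx m r → ℂ) where
  toFun η i := (η : Mat m r) (Sum.inl i) (Sum.inr 1)
  map_add' _ _ := rfl
  map_smul' _ _ := rfl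
  invFun w := ⟨oddMatrix w, oddMatrix_mem w⟩
  left_inv η := by
    refine Subtype.ext ?_
    ext i j
    rcases i with i | i <;> rcases j with j | j
    · rw [uOdd_apply_eq_zero η (by simp [degree])]; rfl
    · fin_cases j
      · rw [uOdd_apply_eq_zero η (by simp [degree])]; simp [oddMatrix]
      · simp [oddMatrix]
    · fin_cases i
      · simp [oddMatrix, uOdd_apply_inr_inl]
      · rw [uOdd_apply_eq_zero η (by simp [degree])]; simp [oddMatrix]
    · rw [uOdd_apply_eq_zero η]
      · rfl
      · fin_cases i <;> fin_cases j <;> simp [degree]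
  right_inv w := by
    funext i
    simp [oddMatrix]

theorem oddEquiv_apply (η : uOdd m r) (i : EvenIdx m r) :
    oddEquiv η i = (η : Mat m r) (Sum.inl i) (Sum.inr 1) := rfl

end Odd

/-! #### The even part of the nilradical -/

section Even

theorem uEven_apply_eq_zero (x : uEven m r) {i j : Idx m r} (h : degree i - degree j ≠ 2) :
    (x : Mat m r) i j = 0 := (mem_gradedPiece_iff.mp x.2).2 i j h

theorem evenMatrix_mem (z : ℂ) :
    (fromBlocks 0 0 0 !![0, z; 0, 0] : Mat m r) ∈ uEven m r := by
  rw [mem_gradedPiece_iff, mem_osp_iff]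
  refine ⟨⟨?_, ?_⟩, ?_⟩
  · rintro (i | i) (j | j) h
    · rfl
    · rfl
    · rfl
    · simp [parity] at h
  · rintro (i | i) (j | j)
    · rw [transpose_mul_form_inl, form_mul_inl]
      simp
    · fin_cases j
      · simp only [Fin.zero_eta]
        rw [transpose_mul_form_zero, form_mul_inl]
        simp
      · simp only [Fin.mk_one]
        rw [transpose_mul_form_one, form_mul_inl]
        simp
    · fin_cases i
      · simp only [Fin.zero_eta]
        rw [transpose_mul_form_inl, form_mul_zero]
        simp
      · simp only [Fin.mk_one]
        rw [transpose_mul_form_inl, form_mul_one]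
        simp
    · fin_cases i <;> fin_cases j <;> simp only [Fin.zero_eta, Fin.mk_one]
      · rw [transpose_mul_form_zero, form_mul_zero]; simp
      · rw [transpose_mul_form_one, form_mul_zero]; simp
      · rw [transpose_mul_form_zero, form_mul_one]; simp
      · rw [transpose_mul_form_one, form_mul_one]; simp
  · rintro (i | i) (j | j) h
    · rfl
    · rfl
    · rfl
    · fin_cases i <;> fin_cases j <;> simp [degree] at h ⊢

/-- The coordinate on the line `𝔤_2`. -/
def evenEquiv : uEven m r ≃ₗ[ℂ] ℂ where
  toFun x := (x : Mat m r) (Sum.inr 0) (Sum.inr 1)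
  map_add' _ _ := rfl
  map_smul' _ _ := rfl
  invFun z := ⟨fromBlocks 0 0 0 !![0, z; 0, 0], evenMatrix_mem z⟩
  left_inv x := by
    refine Subtype.ext ?_
    ext i j
    rcases i with i | i <;> rcases j with j | j
    · rw [uEven_apply_eq_zero x (by simp [degree])]; rfl
    · rw [uEven_apply_eq_zero x (by fin_cases j <;> simp [degree])]; rfl
    · rw [uEven_apply_eq_zero x (by fin_cases i <;> simp [degree])]; rfl
    · fin_cases i <;> fin_cases j
      · rw [uEven_apply_eq_zero x (by simp [degree])]; rfl
      · rfl
      · rw [uEven_apply_eq_zero x (by simp [degree])]; rfl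
      · rw [uEven_apply_eq_zero x (by simp [degree])]; rfl
  right_inv z := by simp

/-- The bracket has degree 4, where the grading is zero; `uStructure_eo` is the same in degree 3. -/
theorem uStructure_ee (x y : uEven m r) : (uStructure m r).ee x y = 0 := by
  have h := bracket_mem x.2 y.2
  rw [sgn_zero_left, one_smul] at h
  exact Subtype.ext (eq_zero_of_mem (by norm_num) h)

theorem uStructure_eo (x : uEven m r) (a : uOdd m r) : (uStructure m r).eo x a = 0 := by
  have h := bracket_mem x.2 a.2
  rw [sgn_zero_left, one_smul] at h
  exact Subtype.ext (eq_zero_of_mem (by norm_num) h)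

/-- Here `[a, a] = 2a²`, and the entry in question pairs the row `-w (dualIdx i)` with the column `w
i`. This is the origin of the constant `κ = -2`. -/
theorem evenEquiv_oo (a : uOdd m r) : evenEquiv ((uStructure m r).oo a a) =
    -2 * ∑ i, oddEquiv a i * oddEquiv a (dualIdx i) := by
  have h : evenEquiv ((uStructure m r).oo a a) =
      (a.1 * a.1 + a.1 * a.1) (Sum.inr 0) (Sum.inr 1) := rfl
  rw [h, Matrix.add_apply, Matrix.mul_apply, Fintype.sum_sum_type]
  simp only [uOdd_apply_inr_inl, oddEquiv_apply]
  rw [Fin.sum_univ_two, uOdd_apply_eq_zero a (i := Sum.inr 0) (j := Sum.inr 0) (by simp [degree]),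
    uOdd_apply_eq_zero a (i := Sum.inr 1) (j := Sum.inr 1) (by simp [degree])]
  simp only [neg_mul, Finset.sum_neg_distrib]
  rw [Finset.sum_congr rfl fun i _ => mul_comm (a.1 (Sum.inl (dualIdx i)) (Sum.inr 1)) _]
  ring

end Even

/-! #### The Levi subalgebra -/

section Levi

theorem g0_apply_eq_zero (X : g0 m r) {i j : Idx m r} (h : degree i - degree j ≠ 0) :
    (X : Mat m r) i j = 0 := (mem_gradedPiece_iff.mp (show X.1 ∈ gradedPiece m r 0 0 from X.2)).2 i j h

theorem g0_apply_dualIdx (X : g0 m r) (i j : EvenIdx m r) :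
    (X : Mat m r) (Sum.inl (dualIdx j)) (Sum.inl (dualIdx i)) =
      -(X : Mat m r) (Sum.inl i) (Sum.inl j) := by
  have h := (mem_osp_iff.mp (mem_gradedPiece_iff.mp
    (show X.1 ∈ gradedPiece m r 0 0 from X.2)).1).2 (Sum.inl (dualIdx i)) (Sum.inl j)
  rw [transpose_mul_form_inl, form_mul_inl, dualIdx_dualIdx] at h
  rw [h]; simp

theorem g0_apply_one_one (X : g0 m r) :
    (X : Mat m r) (Sum.inr 1) (Sum.inr 1) = -(X : Mat m r) (Sum.inr 0) (Sum.inr 0) := by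
  have h := (mem_osp_iff.mp (mem_gradedPiece_iff.mp
    (show X.1 ∈ gradedPiece m r 0 0 from X.2)).1).2 (Sum.inr 0) (Sum.inr 1)
  rw [transpose_mul_form_one, form_mul_zero] at h
  rw [h]; simp

/-- The element of `𝔤_0 ≅ 𝔬(n) ⊕ ℂ` with components `A` and `t`. -/
def levi (A : Matrix (EvenIdx m r) (EvenIdx m r) ℂ) (hA : IsOrtho dualIdx A) (t : ℂ) : g0 m r :=
  ⟨fromBlocks A 0 0 !![t, 0; 0, -t], by
    change _ ∈ gradedPiece m r 0 0
    rw [mem_gradedPiece_iff, mem_osp_iff]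
    refine ⟨⟨?_, ?_⟩, ?_⟩
    · rintro (i | i) (j | j) h
      · simp [parity] at h
      · rfl
      · rfl
      · simp [parity] at h
    · rintro (i | i) (j | j)
      · rw [transpose_mul_form_inl, form_mul_inl]
        have := hA (dualIdx i) j
        rw [dualIdx_dualIdx] at this
        simp [this]
      · fin_cases j
        · simp only [Fin.zero_eta]
          rw [transpose_mul_form_zero, form_mul_inl]
          simp
        · simp only [Fin.mk_one]
          rw [transpose_mul_form_one, form_mul_inl]
          simp
      · fin_cases i
        · simp only [Fin.zero_eta]
          rw [transpose_mul_form_inl, form_mul_zero]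
          simp
        · simp only [Fin.mk_one]
          rw [transpose_mul_form_inl, form_mul_one]
          simp
      · fin_cases i <;> fin_cases j <;> simp only [Fin.zero_eta, Fin.mk_one]
        · rw [transpose_mul_form_zero, form_mul_zero]; simp
        · rw [transpose_mul_form_one, form_mul_zero]; simp
        · rw [transpose_mul_form_zero, form_mul_one]; simp
        · rw [transpose_mul_form_one, form_mul_one]; simp
    · rintro (i | i) (j | j) h
      · simp [degree] at h
      · rfl
      · rfl
      · fin_cases i <;> fin_cases j <;> simp [degree] at h ⊢⟩

theorem coe_levi (A : Matrix (EvenIdx m r) (EvenIdx m r) ℂ) (hA : IsOrtho dualIdx A) (t : ℂ) :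
    (levi A hA t : Mat m r) = fromBlocks A 0 0 !![t, 0; 0, -t] := rfl

/-- As a `𝔤_0`-module, `𝔤_1` is the natural representation `ℂ^n` twisted by `δ`; the twist comes
from right multiplication, where the lower odd entry of `X` is minus the upper one. -/
theorem oddEquiv_lie (X : g0 m r) (η : uOdd m r) (i : EvenIdx m r) :
    oddEquiv ⁅X, η⁆ i = (∑ j, (X : Mat m r) (Sum.inl i) (Sum.inl j) * oddEquiv η j) +
      (X : Mat m r) (Sum.inr 0) (Sum.inr 0) * oddEquiv η i := by
  rw [oddEquiv_apply, coe_lie, Matrix.sub_apply, mul_apply_idx, mul_apply_idx]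
  simp only [oddEquiv_apply]
  rw [g0_apply_eq_zero X (i := Sum.inl i) (j := Sum.inr 0) (by simp [degree]),
    g0_apply_eq_zero X (i := Sum.inl i) (j := Sum.inr 1) (by simp [degree]),
    g0_apply_eq_zero X (i := Sum.inr 0) (j := Sum.inr 1) (by simp [degree]), g0_apply_one_one X,
    Finset.sum_eq_zero (s := Finset.univ) (f := fun j : EvenIdx m r =>
      (η : Mat m r) (Sum.inl i) (Sum.inl j) * (X : Mat m r) (Sum.inl j) (Sum.inr 1))]
  · ring
  · intro j _
    rw [uOdd_apply_eq_zero η (by simp [degree]), zero_mul]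

/-- The standard basis of `𝔤_1`. -/
noncomputable def oddBasis (m r : ℕ) : Module.Basis (EvenIdx m r) ℂ (uOdd m r) :=
  Module.Basis.ofEquivFun oddEquiv

theorem oddBasis_repr (η : uOdd m r) (i : EvenIdx m r) : (oddBasis m r).repr η i = oddEquiv η i :=
  rfl

theorem toMatrix_oddBasis (X : g0 m r) (i j : EvenIdx m r) :
    LinearMap.toMatrix (oddBasis m r) (oddBasis m r)
      (LieModule.toEnd ℂ (g0 m r) (uOdd m r) X) i j =
      (X : Mat m r) (Sum.inl i) (Sum.inl j) +
        if i = j then (X : Mat m r) (Sum.inr 0) (Sum.inr 0) else 0 := by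
  rw [LinearMap.toMatrix_apply, oddBasis_repr, LieModule.toEnd_apply_apply, oddEquiv_lie]
  have : oddEquiv (oddBasis m r j) = Pi.single j 1 := by
    rw [oddBasis, Module.Basis.coe_ofEquivFun, LinearEquiv.apply_symm_apply]
  simp [this, Pi.single_apply]

end Levi

end OrthoSymplectic

/-! ### The cohomology of the nilradical -/

namespace OrthoSymplectic

open Quadric SymmForm MvPolynomial LieSuperCohomology

variable {m r : ℕ}

theorem form_isHomogeneous : (form (dualIdx (m := m) (r := r))).IsHomogeneous 2 :=
  IsHomogeneous.sum _ _ _ fun _ _ => (isHomogeneous_X _ _).mul (isHomogeneous_X _ _)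

/-- In this basis `𝔬(n)` acts by its own matrices, so irreducibility is proved here; the normalized
root basis only serves the explicit quadric. -/
theorem isHeisenberg_oddBasis (hn : 0 < 2 * m + r) :
    IsHeisenberg (uStructure m r) evenEquiv (oddBasis m r) (form dualIdx) (-2) where
  ee := uStructure_ee
  eo := uStructure_eo
  oo a := by
    rw [evenEquiv_oo, form]
    simp only [map_sum, map_mul, eval_X, oddBasis_repr]
  ne_zero h := by
    have h1 := congrArg (eval fun _ => (1 : ℂ)) h
    simp only [form, map_sum, map_mul, eval_X, map_zero, mul_one, Finset.sum_const,
      Finset.card_univ, Fintype.card_sum, Fintype.card_fin, nsmul_eq_mul, Nat.cast_eq_zero] at h1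
    omega
  scalar_ne_zero := by norm_num
  homogeneous := form_isHomogeneous

/-! #### The basis in which the quadric has the normalized form -/

/-- The coordinates of an element of `𝔤_1` in the normalized root basis, relative to the standard
coordinates. -/
def coordScale : EvenIdx m r → ℂ
  | Sum.inl (Sum.inl _) => 2
  | _ => 1

theorem coordScale_ne_zero (i : EvenIdx m r) : coordScale i ≠ 0 := by
  rcases i with (i | i) | i <;> simp [coordScale]

/-- The normalized root basis of `𝔤_1`. -/
noncomputable def rootBasis (m r : ℕ) : Module.Basis (EvenIdx m r) ℂ (uOdd m r) :=
  Module.Basis.ofEquivFun (oddEquiv.trans (LinearEquiv.piCongrRight fun i =>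
    LinearEquiv.smulOfNeZero ℂ ℂ (coordScale i) (coordScale_ne_zero i)))

theorem rootBasis_repr (η : uOdd m r) (i : EvenIdx m r) :
    (rootBasis m r).repr η i = coordScale i * oddEquiv η i := rfl

theorem quadric_isHomogeneous : (quadric m r).IsHomogeneous 2 :=
  (IsHomogeneous.sum _ _ _ fun _ _ => (isHomogeneous_X _ _).mul (isHomogeneous_X _ _)).add
    (IsHomogeneous.sum _ _ _ fun _ _ => (isHomogeneous_X _ _).mul (isHomogeneous_X _ _))

/-- The standard quadric counts each product for `δ ± ε_i` twice; the scale 2 at `δ + ε_i` absorbs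
this and leaves the constant `-2` unchanged. -/
theorem isHeisenberg_rootBasis (hn : 0 < 2 * m + r) :
    IsHeisenberg (uStructure m r) evenEquiv (rootBasis m r) (quadric m r) (-2) where
  ee := uStructure_ee
  eo := uStructure_eo
  oo a := by
    rw [evenEquiv_oo, quadric]
    simp only [map_add, map_sum, map_mul, eval_X, rootBasis_repr, coordScale, Fintype.sum_sum_type,
      dualIdx, Sum.map_inl, Sum.map_inr, Sum.swap_inl, Sum.swap_inr, id_eq]
    rw [← Finset.sum_add_distrib, add_comm]
    congr 2
    · exact Finset.sum_congr rfl fun i _ => by ring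
    · exact Finset.sum_congr rfl fun i _ => by ring
  ne_zero h := by
    have h1 := congrArg (eval fun _ => (1 : ℂ)) h
    simp only [quadric, map_add, map_sum, map_mul, eval_X, map_zero, mul_one, Finset.sum_const,
      Finset.card_univ, Fintype.card_fin, nsmul_eq_mul] at h1
    have h2 : ((r + m : ℕ) : ℂ) = 0 := by push_cast; exact h1
    have h3 : r + m = 0 := by exact_mod_cast h2
    omega
  scalar_ne_zero := by norm_num
  homogeneous := quadric_isHomogeneous

theorem cartan_apply_of_ne {h : g0 m r} (hh : h ∈ cartan m r) {i j : Idx m r} (hij : i ≠ j) :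
    (h : Mat m r) i j = 0 := hh hij

/-- The diagonal entries of an element of the Cartan subalgebra. -/
theorem weight_oddRoot (l₀ : ℤ) (h : g0 m r) (i : EvenIdx m r) :
    weight l₀ (oddRoot m r i) h = l₀ * (h : Mat m r) (Sum.inr 0) (Sum.inr 0) +
      (h : Mat m r) (Sum.inl i) (Sum.inl i) := by
  rw [weight]
  congr 1
  rcases i with (i | i) | i
  · simp [oddRoot, Pi.single_apply]
  · have := g0_apply_dualIdx h (Sum.inl (Sum.inl i)) (Sum.inl (Sum.inl i))
    simp only [dualIdx, Sum.map_inl, Sum.swap_inl] at this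
    simp [oddRoot, Pi.single_apply, this]
  · have := g0_apply_dualIdx h (Sum.inr i) (Sum.inr i)
    simp only [dualIdx, Sum.map_inr, id_eq] at this
    simp only [oddRoot, Pi.zero_apply, Int.cast_zero, zero_mul, Finset.sum_const_zero]
    -- A diagonal entry at a self-dual index equals its own negative.
    linear_combination (-1 / 2 : ℂ) * this

theorem isRootBasis_rootBasis : IsRootBasis (rootBasis m r) := by
  intro i h hh
  refine oddEquiv.injective (funext fun j => ?_)
  rw [oddEquiv_lie, map_smul, Pi.smul_apply, smul_eq_mul, weight_oddRoot,
    Finset.sum_eq_single j (fun k _ hk => by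
      rw [cartan_apply_of_ne hh (by simpa using hk.symm), zero_mul]) (by simp)]
  have : coordScale j * oddEquiv (rootBasis m r i) j = if j = i then 1 else 0 := by
    rw [← rootBasis_repr, Module.Basis.repr_self, Finsupp.single_apply]
    simp [eq_comm]
  by_cases hji : j = i
  · subst hji; push_cast; ring
  · rw [if_neg hji] at this
    rw [(mul_eq_zero.mp this).resolve_left (coordScale_ne_zero j)]
    ring

/-! #### The strictly dominant element of the Cartan subalgebra -/

/-- The values of the strictly dominant element on the weights of `ℂ^n`. -/
def height : EvenIdx m r → ℤ
  | Sum.inl (Sum.inl i) => (m : ℤ) - i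
  | Sum.inl (Sum.inr i) => -((m : ℤ) - i)
  | Sum.inr _ => 0

theorem height_dualIdx (i : EvenIdx m r) : height (dualIdx i) = -height i := by
  rcases i with (i | i) | i <;> simp [height, dualIdx]

theorem isOrtho_diagonal {w : EvenIdx m r → ℂ} (hw : ∀ i, w (dualIdx i) = -w i) :
    IsOrtho dualIdx (diagonal w) := by
  intro i j
  rw [diagonal_apply, diagonal_apply]
  by_cases h : i = j
  · subst h; simp [hw]
  · rw [if_neg h, if_neg, neg_zero]
    intro h'
    have := congrArg dualIdx h'
    simp only [dualIdx_dualIdx] at this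
    exact h this.symm

/-- A strictly dominant element of the Cartan subalgebra. -/
noncomputable def dominant (m r : ℕ) : g0 m r :=
  levi (diagonal fun i => (height i : ℂ))
    (isOrtho_diagonal fun i => by rw [height_dualIdx]; push_cast; rfl) 0

theorem dominant_mem : dominant m r ∈ cartan m r := by
  rintro (i | i) (j | j) hij
  · rw [dominant, coe_levi, fromBlocks_apply₁₁]
    exact diagonal_apply_ne _ (by simpa using hij)
  · rfl
  · rfl
  · fin_cases i <;> fin_cases j <;> simp [dominant, coe_levi] at hij ⊢

theorem dominant_apply (i : EvenIdx m r) :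
    (dominant m r : Mat m r) (Sum.inl i) (Sum.inl i) = height i := by
  simp [dominant, coe_levi]

theorem coe_bracket (X Y : g0 m r) : ((⁅X, Y⁆ : g0 m r) : Mat m r) = X.1 * Y.1 - Y.1 * X.1 := rfl

theorem cartan_lie_apply {h : g0 m r} (hh : h ∈ cartan m r) (X : g0 m r) (i j : Idx m r) :
    ((⁅h, X⁆ : g0 m r) : Mat m r) i j =
      ((h : Mat m r) i i - (h : Mat m r) j j) * (X : Mat m r) i j := by
  have hd : diagonal (fun i => (h : Mat m r) i i) = (h : Mat m r) := IsDiag.diagonal_diag hh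
  rw [coe_bracket, Matrix.sub_apply]
  conv_lhs => rw [← hd]
  rw [diagonal_mul, mul_diagonal]
  ring

/-- With indices from 0, `ε_i` takes the value `m - i`; these values are positive and strictly
decreasing, so every positive root takes a positive integral value. -/
theorem exists_weight_dominant_eq {a : Fin m → ℤ} (ha : a ∈ positiveRoots m r) :
    ∃ k : ℕ, 0 < k ∧ weight 0 a (dominant m r) = k := by
  have h1 : weight 0 a (dominant m r) = ((∑ i, a i * ((m : ℤ) - i) : ℤ) : ℂ) := by
    simp only [weight, dominant_apply, height]
    push_cast
    simp
  suffices h : 0 < ∑ i, a i * ((m : ℤ) - i) by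
    obtain ⟨k, hk⟩ := Int.eq_ofNat_of_zero_le h.le
    refine ⟨k, by omega, ?_⟩
    rw [h1, hk]; rfl
  rcases ha with ⟨i, j, hij, rfl | rfl⟩ | ⟨-, i, rfl⟩
  · simp only [Pi.add_apply, Pi.single_apply, add_mul, Finset.sum_add_distrib, ite_mul, one_mul,
      zero_mul, Finset.sum_ite_eq', Finset.mem_univ, if_true]
    omega
  · simp only [Pi.sub_apply, Pi.single_apply, sub_mul, Finset.sum_sub_distrib, ite_mul, one_mul,
      zero_mul, Finset.sum_ite_eq', Finset.mem_univ, if_true]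
    have : (i : ℕ) < j := hij
    omega
  · simp only [Pi.single_apply, ite_mul, one_mul, zero_mul, Finset.sum_ite_eq', Finset.mem_univ,
      if_true]
    omega

/-- A positive root vector annihilates the coordinate of lowest height. -/
theorem isRootVector_apply {a : Fin m → ℤ} (ha : a ∈ positiveRoots m r) {X : g0 m r}
    (hX : IsRootVector a X) (hm : 0 < m) : (X : Mat m r) (Sum.inr 0) (Sum.inr 0) = 0 ∧
      ∀ j, (X : Mat m r) (Sum.inl (Sum.inl (Sum.inr ⟨0, hm⟩))) (Sum.inl j) = 0 := by
  obtain ⟨k, hk, hka⟩ := exists_weight_dominant_eq ha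
  have h := hX _ dominant_mem
  have key : ∀ i j, ((dominant m r : Mat m r) i i - (dominant m r : Mat m r) j j - k) *
      (X : Mat m r) i j = 0 := by
    intro i j
    have h1 := congrFun (congrFun (congrArg Subtype.val h) i) j
    rw [cartan_lie_apply dominant_mem, hka] at h1
    change _ = (k : ℂ) * (X : Mat m r) i j at h1
    linear_combination h1
  refine ⟨?_, fun j => ?_⟩
  · have h1 := key (Sum.inr 0) (Sum.inr 0)
    rw [sub_self, zero_sub, neg_mul, neg_eq_zero] at h1
    exact (mul_eq_zero.mp h1).resolve_left (by exact_mod_cast hk.ne')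
  · refine (mul_eq_zero.mp (key _ _)).resolve_left ?_
    rw [dominant_apply, dominant_apply]
    -- An entry of `X` can be nonzero only if the row is higher than the column by `k > 0`, and this
    -- row has the minimal height `-m`.
    have : (height (Sum.inl (Sum.inr ⟨0, hm⟩) : EvenIdx m r) - height j - k : ℤ) ≠ 0 := by
      rcases j with (j | j) | j <;> simp only [height] <;> omega
    exact_mod_cast this

/-- `𝔤_0` is spanned by the Cartan subalgebra, the positive root vectors, and vectors that lower
the height. -/
theorem span_eq_top (hr : r ≤ 1) :
    Submodule.span ℂ ((cartan m r ∪ {X | ∃ a ∈ positiveRoots m r, IsRootVector a X}) ∪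
      {X | ∃ k : ℕ, 0 < k ∧ ⁅dominant m r, X⁆ = -(k : ℂ) • X}) = ⊤ := by
  rw [eq_top_iff]
  intro X _
  set W := Submodule.span ℂ ((cartan m r ∪ {X | ∃ a ∈ positiveRoots m r, IsRootVector a X}) ∪
      {X : g0 m r | ∃ k : ℕ, 0 < k ∧ ⁅dominant m r, X⁆ = -(k : ℂ) • X})
  have hinv : ∀ i : EvenIdx m r, dualIdx (dualIdx i) = i := dualIdx_dualIdx
  let R : EvenIdx m r → EvenIdx m r → g0 m r := fun x k =>
    levi (raising dualIdx x k) (isOrtho_raising hinv k) 0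
  have hRentry : ∀ (x k i j : EvenIdx m r), (R x k : Mat m r) (Sum.inl i) (Sum.inl j) =
      (if dualIdx x = i ∧ dualIdx k = j then 1 else 0) - if k = i ∧ x = j then 1 else 0 := by
    intro x k i j
    simp [R, coe_levi, raising, Matrix.single_apply]
  have hRlie : ∀ h ∈ cartan m r, ∀ x k, ⁅h, R x k⁆ =
      ((h : Mat m r) (Sum.inl k) (Sum.inl k) - (h : Mat m r) (Sum.inl x) (Sum.inl x)) • R x k := by
    intro h hh x k
    refine Subtype.ext ?_
    ext i j
    rw [cartan_lie_apply hh]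
    change _ = _ * (R x k : Mat m r) i j
    rcases i with i | i <;> rcases j with j | j
    · rw [hRentry]
      by_cases h1 : dualIdx x = i ∧ dualIdx k = j
      · obtain ⟨rfl, rfl⟩ := h1
        rw [g0_apply_dualIdx, g0_apply_dualIdx]
        ring
      · by_cases h2 : k = i ∧ x = j
        · obtain ⟨rfl, rfl⟩ := h2; rfl
        · rw [if_neg h1, if_neg h2]; ring
    · have : (R x k : Mat m r) (Sum.inl i) (Sum.inr j) = 0 := rfl
      rw [this, mul_zero, mul_zero]
    · have : (R x k : Mat m r) (Sum.inr i) (Sum.inl j) = 0 := rfl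
      rw [this, mul_zero, mul_zero]
    · have : (R x k : Mat m r) (Sum.inr i) (Sum.inr j) = 0 := by
        fin_cases i <;> fin_cases j <;> simp [R, coe_levi]
      rw [this, mul_zero, mul_zero]
  have hroot : ∀ x k, oddRoot m r k - oddRoot m r x ∈ positiveRoots m r → R x k ∈ W := by
    intro x k h
    refine Submodule.subset_span (Or.inl (Or.inr ⟨_, h, fun t ht => ?_⟩))
    rw [hRlie t ht]
    congr 1
    have h1 := weight_oddRoot 0 t k
    have h2 := weight_oddRoot 0 t x
    simp only [weight, Pi.sub_apply, Int.cast_sub, sub_mul, Finset.sum_sub_distrib] at h1 h2 ⊢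
    linear_combination h2 - h1
  have hlow : ∀ x k : EvenIdx m r, height k < height x → R x k ∈ W := by
    intro x k h
    obtain ⟨l, hl⟩ := Int.eq_ofNat_of_zero_le (sub_nonneg.mpr h.le)
    refine Submodule.subset_span (Or.inr ⟨l, by omega, ?_⟩)
    rw [hRlie _ dominant_mem, dominant_apply, dominant_apply]
    congr 1
    have : ((height x - height k : ℤ) : ℂ) = l := by rw [hl]; rfl
    push_cast at this
    linear_combination -this
  have hself : ∀ x, R x x ∈ W := by
    intro x
    refine Submodule.subset_span (Or.inl (Or.inl ?_))
    rintro (i | i) (j | j) hij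
    · rw [hRentry, if_neg, if_neg, sub_zero]
      · rintro ⟨rfl, rfl⟩; exact hij rfl
      · rintro ⟨rfl, rfl⟩; exact hij rfl
    · rfl
    · rfl
    · fin_cases i <;> fin_cases j <;> simp [R, coe_levi] at hij ⊢
  have hdual : ∀ x, R x (dualIdx x) ∈ W := by
    intro x
    have : R x (dualIdx x) = 0 := by
      refine Subtype.ext ?_
      ext i j
      rcases i with i | i <;> rcases j with j | j
      · rw [hRentry, dualIdx_dualIdx]; simp
      · rfl
      · rfl
      · fin_cases i <;> fin_cases j <;> simp [R, coe_levi]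
    rw [this]; exact W.zero_mem
  -- Unless `R x k` lowers the height, it is a positive root vector, or `k = x` and it is diagonal,
  -- or `k = dualIdx x` and it vanishes. By `r ≤ 1` no two indices share the height 0.
  have hR : ∀ x k, R x k ∈ W := by
    intro x k
    by_cases hlt : height k < height x
    · exact hlow x k hlt
    rcases k with (k | k) | k <;> rcases x with (x | x) | x <;> simp only [height] at hlt
    · by_cases hkx : k = x
      · subst hkx; exact hself _
      · have : (k : ℕ) ≠ x := fun h => hkx (Fin.ext h)
        exact hroot _ _ (Or.inl ⟨k, x, by rw [Fin.lt_def]; omega, Or.inr rfl⟩)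
    · rcases lt_trichotomy k x with h | h | h
      · exact hroot _ _ (Or.inl ⟨k, x, h, Or.inl (by simp [oddRoot])⟩)
      · subst h; exact hdual _
      · exact hroot _ _ (Or.inl ⟨x, k, h, Or.inl (by simp [oddRoot, add_comm])⟩)
    · have : r = 1 := by have := x.2; omega
      exact hroot _ _ (Or.inr ⟨this, k, by simp [oddRoot]⟩)
    · exfalso; omega
    · by_cases hkx : k = x
      · subst hkx; exact hself _
      · have : (k : ℕ) ≠ x := fun h => hkx (Fin.ext h)
        exact hroot _ _ (Or.inl ⟨x, k, by rw [Fin.lt_def]; omega, Or.inr (by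
          simp only [oddRoot]; abel)⟩)
    · exfalso; omega
    · exfalso; omega
    · have : r = 1 := by have := k.2; omega
      exact hroot _ _ (Or.inr ⟨this, x, by simp [oddRoot]⟩)
    · have : k = x := Fin.ext (by omega)
      subst this
      exact hself _
  -- The double sum is minus the `𝔬(n)`-block of `X`: by skewness each entry is produced twice,
  -- hence the division by 2. What remains is diagonal.
  have hT : X + ∑ x, ∑ k, ((X : Mat m r) (Sum.inl k) (Sum.inl x) / 2) • R x k ∈ W := by
    refine Submodule.subset_span (Or.inl (Or.inl ?_))
    have hcoe : ∀ i j, ((X + ∑ x, ∑ k, ((X : Mat m r) (Sum.inl k) (Sum.inl x) / 2) • R x k :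
        g0 m r) : Mat m r) i j = (X : Mat m r) i j +
          ∑ x, ∑ k, (X : Mat m r) (Sum.inl k) (Sum.inl x) / 2 * (R x k : Mat m r) i j := by
      intro i j
      simp [Matrix.sum_apply]
    rintro (i | i) (j | j) hij
    · rw [hcoe]
      simp only [hRentry, mul_sub, Finset.sum_sub_distrib, mul_ite, mul_one, mul_zero,
        dualIdx_eq_iff, ite_and]
      simp [g0_apply_dualIdx]
      ring
    · rw [hcoe, g0_apply_eq_zero X (by fin_cases j <;> simp [degree]), zero_add]
      exact Finset.sum_eq_zero fun x _ => Finset.sum_eq_zero fun k _ => mul_zero _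
    · rw [hcoe, g0_apply_eq_zero X (by fin_cases i <;> simp [degree]), zero_add]
      exact Finset.sum_eq_zero fun x _ => Finset.sum_eq_zero fun k _ => mul_zero _
    · rw [hcoe, g0_apply_eq_zero X, zero_add]
      · refine Finset.sum_eq_zero fun x _ => Finset.sum_eq_zero fun k _ => ?_
        fin_cases i <;> fin_cases j <;> simp [R, coe_levi] at hij ⊢
      · fin_cases i <;> fin_cases j <;> simp [degree] at hij ⊢
  have hsum : ∑ x, ∑ k, ((X : Mat m r) (Sum.inl k) (Sum.inl x) / 2) • R x k ∈ W :=
    W.sum_mem fun x _ => W.sum_mem fun k _ => W.smul_mem _ (hR x k)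
  have := W.sub_mem hT hsum
  rwa [add_sub_cancel_right] at this

end OrthoSymplectic

/-! ### Irreducibility and highest weight of the cohomology -/

namespace OrthoSymplectic

open Quadric SymmForm MvPolynomial LieSuperCohomology

variable {m r : ℕ}

theorem toMatrix_levi (A : Matrix (EvenIdx m r) (EvenIdx m r) ℂ) (hA : IsOrtho dualIdx A) :
    LinearMap.toMatrix (oddBasis m r) (oddBasis m r)
      (LieModule.toEnd ℂ (g0 m r) (uOdd m r) (levi A hA 0)) = A := by
  ext i j
  rw [toMatrix_oddBasis]
  simp [coe_levi]

theorem mk_lie (q : ℕ) (X : g0 m r) (c : Z m r q) :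
    ⁅X, (LieSubmodule.Quotient.mk c : H m r q)⁆ = LieSubmodule.Quotient.mk ⁅X, c⁆ := rfl

/-- The index of the coordinate `e*_{δ - ε₁}`. -/
def lowIdx (r : ℕ) (hm : 0 < m) : EvenIdx m r := Sum.inl (Sum.inr ⟨0, hm⟩)

theorem dualIdx_lowIdx_ne (hm : 0 < m) : dualIdx (lowIdx r hm) ≠ lowIdx r hm := by
  simp [dualIdx, lowIdx]

/-- For `n = 2` the quadric is a product of two linear forms and irreducibility fails for `q ≥ 1`.
-/
theorem exists_ne_lowIdx (hm : 0 < m) (hn : 3 ≤ 2 * m + r) :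
    ∃ k, k ≠ lowIdx r hm ∧ k ≠ dualIdx (lowIdx r hm) := by
  by_cases h : 2 ≤ m
  · exact ⟨Sum.inl (Sum.inl ⟨1, h⟩), by simp [lowIdx], by simp [lowIdx, dualIdx]⟩
  · exact ⟨Sum.inr ⟨0, by omega⟩, by simp [lowIdx], by simp [lowIdx, dualIdx]⟩

/-- Powers of the lowest coordinate are not divisible by the quadric. -/
theorem not_form_dvd_X_pow (hm : 0 < m) (q : ℕ) :
    ¬ form (dualIdx (m := m) (r := r)) ∣ X (lowIdx r hm) ^ q := by
  rintro ⟨g, hg⟩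
  -- The basis vector at this index is isotropic, so the quadric vanishes there while the power is
  -- 1.
  have h := congrArg (eval (Pi.single (lowIdx r hm) (1 : ℂ))) hg
  rw [map_mul, map_pow, eval_X, Pi.single_eq_same, one_pow, form, map_sum,
    Finset.sum_eq_zero, zero_mul] at h
  · exact one_ne_zero h
  · intro i _
    rw [map_mul, eval_X, eval_X]
    by_cases hi : i = lowIdx r hm
    · subst hi
      rw [Pi.single_eq_of_ne (dualIdx_lowIdx_ne hm), mul_zero]
    · rw [Pi.single_eq_of_ne hi, zero_mul]

theorem exists_cocyclePoly_eq (hm : 0 < m) (q : ℕ) : ∃ c : Z m r q,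
    (cocyclePoly (actsByDerivations m r) (oddBasis m r) q c : MvPolynomial (EvenIdx m r) ℂ) =
      X (lowIdx r hm) ^ q := by
  obtain ⟨c, hc⟩ := ((isHeisenberg_oddBasis (by omega)).cocyclePoly_bijective
    (actsByDerivations m r) q).2 ⟨X (lowIdx r hm) ^ q, isHomogeneous_X_pow _ q⟩
  exact ⟨c, congrArg Subtype.val hc⟩

/-- The action on the highest weight vector of elements that preserve its line. -/
theorem lie_highest (hm : 0 < m) {q : ℕ} {c : Z m r q}
    (hc : (cocyclePoly (actsByDerivations m r) (oddBasis m r) q c :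
      MvPolynomial (EvenIdx m r) ℂ) = X (lowIdx r hm) ^ q) {X' : g0 m r}
    (hX : ∀ j, j ≠ lowIdx r hm → (X' : Mat m r) (Sum.inl (lowIdx r hm)) (Sum.inl j) = 0) :
    ⁅X', c⁆ = (-(q : ℂ) * ((X' : Mat m r) (Sum.inl (lowIdx r hm)) (Sum.inl (lowIdx r hm)) +
      (X' : Mat m r) (Sum.inr 0) (Sum.inr 0))) • c := by
  refine ((isHeisenberg_oddBasis (by omega)).cocyclePoly_bijective
    (actsByDerivations m r) q).1 (Subtype.ext ?_)
  rw [cocyclePoly_lie, map_smul, Submodule.coe_smul, hc, Derivation.leibniz_pow, linDeriv_X,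
    Finset.sum_eq_single (lowIdx r hm)]
  · rw [toMatrix_oddBasis, if_pos rfl, smul_eq_C_mul]
    cases q with
    | zero => simp
    | succ q =>
      simp only [map_mul, map_neg, map_natCast, nsmul_eq_mul, smul_eq_mul, Nat.add_sub_cancel]
      ring
  · intro j _ hj
    rw [toMatrix_oddBasis, hX j hj, if_neg hj.symm, add_zero, C_0, zero_mul]
  · simp

/-- The entry of `h` at `lowIdx` is `-ε₁(h)`, and a coordinate function carries minus the weight of
its vector: `-q(δ - ε₁) = qε₁ - qδ`. -/
theorem weight_multEps1 (hm : 0 < m) (q : ℕ) (h : g0 m r) :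
    weight (-(q : ℤ)) (multEps1 m q) h =
      -(q : ℂ) * ((h : Mat m r) (Sum.inl (lowIdx r hm)) (Sum.inl (lowIdx r hm)) +
        (h : Mat m r) (Sum.inr 0) (Sum.inr 0)) := by
  have h1 := g0_apply_dualIdx h (Sum.inl (Sum.inl ⟨0, hm⟩)) (Sum.inl (Sum.inl ⟨0, hm⟩))
  simp only [dualIdx, Sum.map_inl, Sum.swap_inl] at h1
  rw [weight, Finset.sum_eq_single ⟨0, hm⟩]
  · rw [lowIdx, h1]
    simp [multEps1]
    ring
  · intro i _ hi
    have : (i : ℕ) ≠ 0 := fun h => hi (Fin.ext h)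
    simp [multEps1, this]
  · simp

/-- All that the irreducibility proof has to know about cochains. Elements with `t = 0` suffice,
because `𝔬(n)` alone acts irreducibly. -/
theorem exists_standard_model (hn : 0 < 2 * m + r) (q : ℕ) :
    ∃ Φ : Z m r q →ₗ[ℂ] homogeneousSubmodule (EvenIdx m r) ℂ q, Function.Bijective Φ ∧
      (∀ c, c ∈ B m r q ↔ form dualIdx ∣ (Φ c : MvPolynomial (EvenIdx m r) ℂ)) ∧
      ∀ (A : Matrix (EvenIdx m r) (EvenIdx m r) ℂ) (hA : IsOrtho dualIdx A) (c : Z m r q),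
        (Φ ⁅levi A hA 0, c⁆ : MvPolynomial (EvenIdx m r) ℂ) =
          linDeriv A (Φ c : MvPolynomial (EvenIdx m r) ℂ) := by
  have hS := isHeisenberg_oddBasis (m := m) (r := r) hn
  refine ⟨cocyclePoly (actsByDerivations m r) (oddBasis m r) q, hS.cocyclePoly_bijective _ q,
    hS.mem_coboundaries_iff _ q, fun A hA c => ?_⟩
  rw [cocyclePoly_lie, toMatrix_levi]

theorem isIrreducible_H (hm : 0 < m) (hn : 3 ≤ 2 * m + r) (q : ℕ) :
    LieModule.IsIrreducible ℂ (g0 m r) (H m r q) := by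
  obtain ⟨Φ, hΦ, hB, hlie⟩ := exists_standard_model (m := m) (r := r) (by omega) q
  obtain ⟨c₀, hc₀⟩ := hΦ.2 ⟨X (lowIdx r hm) ^ q, isHomogeneous_X_pow _ q⟩
  have : Nontrivial (H m r q) := by
    refine ⟨⟨LieSubmodule.Quotient.mk c₀, 0, fun h => not_form_dvd_X_pow (r := r) hm q ?_⟩⟩
    have h1 := (hB c₀).mp (LieSubmodule.Quotient.mk_eq_zero'.mp h)
    rwa [hc₀] at h1
  refine LieModule.IsIrreducible.mk fun N hN => ?_
  -- The full preimage of `N` among polynomials of degree `q`; it contains all multiples of the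
  -- quadric of that degree.
  let N' : Submodule ℂ (MvPolynomial (EvenIdx m r) ℂ) :=
    (N.toSubmodule.comap (LieSubmodule.Quotient.mk' (B m r q)).toLinearMap).map
      ((homogeneousSubmodule (EvenIdx m r) ℂ q).subtype ∘ₗ Φ)
  have hmem : ∀ c : Z m r q, (LieSubmodule.Quotient.mk c : H m r q) ∈ N →
      (Φ c : MvPolynomial (EvenIdx m r) ℂ) ∈ N' := fun c hc => ⟨c, hc, rfl⟩
  obtain ⟨y, hy, hy0⟩ : ∃ y ∈ N, y ≠ 0 := by
    by_contra! h
    exact hN ((LieSubmodule.eq_bot_iff N).mpr h)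
  obtain ⟨c, rfl⟩ := LieSubmodule.Quotient.surjective_mk' _ y
  have key := homogeneousSubmodule_le_of_stable (τ := dualIdx) dualIdx_dualIdx
    (dualIdx_lowIdx_ne (r := r) hm) (exists_ne_lowIdx hm hn) (q := q) (N := N')
    (by rintro _ ⟨c, -, rfl⟩; exact (Φ c).2)
    (by
      rintro A hA _ ⟨c, hc, rfl⟩
      have h1 := hmem ⁅levi A hA 0, c⁆ (by rw [← mk_lie]; exact N.lie_mem hc)
      rw [hlie] at h1
      exact h1)
    (by
      intro f hf hdvd
      obtain ⟨c, hc⟩ := hΦ.2 ⟨f, hf⟩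
      have hcf : (Φ c : MvPolynomial (EvenIdx m r) ℂ) = f := congrArg Subtype.val hc
      rw [← hcf]
      refine hmem c ?_
      rw [LieSubmodule.Quotient.mk_eq_zero'.mpr ((hB c).mpr (hcf ▸ hdvd))]
      exact N.zero_mem)
    (hmem c hy)
    (fun h => hy0 (LieSubmodule.Quotient.mk_eq_zero'.mpr ((hB c).mpr h)))
  rw [eq_top_iff]
  rintro y -
  obtain ⟨c, rfl⟩ := LieSubmodule.Quotient.surjective_mk' _ y
  obtain ⟨c', hc', hcc'⟩ := key (Φ c).2
  have : c' = c := hΦ.1 (Subtype.ext hcc')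
  rw [← this]
  exact hc'

theorem isIrreducibleOfHighestWeight_H (hm : 0 < m) (hn : 3 ≤ 2 * m + r) (q : ℕ) :
    IsIrreducibleOfHighestWeight m r (-(q : ℤ)) (multEps1 m q) (H m r q) := by
  have hS := isHeisenberg_oddBasis (m := m) (r := r) (by omega)
  refine ⟨?_, isIrreducible_H hm hn q, ?_⟩
  · have : FiniteDimensional ℂ (homogeneousSubmodule (EvenIdx m r) ℂ q) :=
      Module.Finite.iff_fg.mpr (homogeneousSubmodule_fg _ _ q)
    have : FiniteDimensional ℂ (Z m r q) := FiniteDimensional.of_injective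
      (cocyclePoly (actsByDerivations m r) (oddBasis m r) q) (hS.cocyclePoly_bijective _ q).1
    exact Module.Finite.of_surjective (LieSubmodule.Quotient.mk' (B m r q)).toLinearMap
      (LieSubmodule.Quotient.surjective_mk' _)
  · obtain ⟨c₀, hc₀⟩ := exists_cocyclePoly_eq (r := r) hm q
    refine ⟨LieSubmodule.Quotient.mk c₀, fun h => not_form_dvd_X_pow (r := r) hm q ?_, ?_, ?_⟩
    · rw [← hc₀]
      exact (hS.mem_coboundaries_iff _ q c₀).mp (LieSubmodule.Quotient.mk_eq_zero'.mp h)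
    · intro h hh
      rw [mk_lie, lie_highest hm hc₀ fun j hj => cartan_apply_of_ne hh (by simpa using hj.symm),
        weight_multEps1 hm]
      rfl
    · intro a ha X hX
      obtain ⟨h1, h2⟩ := isRootVector_apply ha hX hm
      rw [mk_lie, lie_highest hm hc₀ fun j _ => h2 j, lowIdx, h1, h2, add_zero, mul_zero]
      exact congrArg LieSubmodule.Quotient.mk (zero_smul ℂ c₀)

/-- Irreducible modules of the same highest weight are isomorphic. -/
theorem nonempty_equiv_of_isIrreducibleOfHighestWeight (hr : r ≤ 1) {l₀ : ℤ} {l : Fin m → ℤ}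
    {M L : Type*} [AddCommGroup M] [Module ℂ M] [LieRingModule (g0 m r) M]
    [LieModule ℂ (g0 m r) M] [AddCommGroup L] [Module ℂ L] [LieRingModule (g0 m r) L]
    [LieModule ℂ (g0 m r) L] (hM : IsIrreducibleOfHighestWeight m r l₀ l M)
    (hL : IsIrreducibleOfHighestWeight m r l₀ l L) : Nonempty (M ≃ₗ⁅ℂ, g0 m r⁆ L) := by
  obtain ⟨-, iM, v, hv, hvc, hvr⟩ := hM
  obtain ⟨-, iL, w, hw, hwc, hwr⟩ := hL
  refine HighestWeight.nonempty_equiv (span_eq_top hr) (Or.inl dominant_mem) (fun f hf => hf)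
    hv hw ?_
  rintro t (ht | ⟨a, ha, hat⟩)
  · exact ⟨_, hvc t ht, hwc t ht⟩
  · exact ⟨0, by rw [hvr a ha t hat, zero_smul], by rw [hwr a ha t hat, zero_smul]⟩

end OrthoSymplectic

theorem proposition3p4 (m r : ℕ) (hr : r ≤ 1) (hn : 3 ≤ 2 * m + r) :
    (∀ q : ℕ,
      OrthoSymplectic.IsIrreducibleOfHighestWeight m r (-(q : ℤ))
        (OrthoSymplectic.multEps1 m q) (OrthoSymplectic.H m r q) ∧
      ∀ (L : Type*) [AddCommGroup L] [Module ℂ L] [LieRingModule (OrthoSymplectic.g0 m r) L]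
        [LieModule ℂ (OrthoSymplectic.g0 m r) L],
        OrthoSymplectic.IsIrreducibleOfHighestWeight m r (-(q : ℤ))
          (OrthoSymplectic.multEps1 m q) L →
        Nonempty (OrthoSymplectic.H m r q ≃ₗ⁅ℂ, OrthoSymplectic.g0 m r⁆ L)) ∧
    ∃ e : Module.Basis (OrthoSymplectic.EvenIdx m r) ℂ (OrthoSymplectic.uOdd m r),
      OrthoSymplectic.IsRootBasis e ∧
      ∀ q : ℕ, ∃ Φ : OrthoSymplectic.Z m r q ≃ₗ[ℂ]
          MvPolynomial.homogeneousSubmodule (OrthoSymplectic.EvenIdx m r) ℂ q,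
        (∀ (c : OrthoSymplectic.Z m r q) (η : OrthoSymplectic.uOdd m r),
          MvPolynomial.eval (e.repr η) (Φ c : MvPolynomial (OrthoSymplectic.EvenIdx m r) ℂ) =
            c.1.1 0 q Fin.elim0 (fun _ => η)) ∧
        ∀ c : OrthoSymplectic.Z m r q, c ∈ OrthoSymplectic.B m r q ↔
          (Φ c : MvPolynomial (OrthoSymplectic.EvenIdx m r) ℂ) ∈
            Ideal.span {OrthoSymplectic.quadric m r} := by
  -- Since `r ≤ 1` and `n ≥ 3`, the weight `ε₁` exists.
  have hm : 0 < m := by omega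
  have hS := OrthoSymplectic.isHeisenberg_rootBasis (m := m) (r := r) (by omega)
  refine ⟨fun q => ⟨OrthoSymplectic.isIrreducibleOfHighestWeight_H hm hn q, ?_⟩,
    OrthoSymplectic.rootBasis m r, OrthoSymplectic.isRootBasis_rootBasis, fun q =>
      ⟨LinearEquiv.ofBijective _ (hS.cocyclePoly_bijective
        (OrthoSymplectic.actsByDerivations m r) q), ?_, ?_⟩⟩
  · intro L _ _ _ _ hL
    exact OrthoSymplectic.nonempty_equiv_of_isIrreducibleOfHighestWeight hr
      (OrthoSymplectic.isIrreducibleOfHighestWeight_H hm hn q) hL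
  · intro c η
    exact LieSuperCohomology.eval_cocyclePoly _ q c η
  · intro c
    rw [Ideal.mem_span_singleton]
    exact hS.mem_coboundaries_iff _ q c
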